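/- Let $0<q<1$. Write $(a;q)_n=\prod_{k=0}^{n-1}(1-aq^k)$, $(a_1,a_2;q)_n=(a_1;q)_n(a_2;q)_n$, $(a;q)_\infty=\prod_{k\ge 0}(1-aq^k)$, $(x)_n=x(x+1)\cdots(x+n-1)$, and $\Gamma_q(x)=\frac{(q;q)_\infty}{(q^x;q)_\infty}(1-q)^{1-x}$ for $x\in\mathbb{C}$, where $1/\Gamma_q(x)$ is read as $0$ at the poles of $\Gamma_q$. All series below converge absolutely. **Two-variable formulas.** Let $b,c\in\mathbb{C}$ be such that none of $c+1$, $2b+c+1$, $b+c+\frac12$ is a pole of $\Gamma_{q^3}$, i.e. $q^{3c+3+3j}$, $q^{6b+3c+3+3j}$ and $q^{3b+3c+3/2+3j}$ are different from $1$ for all integers $j\ge0$. Put $$N(b,c)=(1-q)(q^2+q+1)^{3b+3c+\frac12}\,\Gamma_{q^3}(c+1)\,\Gamma_{q^3}(b+c+\tfrac12)\,\Gamma_{q^3}(2b+c+1),$$ $$C(b,c)=\frac{N(b,c)}{\Gamma_{q^3}(\frac13)\Gamma_{q^3}(\frac23)\Gamma_q(3b+3c+\frac12)},\qquad R(b,c)=\frac{N(b,c)}{\Gamma_{q^3}(\frac12-b)\Gamma_{q^3}(b+\frac12)\Gamma_q(3b+3c+\frac12)}.$$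 (1) We have $$\sum_{n\ge0}\frac{q^{n^2}(1-q^{3b+3c+4n+\frac12})(q^{\frac12-3b},q^{\frac12+3b};q)_n(q^{3b+3c+\frac12};q)_{2n}}{(q;q)_{2n}(q^{3c+3},q^{3+6b+3c};q^3)_n}=C(b,c)\sum_{n\ge0}\frac{q^{n^2}(q^{\frac12-3b},q^{\frac12+3b};q)_n}{(q;q)_{2n}}=R(b,c).$$ (2) If moreover $q^{2b+2c+1}\ne q^{-b-c+3n-\frac12}$ for all integers $n\ge 0$, then $$\sum_{n\ge0}\frac{(-1)^nq^{3bn-b+3cn-c+\frac{5n^2}2-\frac52}P_q(n)(q^{\frac12-3b},q^{3b+\frac12};q)_{2n}(q^{\frac32-3b-3c};q^3)_n(q^{3b+3c+\frac12};q)_n}{(q^{2b+2c+1}-q^{-b-c+3n-\frac12})(q;q)_{4n+2}(q^{3c+3},q^{6b+3c+3};q^3)_n}=C(b,c)\sum_{n\ge0}\frac{q^{4n^2}T_q(n)(q^{\frac12-3b},q^{3b+\frac12};q)_{2n}}{(q;q)_{4n+2}}$$ and $$\sum_{n\ge0}\frac{(-1)^nq^{3bn-b+3cn-c+\frac{5n^2}2}P_q(n)(q^{\frac12-3b},q^{3b+\frac12};q)_{2n}(q^{\frac32-3b-3c};q^3)_n(q^{3b+3c+\frac12};q)_n}{(q^{2b+2c+1}-q^{-b-c+3n-\frac12})(q;q)_{4n+2}(q^{3c+3},q^{6b+3c+3};q^3)_n}=q^{3b+3}R(b,c),$$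 where $T_q(n)=-q^{3b+4n+5/2}-q^{6b+6n+2}+q^{3b+8n+5/2}+q^{3b+8n+7/2}+q^{3b+1/2}-q^{6n+2}$ and $P_q(n)=-q^{6b+3c+4n+6}-q^{9b+6c+5n+9/2}-q^{9b+6c+5n+11/2}-q^{3b+3c+6n+11/2}-q^{9b+3c+6n+11/2}+q^{6b+6c+7n+6}+q^{12b+6c+7n+6}+q^{6b+3c+8n+3}+q^{6b+3c+8n+4}+q^{6b+3c+8n+6}+q^{6b+3c+8n+7}+q^{9b+6c+9n+11/2}-q^{3b+3c+10n+9/2}-q^{9b+3c+10n+9/2}-q^{6b+3c+12n+4}-q^{9b+6c+13n+15/2}+q^{6b+3c+16n+6}+q^{6b+3c+4}-q^{3b+3n+5/2}+q^{3b+7n+9/2}+q^{6b+9n+4}-q^{3b+11n+9/2}-q^{3b+11n+11/2}+q^{9n+4}$. **Specializations.** For every $0<q<1$, $$\sum_{n\ge0}A_n(q)=\sum_{n\ge0}B_n(q)=\frac{(1-q^2)\sqrt{q^4+q^2+1}}{\Gamma_{q^2}(\frac12)\Gamma_{q^6}(\frac12)}=:R_0(q),$$ where $$A_n(q)=\frac{q^{2n^2}(1-q^{8n+1})(q;q^2)_{2n}(q;q^2)_n^2}{(q^2;q^2)_{2n}(q^6;q^6)_n^2},\qquad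 B_n(q)=\frac{(-1)^nq^{5n^2}p_q(n)(q;q^2)_n(q^3;q^6)_n(q;q^2)_{2n}^2}{(q^{2n+1}+1)(q^{4n+1}+1)(q^{4n+2}+1)(q^2;q^2)_{4n}(q^6;q^6)_n^2}$$ and $p_q(n)=q^{2n+1}+q^{4n+1}+q^{4n+2}+q^{6n+2}+q^{6n+3}+q^{8n+2}+q^{8n+3}-q^{10n+1}+q^{10n+4}-q^{12n+2}-q^{12n+3}-q^{14n+2}-q^{14n+3}-q^{16n+3}-q^{16n+4}-q^{18n+4}-q^{20n+5}+1$. **Classical limits.** These are $q$-analogues of the classical series $$\sum_{n\ge0}\Big(\frac19\Big)^n\frac{(\frac12)_n(\frac14)_n(\frac34)_n}{(1)_n^3}(8n+1)=\frac{2\sqrt3}{\pi},\qquad \sum_{n\ge0}\Big(-\frac1{48}\Big)^n\frac{(\frac12)_n(\frac14)_n(\frac34)_n}{(1)_n^3}(28n+3)=\frac{16}{\sqrt3\,\pi}:$$ both classical evaluations hold and, as $q\to1^-$, for each fixed $n\ge 0$ the quotients $\frac{A_n(q)}{1-q}$ and $\frac{B_n(q)}{1-q}$ tend respectively to the $n$-th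 term of the first series and to $\frac38$ times the $n$-th term of the second, while $\frac{R_0(q)}{1-q}\to\frac{2\sqrt3}{\pi}$. -/

import Mathlib

open Filter Topology

noncomputable section

/-- The finite `q`-Pochhammer symbol `(a; q)_n = ∏_{0 ≤ k < n} (1 - a q^k)`. -/
def qPoch (a q : ℂ) (n : ℕ) : ℂ :=
  ∏ k ∈ Finset.range n, (1 - a * q ^ k)

/-- The infinite `q`-Pochhammer symbol `(a; q)_∞`. -/
def qPochInf (a q : ℂ) : ℂ :=
  ∏' k : ℕ, (1 - a * q ^ k)

/-- The `q`-gamma function `Γ_q(x) = (q; q)_∞ / (q^x; q)_∞ * (1 - q)^(1 - x)`, for `0 < q < 1`.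
At a pole of `Γ_q` (where `(q^x; q)_∞ = 0`) both this value and its inverse are `0`; the latter is
the value of the entire function `1 / Γ_q`. -/
def qGamma (q : ℝ) (x : ℂ) : ℂ :=
  qPochInf q q / qPochInf ((q : ℂ) ^ x) q * ((1 - q : ℝ) : ℂ) ^ (1 - x)

/-- The Pochhammer symbol `(x)_n = x (x + 1) ⋯ (x + n - 1)`. -/
def poch (x : ℝ) (n : ℕ) : ℝ :=
  (ascPochhammer ℝ n).eval x

/-- Summand of the two-variable `q`-analogue of the `8n+1` series. -/
def termA (q : ℝ) (b c : ℂ) (n : ℕ) : ℂ :=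
  (q : ℂ) ^ (n ^ 2) * (1 - (q : ℂ) ^ (3 * b + 3 * c + 4 * n + 1 / 2)) *
    (qPoch ((q : ℂ) ^ (1 / 2 - 3 * b)) q n * qPoch ((q : ℂ) ^ (1 / 2 + 3 * b)) q n) *
    qPoch ((q : ℂ) ^ (3 * b + 3 * c + 1 / 2)) q (2 * n) /
  (qPoch q q (2 * n) *
    (qPoch ((q : ℂ) ^ (3 * c + 3)) (q ^ 3) n * qPoch ((q : ℂ) ^ (3 + 6 * b + 3 * c)) (q ^ 3) n))

/-- Summand of the auxiliary one-variable series attached to `termA`. -/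
def auxA (q : ℝ) (b : ℂ) (n : ℕ) : ℂ :=
  (q : ℂ) ^ (n ^ 2) *
    (qPoch ((q : ℂ) ^ (1 / 2 - 3 * b)) q n * qPoch ((q : ℂ) ^ (1 / 2 + 3 * b)) q n) /
  qPoch q q (2 * n)

/-- The polynomial factor `P_q(n)` in the two-variable `q`-analogue of the `28n+3` series
(all powers are complex powers). -/
def polyB (q b c n : ℂ) : ℂ :=
    -q ^ (6 * b + 3 * c + 4 * n + 6) - q ^ (9 * b + 6 * c + 5 * n + 9 / 2)
      - q ^ (9 * b + 6 * c + 5 * n + 11 / 2) - q ^ (3 * b + 3 * c + 6 * n + 11 / 2)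
      - q ^ (9 * b + 3 * c + 6 * n + 11 / 2) + q ^ (6 * b + 6 * c + 7 * n + 6)
      + q ^ (12 * b + 6 * c + 7 * n + 6) + q ^ (6 * b + 3 * c + 8 * n + 3)
      + q ^ (6 * b + 3 * c + 8 * n + 4) + q ^ (6 * b + 3 * c + 8 * n + 6)
      + q ^ (6 * b + 3 * c + 8 * n + 7) + q ^ (9 * b + 6 * c + 9 * n + 11 / 2)
      - q ^ (3 * b + 3 * c + 10 * n + 9 / 2) - q ^ (9 * b + 3 * c + 10 * n + 9 / 2)
      - q ^ (6 * b + 3 * c + 12 * n + 4) - q ^ (9 * b + 6 * c + 13 * n + 15 / 2)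
      + q ^ (6 * b + 3 * c + 16 * n + 6) + q ^ (6 * b + 3 * c + 4) - q ^ (3 * b + 3 * n + 5 / 2)
      + q ^ (3 * b + 7 * n + 9 / 2) + q ^ (6 * b + 9 * n + 4) - q ^ (3 * b + 11 * n + 9 / 2)
      - q ^ (3 * b + 11 * n + 11 / 2) + q ^ (9 * n + 4)

/-- Summand of the two-variable `q`-analogue of the `28n+3` series. -/
def termB (q : ℝ) (b c : ℂ) (n : ℕ) : ℂ :=
  (-1) ^ n * (q : ℂ) ^ (3 * b * n - b + 3 * c * n - c + 5 * n ^ 2 / 2) * polyB q b c n *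
    (qPoch ((q : ℂ) ^ (1 / 2 - 3 * b)) q (2 * n) * qPoch ((q : ℂ) ^ (3 * b + 1 / 2)) q (2 * n)) *
    qPoch ((q : ℂ) ^ (3 / 2 - 3 * b - 3 * c)) (q ^ 3) n *
    qPoch ((q : ℂ) ^ (3 * b + 3 * c + 1 / 2)) q n /
  (((q : ℂ) ^ (2 * b + 2 * c + 1) - (q : ℂ) ^ (-b - c + 3 * n - 1 / 2)) *
    qPoch q q (4 * n + 2) *
    (qPoch ((q : ℂ) ^ (3 * c + 3)) (q ^ 3) n * qPoch ((q : ℂ) ^ (6 * b + 3 * c + 3)) (q ^ 3) n))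

/-- The polynomial factor of the auxiliary one-variable series attached to `termB`. -/
def auxPolyB (q b n : ℂ) : ℂ :=
    -q ^ (3 * b + 4 * n + 5 / 2) - q ^ (6 * b + 6 * n + 2) + q ^ (3 * b + 8 * n + 5 / 2)
      + q ^ (3 * b + 8 * n + 7 / 2) + q ^ (3 * b + 1 / 2) - q ^ (6 * n + 2)

/-- Summand of the auxiliary one-variable series attached to `termB`. -/
def auxB (q : ℝ) (b : ℂ) (n : ℕ) : ℂ :=
  (q : ℂ) ^ (4 * n ^ 2) * auxPolyB q b n *
    (qPoch ((q : ℂ) ^ (1 / 2 - 3 * b)) q (2 * n) * qPoch ((q : ℂ) ^ (3 * b + 1 / 2)) q (2 * n)) /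
  qPoch q q (4 * n + 2)

/-- Summand of the parameter-free `q`-analogue of the `8n+1` series. -/
def termA₀ (q : ℂ) (n : ℕ) : ℂ :=
  q ^ (2 * n ^ 2) * (1 - q ^ (8 * n + 1)) * qPoch q (q ^ 2) (2 * n) * qPoch q (q ^ 2) n ^ 2 /
  (qPoch (q ^ 2) (q ^ 2) (2 * n) * qPoch (q ^ 6) (q ^ 6) n ^ 2)

/-- The polynomial factor of the parameter-free `q`-analogue of the `28n+3` series. -/
def polyB₀ (q : ℂ) (n : ℕ) : ℂ :=
    q ^ (2 * n + 1) + q ^ (4 * n + 1) + q ^ (4 * n + 2) + q ^ (6 * n + 2) + q ^ (6 * n + 3)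
      + q ^ (8 * n + 2) + q ^ (8 * n + 3) - q ^ (10 * n + 1) + q ^ (10 * n + 4)
      - q ^ (12 * n + 2) - q ^ (12 * n + 3) - q ^ (14 * n + 2) - q ^ (14 * n + 3)
      - q ^ (16 * n + 3) - q ^ (16 * n + 4) - q ^ (18 * n + 4) - q ^ (20 * n + 5) + 1

/-- Summand of the parameter-free `q`-analogue of the `28n+3` series. -/
def termB₀ (q : ℂ) (n : ℕ) : ℂ :=
  (-1) ^ n * q ^ (5 * n ^ 2) * polyB₀ q n *
    qPoch q (q ^ 2) n * qPoch (q ^ 3) (q ^ 6) n * qPoch q (q ^ 2) (2 * n) ^ 2 /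
  ((q ^ (2 * n + 1) + 1) * (q ^ (4 * n + 1) + 1) * (q ^ (4 * n + 2) + 1) *
    qPoch (q ^ 2) (q ^ 2) (4 * n) * qPoch (q ^ 6) (q ^ 6) n ^ 2)

/-- The common right-hand side of the two parameter-free `q`-analogues. -/
def rhs₀ (q : ℝ) : ℂ :=
  (((1 - q ^ 2) * √(q ^ 4 + q ^ 2 + 1) : ℝ) : ℂ) /
    (qGamma (q ^ 2) (1 / 2) * qGamma (q ^ 6) (1 / 2))

/-- Summand of the classical `8n+1` series. -/
def classicalA (n : ℕ) : ℝ :=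
  (1 / 9) ^ n * (poch (1 / 2) n * poch (1 / 4) n * poch (3 / 4) n / poch 1 n ^ 3) * (8 * n + 1)

/-- Summand of the classical `28n+3` series. -/
def classicalB (n : ℕ) : ℝ :=
  (-1 / 48) ^ n * (poch (1 / 2) n * poch (1 / 4) n * poch (3 / 4) n / poch 1 n ^ 3) * (28 * n + 3)

end

/-! Put a = q^(1/2+3b), z = q^(3c) and D = (zq³, a²zq², azq; q³)_∞ (`denomInf`). Multiplied by D,
and divided by q^(3b+3) in the second case, the two-variable summands become terms F_n(z) without
poles in z (`clearedA`, `clearedB`). Each has a companion G_n(z) of WZ type with F_n(z) − (az;q)_3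
F_n(zq³) = G_{n+1}(z) − G_n(z), G_0 = 0 and G_n → 0 (`clearedA_sub`, `clearedB_sub`). Summing over n
and iterating gives ΣF_n(z) = (az;q)_{3k} ΣF_n(zq^(3k)), and k → ∞ under domination leaves (az;q)_∞
ΣF_n(0) (`hasSum_of_telescoping`).

For the first family ΣF_n(0) is S(a) = Σ q^(n²) (a, q/a; q)_n / (q;q)_{2n}; for the second it is the
same series with the terms 2n and 2n+1 grouped (`limitB_eq_add`). Hence both families have the value
(az;q)_∞ S(a) / D.

S(a) is evaluated by Bailey's method (`hasSum_bailey`): the finite Jacobi triple product expands the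
summand over r ∈ ℤ, the inner sum over n is a Durfee rectangle sum, and what remains is a theta
series in base q³, a product by Jacobi's identity. In q-gamma notation (az;q)_∞ / D is C(b,c) and
(az;q)_∞ S(a) / D is R(b,c).

The 24-term polynomial P_q(n) is a monomial times the denominator q^(2b+2c+1) − q^(−b−c+3n−1/2)
times the short factor `factorB` (`polyB_eq`), so that denominator cancels.

The one-parameter series are the case b = c = 0 in base q². The classical series follow by letting q
→ 1⁻: the terms divided by 1 − q have a geometric majorant for 4/5 < q < 1, and a q-Wallis product
gives Γ_{q²}(1/2) → √π. -/

/-! ### Finite and infinite q-Pochhammer symbols: convergence and bounds. -/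

theorem qPoch_zero (a q : ℂ) : qPoch a q 0 = 1 := by simp [qPoch]

theorem qPoch_succ (a q : ℂ) (n : ℕ) : qPoch a q (n + 1) = qPoch a q n * (1 - a * q ^ n) := by
  simp [qPoch, Finset.prod_range_succ]

theorem qPoch_add (a q : ℂ) (m n : ℕ) :
    qPoch a q (m + n) = qPoch a q m * qPoch (a * q ^ m) q n := by
  simp only [qPoch, Finset.prod_range_add]
  congr 1
  exact Finset.prod_congr rfl fun k _ => by ring

theorem qPoch_succ_left (a q : ℂ) (n : ℕ) :
    qPoch a q (n + 1) = (1 - a) * qPoch (a * q) q n := by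
  rw [add_comm, qPoch_add]
  simp [qPoch]

theorem qPoch_eq_zero_iff (a q : ℂ) (n : ℕ) : qPoch a q n = 0 ↔ ∃ k < n, a * q ^ k = 1 := by
  simp only [qPoch, Finset.prod_eq_zero_iff, Finset.mem_range, sub_eq_zero, eq_comm (a := (1 : ℂ))]

theorem summable_norm_mul_pow {q : ℂ} (hq : ‖q‖ < 1) (a : ℂ) :
    Summable fun k : ℕ => ‖-(a * q ^ k)‖ := by
  simp only [norm_neg, norm_mul, norm_pow]
  exact (summable_geometric_of_lt_one (norm_nonneg _) hq).mul_left _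

theorem multipliable_qPoch {q : ℂ} (hq : ‖q‖ < 1) (a : ℂ) :
    Multipliable fun k : ℕ => 1 - a * q ^ k := by
  simpa [sub_eq_add_neg] using multipliable_one_add_of_summable (summable_norm_mul_pow hq a)

theorem tendsto_qPoch {q : ℂ} (hq : ‖q‖ < 1) (a : ℂ) :
    Tendsto (qPoch a q) atTop (𝓝 (qPochInf a q)) :=
  (multipliable_qPoch hq a).hasProd.tendsto_prod_nat

theorem qPochInf_eq {q : ℂ} (hq : ‖q‖ < 1) (a : ℂ) (n : ℕ) :
    qPochInf a q = qPoch a q n * qPochInf (a * q ^ n) q := by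
  refine tendsto_nhds_unique ((tendsto_add_atTop_iff_nat n).2 (tendsto_qPoch hq a)) ?_
  simp_rw [add_comm _ n, qPoch_add]
  exact (tendsto_qPoch hq _).const_mul _

theorem qPochInf_eq_one_sub_mul {q : ℂ} (hq : ‖q‖ < 1) (a : ℂ) :
    qPochInf a q = (1 - a) * qPochInf (a * q) q := by
  rw [qPochInf_eq hq a 1]; simp [qPoch]

theorem qPochInf_ne_zero {q : ℂ} (hq : ‖q‖ < 1) {a : ℂ} (h : ∀ k : ℕ, a * q ^ k ≠ 1) :
    qPochInf a q ≠ 0 := by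
  have := tprod_one_add_ne_zero_of_summable (f := fun k : ℕ => -(a * q ^ k))
    (fun k => by rw [← sub_eq_add_neg, sub_ne_zero]; exact (h k).symm) (summable_norm_mul_pow hq a)
  simpa [qPochInf, sub_eq_add_neg] using this

theorem mul_pow_ne_one_of_norm_lt {q : ℂ} (hq : ‖q‖ < 1) {a : ℂ} (ha : ‖a‖ < 1) (k : ℕ) :
    a * q ^ k ≠ 1 := by
  intro h
  have h1 : ‖a * q ^ k‖ < 1 := by
    rw [norm_mul, norm_pow]
    exact mul_lt_one_of_nonneg_of_lt_one_left (norm_nonneg _) ha (pow_le_one₀ (norm_nonneg _) hq.le)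
  rw [h] at h1
  simp at h1

theorem qPochInf_ne_zero_of_norm_lt {q : ℂ} (hq : ‖q‖ < 1) {a : ℂ} (ha : ‖a‖ < 1) :
    qPochInf a q ≠ 0 :=
  qPochInf_ne_zero hq (mul_pow_ne_one_of_norm_lt hq ha)

theorem qPoch_self_ne_zero {q : ℂ} (hq : ‖q‖ < 1) (n : ℕ) : qPoch q q n ≠ 0 := by
  rw [Ne, qPoch_eq_zero_iff]
  rintro ⟨k, -, h⟩
  exact mul_pow_ne_one_of_norm_lt hq hq k h

/-- From 1 + t ≤ e^t and the geometric series. The bound depends on `a` only through `R`, so it is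
uniform in n and on discs. -/
theorem norm_qPoch_le {q : ℂ} (hq : ‖q‖ < 1) {a : ℂ} {R : ℝ} (ha : ‖a‖ ≤ R) (n : ℕ) :
    ‖qPoch a q n‖ ≤ Real.exp (R * (1 - ‖q‖)⁻¹) := by
  calc ‖qPoch a q n‖ ≤ ∏ k ∈ Finset.range n, Real.exp (‖a‖ * ‖q‖ ^ k) := by
        refine (Finset.norm_prod_le _ _).trans
          (Finset.prod_le_prod (fun _ _ => norm_nonneg _) fun k _ => ?_)
        have h1 : ‖1 - a * q ^ k‖ ≤ 1 + ‖a‖ * ‖q‖ ^ k := by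
          simpa [norm_mul, norm_pow] using norm_sub_le (1 : ℂ) (a * q ^ k)
        linarith [Real.add_one_le_exp (‖a‖ * ‖q‖ ^ k)]
    _ = Real.exp (‖a‖ * ∑ k ∈ Finset.range n, ‖q‖ ^ k) := by
        rw [← Real.exp_sum, Finset.mul_sum]
    _ ≤ _ := by
        refine Real.exp_le_exp.2 (mul_le_mul ha ?_ (Finset.sum_nonneg fun _ _ => by positivity)
          ((norm_nonneg a).trans ha))
        rw [← tsum_geometric_of_lt_one (norm_nonneg _) hq]
        exact (summable_geometric_of_lt_one (norm_nonneg _) hq).sum_le_tsum _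
          fun _ _ => by positivity

theorem norm_qPochInf_le {q : ℂ} (hq : ‖q‖ < 1) {a : ℂ} {R : ℝ} (ha : ‖a‖ ≤ R) :
    ‖qPochInf a q‖ ≤ Real.exp (R * (1 - ‖q‖)⁻¹) :=
  le_of_tendsto (tendsto_qPoch hq a).norm (Eventually.of_forall fun n => norm_qPoch_le hq ha n)

/-- 1/(q;q)_n = (q^(n+1);q)_∞ / (q;q)_∞, whose numerator is bounded and whose denominator is a
nonzero constant. -/
theorem exists_norm_inv_qPoch_self_le {q : ℂ} (hq : ‖q‖ < 1) :
    ∃ K : ℝ, 0 < K ∧ ∀ n, ‖(qPoch q q n)⁻¹‖ ≤ K := by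
  have h0 := qPochInf_ne_zero_of_norm_lt hq hq
  refine ⟨Real.exp (1 * (1 - ‖q‖)⁻¹) / ‖qPochInf q q‖, by positivity, fun n => ?_⟩
  have h1 := qPochInf_eq hq q n
  have h2 : ‖qPochInf (q * q ^ n) q‖ ≤ Real.exp (1 * (1 - ‖q‖)⁻¹) := by
    refine norm_qPochInf_le hq ?_
    rw [norm_mul, norm_pow]
    exact mul_le_one₀ hq.le (by positivity) (pow_le_one₀ (norm_nonneg _) hq.le)
  rw [le_div_iff₀ (norm_pos_iff.2 h0), h1, norm_mul, norm_inv, inv_mul_cancel_left₀]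
  · exact h2
  · exact norm_ne_zero_iff.2 (qPoch_self_ne_zero hq n)

theorem tendsto_qPochInf_one {q : ℂ} (hq : ‖q‖ < 1) {f : ℕ → ℂ} (hf : Tendsto f atTop (𝓝 0)) :
    Tendsto (fun k => qPochInf (f k) q) atTop (𝓝 1) := by
  have := tendsto_tprod_one_add_of_dominated_convergence (𝓕 := atTop)
    (f := fun k j => -(f k * q ^ j)) (g := fun _ => 0) (bound := fun j => ‖q‖ ^ j)
    (summable_geometric_of_lt_one (norm_nonneg _) hq)
    (fun j => by simpa using (hf.mul_const (q ^ j)).neg) ?_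
  · simpa [qPochInf, sub_eq_add_neg] using this
  · have h1 : ∀ᶠ k in atTop, ‖f k‖ < 1 := by
      have := hf.norm
      rw [norm_zero] at this
      exact this.eventually_lt_const one_pos
    filter_upwards [h1] with k hk j
    rw [norm_neg, norm_mul, norm_pow]
    exact mul_le_of_le_one_left (by positivity) hk.le

theorem tendsto_qPoch_one {q : ℂ} {f : ℕ → ℂ} (hf : Tendsto f atTop (𝓝 0)) (n : ℕ) :
    Tendsto (fun k => qPoch (f k) q n) atTop (𝓝 1) := by
  have := tendsto_finsetProd (Finset.range n) (f := fun j k => 1 - f k * q ^ j) (a := fun _ => 1)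
    (x := atTop) fun j _ => by simpa using (hf.mul_const (q ^ j)).const_sub 1
  simpa [qPoch] using this

/-! ### Telescoping families and the dominating series. -/

/-- Summation by a telescoping pair: if the rows `t k` differ by telescoping differences that
vanish at both ends and converge dominatedly to `s`, then `t 0` and `s` have the same sum. -/
theorem hasSum_of_telescoping {t g : ℕ → ℕ → ℂ} {s : ℕ → ℂ} {bound : ℕ → ℝ}
    (hb : Summable bound) (hbound : ∀ k n, ‖t k n‖ ≤ bound n)
    (hlim : ∀ n, Tendsto (fun k => t k n) atTop (𝓝 (s n)))
    (htel : ∀ k n, t k n - t (k + 1) n = g k (n + 1) - g k n)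
    (hg0 : ∀ k, g k 0 = 0) (hg : ∀ k, Tendsto (g k) atTop (𝓝 0)) :
    HasSum (t 0) (∑' n, s n) := by
  have hs : ∀ k, Summable (t k) := fun k => hb.of_norm_bounded (hbound k)
  have hstep : ∀ k, ∑' n, t k n = ∑' n, t (k + 1) n := by
    intro k
    rw [← sub_eq_zero, ← (hs k).tsum_sub (hs (k + 1))]
    refine tendsto_nhds_unique ((hs k).sub (hs (k + 1))).hasSum.tendsto_sum_nat ?_
    simp_rw [htel, Finset.sum_range_sub, hg0, sub_zero]
    exact hg k
  have hconst : ∀ k, ∑' n, t k n = ∑' n, t 0 n := by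
    intro k
    induction k with
    | zero => rfl
    | succ k ih => rw [← hstep, ih]
  have hT := tendsto_tsum_of_dominated_convergence (𝓕 := atTop) hb hlim
    (Eventually.of_forall fun k n => hbound k n)
  simp_rw [hconst] at hT
  rw [tendsto_nhds_unique hT tendsto_const_nhds]
  exact (hs 0).hasSum

/-- A Gaussian factor beats any geometric growth: consecutive terms have ratio R ρ^n → 0. This
majorant serves the theta series and `clearedB`. -/
theorem summable_pow_mul_pow_choose {ρ : ℝ} (h0 : 0 < ρ) (h1 : ρ < 1) {R : ℝ} (hR : 0 < R) :
    Summable fun n : ℕ => R ^ n * ρ ^ (n.choose 2) := by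
  refine summable_of_ratio_test_tendsto_lt_one zero_lt_one
    (Eventually.of_forall fun n => by positivity) ?_
  have : (fun n : ℕ => ‖R ^ (n + 1) * ρ ^ ((n + 1).choose 2)‖ / ‖R ^ n * ρ ^ (n.choose 2)‖) =
      fun n => R * ρ ^ n := by
    funext n
    rw [Real.norm_of_nonneg (by positivity), Real.norm_of_nonneg (by positivity),
      Nat.choose_succ_succ' n 1, Nat.choose_one_right, pow_succ]
    simp only [Nat.reduceAdd]
    rw [pow_add]
    field_simp
  rw [this]
  simpa using (tendsto_pow_atTop_nhds_zero_of_lt_one h0.le h1).const_mul R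

/-! ### The q-binomial theorem and the Jacobi triple product. -/

/-- The Gaussian binomial coefficient. -/
noncomputable def gaussBinom (q : ℂ) : ℕ → ℕ → ℂ
  | _, 0 => 1
  | 0, _ + 1 => 0
  | n + 1, k + 1 => gaussBinom q n (k + 1) + q ^ (n - k) * gaussBinom q n k

theorem gaussBinom_zero_right (q : ℂ) (n : ℕ) : gaussBinom q n 0 = 1 := by
  cases n <;> simp [gaussBinom]

/-- Makes the truncated exponent `n - k` in the recursion harmless: when truncation occurs, it
multiplies a zero coefficient. -/
theorem gaussBinom_eq_zero_of_lt (q : ℂ) {n k : ℕ} (h : n < k) : gaussBinom q n k = 0 := by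
  induction n generalizing k with
  | zero =>
    obtain ⟨k, rfl⟩ := Nat.exists_eq_succ_of_ne_zero h.ne'
    simp [gaussBinom]
  | succ n ih =>
    obtain ⟨k, rfl⟩ := Nat.exists_eq_succ_of_ne_zero (Nat.ne_zero_of_lt h)
    simp [gaussBinom, ih (k := k + 1) (by omega), ih (k := k) (by omega)]

theorem gaussBinom_mul_qPoch (q : ℂ) (m k : ℕ) :
    gaussBinom q (m + k) k * (qPoch q q m * qPoch q q k) = qPoch q q (m + k) := by
  induction k generalizing m with
  | zero => simp [gaussBinom_zero_right, qPoch_zero]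
  | succ k ihk =>
    have hs : ∀ j, qPoch q q (j + 1) = qPoch q q j * (1 - q ^ (j + 1)) := fun j => by
      rw [qPoch_succ, pow_succ']
    induction m with
    | zero =>
      have := ihk 0
      rw [zero_add] at this
      rw [zero_add, gaussBinom, gaussBinom_eq_zero_of_lt q (Nat.lt_succ_self k), hs]
      simp only [qPoch_zero] at this ⊢
      simp only [Nat.sub_self, pow_zero]
      linear_combination (1 - q ^ (k + 1)) * this
    | succ m ihm =>
      have h1 := ihk (m + 1)
      have e1 : m + 1 + (k + 1) = (m + 1 + k) + 1 := by ring
      have e2 : m + (k + 1) = m + 1 + k := by ring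
      rw [e2] at ihm
      rw [e1, gaussBinom, hs (m + 1 + k), Nat.add_sub_cancel]
      rw [hs k] at ihm ⊢
      rw [hs m] at h1 ⊢
      -- The two terms of Pascal's rule come from the inner hypothesis (m, k+1) and the outer one
      -- (m+1, k); their weights add up to 1 − q^(m+k+2).
      linear_combination (1 - q ^ (m + 1)) * ihm + q ^ (m + 1) * (1 - q ^ (k + 1)) * h1

/-- The finite q-binomial theorem: by Pascal's rule, multiplication by 1 − x q^n raises n by one in
the coefficients. -/
theorem qPoch_eq_sum_gaussBinom (x q : ℂ) (n : ℕ) :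
    qPoch x q n =
      ∑ k ∈ Finset.range (n + 1), (-x) ^ k * q ^ (k.choose 2) * gaussBinom q n k := by
  induction n with
  | zero => simp [qPoch_zero, gaussBinom_zero_right]
  | succ n ih =>
    rw [Finset.sum_range_succ', qPoch_succ, mul_sub, mul_one]
    have h : ∀ k ∈ Finset.range (n + 1),
        (-x) ^ (k + 1) * q ^ ((k + 1).choose 2) * gaussBinom q (n + 1) (k + 1) =
        (-x) ^ (k + 1) * q ^ ((k + 1).choose 2) * gaussBinom q n (k + 1) -
          (-x) ^ k * q ^ (k.choose 2) * gaussBinom q n k * (x * q ^ n) := by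
      intro k hk
      have hk' : k ≤ n := Nat.lt_succ_iff.1 (Finset.mem_range.1 hk)
      rw [gaussBinom, Nat.choose_succ_succ' k 1, Nat.choose_one_right]
      have : q ^ n = q ^ k * q ^ (n - k) := by rw [← pow_add, Nat.add_sub_cancel' hk']
      rw [this, pow_add]
      ring
    rw [Finset.sum_congr rfl h, Finset.sum_sub_distrib, ← Finset.sum_mul, ← ih]
    have h2 := Finset.sum_range_succ'
      (fun k => (-x) ^ k * q ^ (k.choose 2) * gaussBinom q n k) (n + 1)
    rw [Finset.sum_range_succ, ← ih, gaussBinom_eq_zero_of_lt q (Nat.lt_succ_self n)] at h2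
    simp only [gaussBinom_zero_right] at h2 ⊢
    linear_combination h2

/-- The summand `(-x)^r q^{r(r-1)/2}` of the Jacobi theta series. -/
noncomputable def thetaTerm (x q : ℂ) (r : ℤ) : ℂ := (-x) ^ r * q ^ (r * (r - 1) / 2)

/-- Reversal of the product: 1 − x q^(−j) = −x q^(−j) (1 − q^j / x) for 1 ≤ j ≤ n. It yields the
finite triple product, and later absorbs the alternating sign of `termB`. -/
theorem qPoch_mul_pow_neg {x q : ℂ} (hx : x ≠ 0) (hq : q ≠ 0) (n : ℕ) :
    qPoch (x * (q ^ n)⁻¹) q n * q ^ ((n + 1).choose 2) = (-x) ^ n * qPoch (q / x) q n := by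
  induction n with
  | zero => simp [qPoch_zero]
  | succ n ih =>
    have e : x * (q ^ (n + 1))⁻¹ * q = x * (q ^ n)⁻¹ := by
      rw [pow_succ]; field_simp
    rw [qPoch_succ_left, e, Nat.choose_succ_succ' (n + 1) 1, Nat.choose_one_right, pow_add,
      qPoch_succ, pow_succ (-x)]
    have : (1 - x * (q ^ (n + 1))⁻¹) * q ^ (n + 1) = (-x) * (1 - q / x * q ^ n) := by
      rw [pow_succ]; field_simp; ring
    linear_combination (qPoch (x * (q ^ n)⁻¹) q n * q ^ ((n + 1).choose 2)) * this +
      (-x) * (1 - q / x * q ^ n) * ih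

theorem choose_two_cast (k : ℕ) : ((k.choose 2 : ℕ) : ℤ) * 2 = k * (k - 1) := by
  induction k with
  | zero => simp
  | succ k ih =>
    rw [Nat.choose_succ_succ' k 1, Nat.choose_one_right]
    push_cast
    linear_combination ih

theorem int_choose_two (r : ℤ) : r * (r - 1) / 2 * 2 = r * (r - 1) :=
  Int.ediv_mul_cancel (even_iff_two_dvd.1 (by simpa using Int.even_mul_pred_self r))

/-- The finite Jacobi triple product: the q-binomial theorem of length 2n at x q^(−n), recentred at
the middle index. -/
theorem qPoch_mul_qPoch_eq_sum {x q : ℂ} (hx : x ≠ 0) (hq : q ≠ 0) (n : ℕ) :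
    qPoch x q n * qPoch (q / x) q n =
      ∑ k ∈ Finset.range (2 * n + 1), thetaTerm x q ((k : ℤ) - n) * gaussBinom q (2 * n) k := by
  have h := qPoch_eq_sum_gaussBinom (x * (q ^ n)⁻¹) q (2 * n)
  have hqn : q ^ n ≠ 0 := pow_ne_zero _ hq
  rw [two_mul, qPoch_add, inv_mul_cancel_right₀ hqn, ← two_mul] at h
  have h2 := qPoch_mul_pow_neg hx hq n
  have hxn : (-x) ^ n ≠ 0 := pow_ne_zero _ (neg_ne_zero.2 hx)
  apply mul_left_cancel₀ hxn
  calc (-x) ^ n * (qPoch x q n * qPoch (q / x) q n)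
      = (qPoch (x * (q ^ n)⁻¹) q n * qPoch x q n) * q ^ ((n + 1).choose 2) := by
        linear_combination (-qPoch x q n) * h2
    _ = _ := by
        rw [h, Finset.sum_mul, Finset.mul_sum]
        refine Finset.sum_congr rfl fun k _ => ?_
        rw [← mul_assoc ((-x) ^ n), mul_right_comm]
        congr 1
        rw [thetaTerm, ← mul_assoc, zpow_sub₀ (neg_ne_zero.2 hx), zpow_natCast, zpow_natCast,
          mul_div_cancel₀ _ hxn, neg_mul_eq_neg_mul, mul_pow, mul_assoc, mul_assoc]
        congr 1
        rw [inv_pow, ← pow_mul, ← zpow_natCast, ← zpow_natCast, ← zpow_natCast, ← zpow_neg,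
          ← zpow_add₀ hq, ← zpow_add₀ hq]
        congr 1
        have e1 := choose_two_cast k
        have e2 := choose_two_cast (n + 1)
        have e3 := int_choose_two ((k : ℤ) - n)
        push_cast at *
        refine mul_right_cancel₀ (two_ne_zero' ℤ) ?_
        linear_combination e1 + e2 - e3

/-- The coefficient `1 / ((q; q)_{n-s} (q; q)_{n+s})`, zero for `n < s`. -/
noncomputable def baileyCoeff (q : ℂ) (n s : ℕ) : ℂ :=
  if s ≤ n then (qPoch q q (n - s) * qPoch q q (n + s))⁻¹ else 0

/-- A Bailey pair relative to 1. Since the coefficient vanishes for |r| > n, the finite sum can be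
written over all of ℤ, which prepares both the limit n → ∞ and the interchange of sums. -/
theorem hasSum_baileyCoeff_mul_thetaTerm {x q : ℂ} (hx : x ≠ 0) (hq : q ≠ 0) (hq1 : ‖q‖ < 1)
    (n : ℕ) :
    HasSum (fun r : ℤ => baileyCoeff q n r.natAbs * thetaTerm x q r)
      (qPoch x q n * qPoch (q / x) q n / qPoch q q (2 * n)) := by
  have h : qPoch x q n * qPoch (q / x) q n / qPoch q q (2 * n) =
      ∑ r ∈ Finset.Icc (-(n : ℤ)) n, baileyCoeff q n r.natAbs * thetaTerm x q r := by
    rw [qPoch_mul_qPoch_eq_sum hx hq, Finset.sum_div]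
    refine Finset.sum_bij (fun k _ => (k : ℤ) - n) ?_ ?_ ?_ ?_
    · intro k hk
      rw [Finset.mem_range] at hk
      rw [Finset.mem_Icc]
      omega
    · intro k _ l _ h
      have h' : (k : ℤ) - n = l - n := h
      omega
    · intro r hr
      rw [Finset.mem_Icc] at hr
      exact ⟨(r + n).toNat, by rw [Finset.mem_range]; omega, by simp; omega⟩
    · intro k hk
      rw [Finset.mem_range] at hk
      rw [mul_div_assoc, mul_comm]
      congr 1
      have hne := qPoch_self_ne_zero hq1
      have hb : gaussBinom q (2 * n) k / qPoch q q (2 * n) =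
          (qPoch q q (2 * n - k) * qPoch q q k)⁻¹ := by
        have h1 := gaussBinom_mul_qPoch q (2 * n - k) k
        rw [Nat.sub_add_cancel (by omega)] at h1
        rw [div_eq_iff (hne _), ← h1]
        field_simp [hne k, hne (2 * n - k)]
      rw [hb, baileyCoeff, if_pos (by omega)]
      rcases le_total k n with hkn | hkn
      · have e1 : n - ((k : ℤ) - n).natAbs = k := by omega
        have e2 : n + ((k : ℤ) - n).natAbs = 2 * n - k := by omega
        rw [e1, e2, mul_comm]
      · have e1 : n - ((k : ℤ) - n).natAbs = 2 * n - k := by omega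
        have e2 : n + ((k : ℤ) - n).natAbs = k := by omega
        rw [e1, e2]
  rw [h]
  refine hasSum_sum_of_ne_finset_zero fun r hr => ?_
  rw [baileyCoeff, if_neg, zero_mul]
  rw [Finset.mem_Icc] at hr
  omega

theorem summable_norm_thetaTerm {x q : ℂ} (hx : x ≠ 0) (hq : q ≠ 0) (hq1 : ‖q‖ < 1) :
    Summable fun r : ℤ => ‖thetaTerm x q r‖ := by
  have key : ∀ (k : ℕ), (k : ℤ) * (k - 1) / 2 = (k.choose 2 : ℕ) := fun k =>
    Int.ediv_eq_of_eq_mul_left two_ne_zero (choose_two_cast k).symm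
  have key' : ∀ (k : ℕ), (-(k : ℤ)) * (-k - 1) / 2 = (k.choose 2 : ℕ) + k := fun k =>
    Int.ediv_eq_of_eq_mul_left two_ne_zero (by linear_combination -choose_two_cast k)
  refine Summable.of_nat_of_neg ?_ ?_
  · refine (summable_pow_mul_pow_choose (norm_pos_iff.2 hq) hq1 (norm_pos_iff.2 hx)).congr
      fun k => ?_
    rw [thetaTerm, key, zpow_natCast, zpow_natCast, norm_mul, norm_pow, norm_pow, norm_neg]
  · have hR : 0 < ‖x‖⁻¹ * ‖q‖ := by
      have := norm_pos_iff.2 hx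
      have := norm_pos_iff.2 hq
      positivity
    refine (summable_pow_mul_pow_choose (norm_pos_iff.2 hq) hq1 hR).congr fun k => ?_
    rw [thetaTerm, key', zpow_neg, zpow_natCast, ← Nat.cast_add, zpow_natCast, norm_mul, norm_inv,
      norm_pow, norm_pow, norm_neg, mul_pow, inv_pow, pow_add]
    ring

theorem exists_norm_baileyCoeff_le {q : ℂ} (hq : ‖q‖ < 1) :
    ∃ K : ℝ, 0 < K ∧ ∀ n s, ‖baileyCoeff q n s‖ ≤ K := by
  obtain ⟨K, hK, h⟩ := exists_norm_inv_qPoch_self_le hq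
  refine ⟨K * K, by positivity, fun n s => ?_⟩
  rw [baileyCoeff]
  split_ifs
  · rw [mul_inv, norm_mul]
    exact mul_le_mul (h _) (h _) (norm_nonneg _) hK.le
  · rw [norm_zero]; positivity

/-- The Jacobi triple product identity. -/
theorem tsum_thetaTerm {x q : ℂ} (hx : x ≠ 0) (hq : q ≠ 0) (hq1 : ‖q‖ < 1) :
    ∑' r, thetaTerm x q r = qPochInf x q * qPochInf (q / x) q * qPochInf q q := by
  obtain ⟨K, hK, hKb⟩ := exists_norm_baileyCoeff_le hq1
  have h0 := qPochInf_ne_zero_of_norm_lt hq1 hq1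
  have ht := tendsto_qPoch hq1 q
  -- In the finite form every coefficient tends to (q;q)_∞^(−2) under a uniform bound, so n → ∞ may
  -- be taken termwise.
  have hlim := tendsto_tsum_of_dominated_convergence (𝓕 := atTop)
    (f := fun (n : ℕ) (r : ℤ) => baileyCoeff q n r.natAbs * thetaTerm x q r)
    (g := fun r => (qPochInf q q * qPochInf q q)⁻¹ * thetaTerm x q r)
    ((summable_norm_thetaTerm hx hq hq1).mul_left K) ?_ ?_
  · simp_rw [(hasSum_baileyCoeff_mul_thetaTerm hx hq hq1 _).tsum_eq] at hlim
    have h2 : Tendsto (fun n => qPoch x q n * qPoch (q / x) q n / qPoch q q (2 * n)) atTop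
        (𝓝 (qPochInf x q * qPochInf (q / x) q / qPochInf q q)) :=
      ((tendsto_qPoch hq1 x).mul (tendsto_qPoch hq1 (q / x))).div
        (ht.comp (tendsto_id.const_mul_atTop' two_pos)) h0
    have h3 := tendsto_nhds_unique hlim h2
    rw [tsum_mul_left] at h3
    field_simp at h3
    linear_combination h3
  · intro r
    refine Tendsto.mul_const _ ?_
    have h1 : Tendsto (fun n => (qPoch q q (n - r.natAbs) * qPoch q q (n + r.natAbs))⁻¹) atTop
        (𝓝 (qPochInf q q * qPochInf q q)⁻¹) :=
      ((ht.comp (tendsto_sub_atTop_nat _)).mul (ht.comp (tendsto_add_atTop_nat _))).inv₀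
        (mul_ne_zero h0 h0)
    refine h1.congr' ?_
    filter_upwards [eventually_ge_atTop r.natAbs] with n hn
    rw [baileyCoeff, if_pos hn]
  · refine Eventually.of_forall fun n r => ?_
    rw [norm_mul]
    exact mul_le_mul_of_nonneg_right (hKb _ _) (norm_nonneg _)

/-! ### Durfee sums and the evaluation of the one-variable series. -/

theorem summable_pow_sq {ρ : ℝ} (h0 : 0 < ρ) (h1 : ρ < 1) : Summable fun n : ℕ => ρ ^ (n ^ 2) := by
  refine Summable.of_nonneg_of_le (fun n => by positivity) (fun n => ?_)
    (summable_geometric_of_lt_one h0.le h1)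
  exact pow_le_pow_of_le_one h0.le h1.le (by nlinarith)

/-- Partitions sorted by their Durfee rectangle. Here it is proved by telescoping in s: the sum is
unchanged by s → s + 1, and as s → ∞ only m = 0 survives, with value 1/(q;q)_∞. -/
theorem hasSum_durfee {q : ℂ} (hq : q ≠ 0) (hq1 : ‖q‖ < 1) (s : ℕ) :
    HasSum (fun m : ℕ => q ^ (m ^ 2 + m * s) / (qPoch q q m * qPoch q q (m + s)))
      (qPochInf q q)⁻¹ := by
  obtain ⟨K, hK, hKb⟩ := exists_norm_inv_qPoch_self_le hq1
  have hne := qPoch_self_ne_zero hq1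
  have hb : ∀ k m : ℕ, ‖q ^ (m ^ 2 + m * (s + k)) / (qPoch q q m * qPoch q q (m + (s + k)))‖ ≤
      ‖q‖ ^ m ^ 2 * (K * K) := by
    intro k m
    rw [div_eq_mul_inv, norm_mul, mul_inv, norm_mul, norm_pow]
    refine mul_le_mul (pow_le_pow_of_le_one (norm_nonneg _) hq1.le (Nat.le_add_right _ _))
      (mul_le_mul (hKb _) (hKb _) (norm_nonneg _) hK.le) (by positivity) (by positivity)
  have hsum := (summable_pow_sq (norm_pos_iff.2 hq) hq1).mul_right (K * K)
  have h := hasSum_of_telescoping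
    (t := fun k m => q ^ (m ^ 2 + m * (s + k)) / (qPoch q q m * qPoch q q (m + (s + k))))
    (g := fun k m => -(q ^ (m ^ 2 + m * (s + k)) * (1 - q ^ m) /
      (qPoch q q m * qPoch q q (m + (s + k)))))
    (s := fun m => if m = 0 then (qPochInf q q)⁻¹ else 0) hsum hb ?_ ?_ ?_ ?_
  · simpa using h
  · intro m
    have ht : Tendsto (fun k => qPoch q q (m + (s + k))) atTop (𝓝 (qPochInf q q)) := by
      refine (tendsto_qPoch hq1 q).comp (tendsto_atTop_mono (fun k => ?_) tendsto_id)
      simp only [id]; omega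
    have h0 := qPochInf_ne_zero_of_norm_lt hq1 hq1
    rcases Nat.eq_zero_or_pos m with rfl | hm
    · simpa [qPoch_zero] using ht.inv₀ h0
    · rw [if_neg hm.ne']
      have hp : Tendsto (fun k => q ^ (m ^ 2 + m * (s + k))) atTop (𝓝 0) := by
        refine (tendsto_pow_atTop_nhds_zero_of_norm_lt_one hq1).comp
          (tendsto_atTop_mono (fun k => ?_) tendsto_id)
        simp only [id]; nlinarith
      have := hp.div (ht.const_mul (qPoch q q m)) (mul_ne_zero (hne m) h0)
      rwa [zero_div] at this
  · intro k m
    have e1 : m + (s + (k + 1)) = (m + (s + k)) + 1 := by ring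
    have e2 : m + 1 + (s + k) = (m + (s + k)) + 1 := by ring
    simp only [e1, e2, qPoch_succ]
    have h1 := hne (m + 1)
    have h2 := hne ((m + (s + k)) + 1)
    rw [qPoch_succ] at h1 h2
    have h1a := left_ne_zero_of_mul h1
    have h1b := right_ne_zero_of_mul h1
    have h2a := left_ne_zero_of_mul h2
    have h2b := right_ne_zero_of_mul h2
    field_simp
    ring
  · intro k; simp
  · intro k
    refine squeeze_zero_norm (a := fun m => ‖q‖ ^ m ^ 2 * (K * K) * 2) (fun m => ?_) ?_
    · rw [norm_neg, mul_div_right_comm, norm_mul]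
      refine mul_le_mul (hb k m) ?_ (norm_nonneg _) (by positivity)
      calc ‖1 - q ^ m‖ ≤ ‖(1 : ℂ)‖ + ‖q ^ m‖ := norm_sub_le _ _
        _ ≤ 1 + 1 := by
          rw [norm_one, norm_pow]
          gcongr
          exact pow_le_one₀ (norm_nonneg _) hq1.le
        _ = 2 := by norm_num
    · simpa using hsum.tendsto_atTop_zero.mul_const 2

/-- The limiting case of Bailey's lemma: with n = m + s, n² = m² + 2ms + s², which leaves a Durfee
sum with parameter 2s. -/
theorem hasSum_pow_sq_mul_baileyCoeff {q : ℂ} (hq : q ≠ 0) (hq1 : ‖q‖ < 1) (s : ℕ) :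
    HasSum (fun n : ℕ => q ^ (n ^ 2) * baileyCoeff q n s) (q ^ (s ^ 2) * (qPochInf q q)⁻¹) := by
  rw [← (add_left_injective s).hasSum_iff]
  · have e : ((fun n : ℕ => q ^ (n ^ 2) * baileyCoeff q n s) ∘ fun m => m + s) =
        fun m => q ^ s ^ 2 * (q ^ (m ^ 2 + m * (2 * s)) /
          (qPoch q q m * qPoch q q (m + 2 * s))) := by
      funext m
      have e : m + s + s = m + 2 * s := by ring
      simp only [Function.comp, baileyCoeff, le_add_iff_nonneg_left, zero_le, if_true,
        Nat.add_sub_cancel, e]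
      rw [← mul_div_assoc, ← pow_add, ← div_eq_mul_inv]
      congr 2
      ring
    rw [e]
    exact (hasSum_durfee hq hq1 (2 * s)).mul_left _
  · intro n hn
    rw [baileyCoeff, if_neg, mul_zero]
    intro h
    exact hn ⟨n - s, Nat.sub_add_cancel h⟩

/-- The double series over ℕ × ℤ converges absolutely. Summing over r first gives the left side;
summing over n first gives a theta series with the extra weight q^(r²), to which the triple product
applies. -/
theorem hasSum_bailey {a q : ℂ} (ha : a ≠ 0) (hq : q ≠ 0) (hq1 : ‖q‖ < 1) :
    HasSum (fun n : ℕ => q ^ (n ^ 2) * (qPoch a q n * qPoch (q / a) q n) / qPoch q q (2 * n))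
      (qPochInf (a * q) (q ^ 3) * qPochInf (q ^ 2 / a) (q ^ 3) * qPochInf (q ^ 3) (q ^ 3) /
        qPochInf q q) := by
  obtain ⟨K, hK, hKb⟩ := exists_norm_baileyCoeff_le hq1
  have hq3 : ‖q ^ 3‖ < 1 := by
    rw [norm_pow]; exact pow_lt_one₀ (norm_nonneg _) hq1 three_ne_zero
  have hsum : Summable fun x : ℕ × ℤ =>
      q ^ (x.1 ^ 2) * (baileyCoeff q x.1 x.2.natAbs * thetaTerm a q x.2) := by
    refine Summable.of_norm_bounded (((summable_pow_sq (norm_pos_iff.2 hq) hq1).mul_of_nonneg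
      ((summable_norm_thetaTerm ha hq hq1).mul_left K) (fun _ => by positivity)
      (fun _ => by positivity))) fun x => ?_
    rw [norm_mul, norm_mul, norm_pow]
    gcongr
    exact hKb _ _
  have h1 : ∀ n : ℕ, HasSum (fun r : ℤ => q ^ (n ^ 2) *
      (baileyCoeff q n r.natAbs * thetaTerm a q r))
      (q ^ (n ^ 2) * (qPoch a q n * qPoch (q / a) q n) / qPoch q q (2 * n)) := fun n => by
    rw [mul_div_assoc]
    exact (hasSum_baileyCoeff_mul_thetaTerm ha hq hq1 n).mul_left _
  have h2 := hsum.hasSum.prod_fiberwise h1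
  convert h2 using 1
  have hswap := (Equiv.prodComm ℤ ℕ).hasSum_iff.2 hsum.hasSum
  have h3 : ∀ r : ℤ, HasSum (fun n : ℕ => q ^ (n ^ 2) *
      (baileyCoeff q n r.natAbs * thetaTerm a q r))
      (thetaTerm (a * q) (q ^ 3) r * (qPochInf q q)⁻¹) := fun r => by
    -- The weight q^(r²) changes the base: r(r−1)/2 + r² = 3 r(r−1)/2 + r.
    have e : thetaTerm (a * q) (q ^ 3) r = q ^ (r.natAbs ^ 2) * thetaTerm a q r := by
      rw [thetaTerm, thetaTerm, neg_mul_eq_neg_mul, mul_zpow, mul_assoc,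
        mul_left_comm (q ^ r.natAbs ^ 2)]
      congr 1
      rw [← zpow_natCast q 3, ← zpow_mul, ← zpow_natCast, ← zpow_add₀ hq, ← zpow_add₀ hq]
      congr 1
      have := int_choose_two r
      push_cast
      rw [sq_abs]
      refine mul_right_cancel₀ (two_ne_zero' ℤ) ?_
      linear_combination 2 * this
    rw [e, mul_right_comm]
    simpa only [mul_assoc] using
      (hasSum_pow_sq_mul_baileyCoeff hq hq1 r.natAbs).mul_right (thetaTerm a q r)
  have h4 := hswap.prod_fiberwise h3
  rw [← h4.tsum_eq, tsum_mul_right, tsum_thetaTerm (mul_ne_zero ha hq) (pow_ne_zero 3 hq) hq3,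
    div_eq_mul_inv]
  congr 4
  field_simp

/-! ### Cleared summands and their contiguous relations under z → zq³. -/

/-- The `8n+1` summand, cleared of its denominators depending on `z`. -/
noncomputable def clearedA (q a z : ℂ) (n : ℕ) : ℂ :=
  q ^ (n ^ 2) * (1 - a * z * q ^ (4 * n)) * (qPoch a q n * qPoch (q / a) q n) *
    qPoch (a * z) q (2 * n) * (qPoch q q (2 * n))⁻¹ *
    (qPochInf (z * q ^ (3 * n + 3)) (q ^ 3) * qPochInf (a ^ 2 * z * q ^ (3 * n + 2)) (q ^ 3) *
      qPochInf (a * z * q) (q ^ 3))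

/-- The telescoping companion of `clearedA`. -/
noncomputable def companionA (q a z : ℂ) (n : ℕ) : ℂ :=
  q ^ (n ^ 2) * (a * z * q * (1 - 1 * q ^ (2 * n)) * (1 - q⁻¹ * q ^ (2 * n))) *
    (qPoch a q n * qPoch (q / a) q n) * qPoch (a * z) q (2 * n) * (qPoch q q (2 * n))⁻¹ *
    (qPochInf (z * q ^ (3 * n + 3)) (q ^ 3) * qPochInf (a ^ 2 * z * q ^ (3 * n + 2)) (q ^ 3) *
      qPochInf (a * z * q ^ 4) (q ^ 3))

/-- The limit of `clearedA` as `z → 0`. -/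
noncomputable def limitA (q a : ℂ) (n : ℕ) : ℂ :=
  q ^ (n ^ 2) * (qPoch a q n * qPoch (q / a) q n) / qPoch q q (2 * n)

/-- The short polynomial factor of the `28n+3` summand. -/
noncomputable def factorB (q a z : ℂ) (n : ℕ) : ℂ :=
  (1 - q * q ^ (4 * n)) * (1 - q ^ 2 * q ^ (4 * n)) * (1 - a * z * q ^ (5 * n)) +
    q ^ (4 * n + 1) * (1 - a * z * q ^ n) * (1 - a * q ^ (2 * n)) * (1 - q / a * q ^ (2 * n))

/-- The `28n+3` summand, cleared of its denominators depending on `z`. -/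
noncomputable def clearedB (q a z : ℂ) (n : ℕ) : ℂ :=
  q ^ (4 * n ^ 2) * qPochInf (a * z * q / (q ^ 3) ^ n) (q ^ 3) *
    (factorB q a z n * (qPoch a q (2 * n) * qPoch (q / a) q (2 * n)) * qPoch (a * z) q n *
    (qPoch q q (4 * n + 2))⁻¹ *
    (qPochInf (z * q ^ (3 * n + 3)) (q ^ 3) * qPochInf (a ^ 2 * z * q ^ (3 * n + 2)) (q ^ 3)))

/-- The telescoping companion of `clearedB`. -/
noncomputable def companionB (q a z : ℂ) (n : ℕ) : ℂ :=
  (q ^ (4 * n ^ 2) * qPochInf (a * z * q ^ 4 / (q ^ 3) ^ n) (q ^ 3)) * ((q ^ 3) ^ n)⁻¹ *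
    (a * z * q * (1 - 1 * q ^ (4 * n)) * (1 - q⁻¹ * q ^ (4 * n)) * (1 - q * q ^ (4 * n)) *
      (1 - q ^ 2 * q ^ (4 * n)) *
    (qPoch a q (2 * n) * qPoch (q / a) q (2 * n)) * qPoch (a * z) q n *
    (qPoch q q (4 * n + 2))⁻¹ *
    (qPochInf (z * q ^ (3 * n + 3)) (q ^ 3) * qPochInf (a ^ 2 * z * q ^ (3 * n + 2)) (q ^ 3)))

/-- The limit of `clearedB` as `z → 0`. -/
noncomputable def limitB (q a : ℂ) (n : ℕ) : ℂ :=
  q ^ (4 * n ^ 2) * (factorB q a 0 n * (qPoch a q (2 * n) * qPoch (q / a) q (2 * n))) /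
    qPoch q q (4 * n + 2)

theorem qPoch_shift_three (x q : ℂ) (n : ℕ) :
    qPoch x q 3 * qPoch (x * q ^ 3) q n =
      qPoch x q n * ((1 - x * q ^ n) * (1 - x * q ^ (n + 1)) * (1 - x * q ^ (n + 2))) := by
  rw [← qPoch_add, add_comm, qPoch_succ, qPoch_succ, qPoch_succ]
  ring

theorem norm_cube_lt_one {q : ℂ} (hq1 : ‖q‖ < 1) : ‖q ^ 3‖ < 1 := by
  rw [norm_pow]; exact pow_lt_one₀ (norm_nonneg _) hq1 three_ne_zero

/-- After the infinite products are reduced to common tails and (azq³;q)_{2n} to (az;q)_{2n}, all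
transcendental factors are common and a rational identity in q^n remains. In `companionA` the
factors 1 − q^(2n) and 1 − q^(2n−1) turn 1/(q;q)_{2n} into 1/(q;q)_{2n−2} for n ≥ 1 and vanish at n
= 0. -/
theorem clearedA_sub {q a : ℂ} (ha : a ≠ 0) (hq : q ≠ 0) (hq1 : ‖q‖ < 1) (z : ℂ) (n : ℕ) :
    clearedA q a z n - qPoch (a * z) q 3 * clearedA q a (z * q ^ 3) n =
      companionA q a z (n + 1) - companionA q a z n := by
  have hp := norm_cube_lt_one hq1
  have e1 : qPochInf (z * q ^ (3 * n + 3)) (q ^ 3) =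
      (1 - z * q ^ (3 * n + 3)) * qPochInf (z * q ^ (3 * n + 6)) (q ^ 3) := by
    rw [qPochInf_eq_one_sub_mul hp]; ring_nf
  have e2 : qPochInf (a ^ 2 * z * q ^ (3 * n + 2)) (q ^ 3) =
      (1 - a ^ 2 * z * q ^ (3 * n + 2)) * qPochInf (a ^ 2 * z * q ^ (3 * n + 5)) (q ^ 3) := by
    rw [qPochInf_eq_one_sub_mul hp]; ring_nf
  have e3 : qPochInf (a * z * q) (q ^ 3) = (1 - a * z * q) * qPochInf (a * z * q ^ 4) (q ^ 3) := by
    rw [qPochInf_eq_one_sub_mul hp]; ring_nf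
  have f1 : z * q ^ 3 * q ^ (3 * n + 3) = z * q ^ (3 * n + 6) := by ring
  have f2 : a ^ 2 * (z * q ^ 3) * q ^ (3 * n + 2) = a ^ 2 * z * q ^ (3 * n + 5) := by ring
  have f3 : a * (z * q ^ 3) * q = a * z * q ^ 4 := by ring
  have f4 := qPoch_shift_three (a * z) q (2 * n)
  have f5 : a * (z * q ^ 3) = a * z * q ^ 3 := by ring
  have g1 : 3 * (n + 1) + 3 = 3 * n + 6 := by ring
  have g2 : 3 * (n + 1) + 2 = 3 * n + 5 := by ring
  have g3 : 2 * (n + 1) = 2 * n + 1 + 1 := by ring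
  have h1 := qPoch_self_ne_zero hq1 (2 * n + 1 + 1)
  rw [qPoch_succ, qPoch_succ] at h1
  have h3 := right_ne_zero_of_mul h1
  have h4 := right_ne_zero_of_mul (left_ne_zero_of_mul h1)
  have h5 := left_ne_zero_of_mul (left_ne_zero_of_mul h1)
  simp only [clearedA, companionA]
  rw [f1, f2, f3, f5, g1, g2, g3, e1, e2, e3]
  simp only [qPoch_succ _ _ n, qPoch_succ _ _ (2 * n), qPoch_succ _ _ (2 * n + 1)]
  generalize qPochInf (z * q ^ (3 * n + 6)) (q ^ 3) = X1
  generalize qPochInf (a ^ 2 * z * q ^ (3 * n + 5)) (q ^ 3) = X2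
  generalize qPochInf (a * z * q ^ 4) (q ^ 3) = X3
  generalize qPoch a q n = P at *
  generalize qPoch (q / a) q n = P' at *
  generalize qPoch q q (2 * n) = V at *
  generalize qPoch (a * z * q ^ 3) q (2 * n) = U' at *
  generalize qPoch (a * z) q (2 * n) = U at *
  generalize qPoch (a * z) q 3 = T at *
  have e : T * (q ^ n ^ 2 * (1 - a * z * q ^ 3 * q ^ (4 * n)) * (P * P') * U' * V⁻¹ *
      (X1 * X2 * X3)) = (q ^ n ^ 2 * (1 - a * z * q ^ 3 * q ^ (4 * n)) * (P * P') * V⁻¹ *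
      (X1 * X2 * X3)) * (U * ((1 - a * z * q ^ (2 * n)) * (1 - a * z * q ^ (2 * n + 1)) *
        (1 - a * z * q ^ (2 * n + 2)))) := by
    rw [← f4]; ring
  rw [e]
  -- Everything is put over (q;q)_{2n+2}, the denominator of the companion at n + 1.
  have e' : V⁻¹ = (1 - q * q ^ (2 * n)) * (1 - q * q ^ (2 * n + 1)) *
    (V * (1 - q * q ^ (2 * n)) * (1 - q * q ^ (2 * n + 1)))⁻¹ := by field_simp
  rw [e']
  generalize (V * (1 - q * q ^ (2 * n)) * (1 - q * q ^ (2 * n + 1)))⁻¹ = Y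
  have hn : (n + 1) ^ 2 = n ^ 2 + 2 * n + 1 := by ring
  rw [hn]
  simp only [pow_add, pow_mul']
  generalize q ^ n = Q
  generalize q ^ n ^ 2 = QQ
  field_simp
  ring

/-- Same mechanism as `clearedA_sub`, with four new factors of (q;q)_{4n+6} and one infinite product
whose argument depends on n. -/
theorem clearedB_sub {q a : ℂ} (ha : a ≠ 0) (hq : q ≠ 0) (hq1 : ‖q‖ < 1) (z : ℂ) (n : ℕ) :
    clearedB q a z n - qPoch (a * z) q 3 * clearedB q a (z * q ^ 3) n =
      companionB q a z (n + 1) - companionB q a z n := by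
  have hp := norm_cube_lt_one hq1
  have hp0 : q ^ 3 ≠ 0 := pow_ne_zero 3 hq
  have e1 : qPochInf (z * q ^ (3 * n + 3)) (q ^ 3) =
      (1 - z * q ^ (3 * n + 3)) * qPochInf (z * q ^ (3 * n + 6)) (q ^ 3) := by
    rw [qPochInf_eq_one_sub_mul hp]; ring_nf
  have e2 : qPochInf (a ^ 2 * z * q ^ (3 * n + 2)) (q ^ 3) =
      (1 - a ^ 2 * z * q ^ (3 * n + 2)) * qPochInf (a ^ 2 * z * q ^ (3 * n + 5)) (q ^ 3) := by
    rw [qPochInf_eq_one_sub_mul hp]; ring_nf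
  have e3 : qPochInf (a * z * q / (q ^ 3) ^ n) (q ^ 3) =
      (1 - a * z * q / (q ^ 3) ^ n) * qPochInf (a * z * q ^ 4 / (q ^ 3) ^ n) (q ^ 3) := by
    rw [qPochInf_eq_one_sub_mul hp]; ring_nf
  have f1 : z * q ^ 3 * q ^ (3 * n + 3) = z * q ^ (3 * n + 6) := by ring
  have f2 : a ^ 2 * (z * q ^ 3) * q ^ (3 * n + 2) = a ^ 2 * z * q ^ (3 * n + 5) := by ring
  have f3 : a * (z * q ^ 3) * q = a * z * q ^ 4 := by ring
  have f4 := qPoch_shift_three (a * z) q n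
  have f5 : a * (z * q ^ 3) = a * z * q ^ 3 := by ring
  -- Raising n by one undoes the shift z → zq³ in this argument, so the companion at n + 1 carries
  -- the same infinite product as the summand at n.
  have f6 : a * z * q ^ 4 / (q ^ 3) ^ (n + 1) = a * z * q / (q ^ 3) ^ n := by
    rw [pow_succ]; field_simp; ring
  have g1 : 3 * (n + 1) + 3 = 3 * n + 6 := by ring
  have g2 : 3 * (n + 1) + 2 = 3 * n + 5 := by ring
  have g3 : 2 * (n + 1) = 2 * n + 1 + 1 := by ring
  have g4 : 4 * (n + 1) + 2 = 4 * n + 2 + 1 + 1 + 1 + 1 := by ring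
  have h1 := qPoch_self_ne_zero hq1 (4 * n + 2 + 1 + 1 + 1 + 1)
  simp only [qPoch_succ _ _ (4 * n + 2), qPoch_succ _ _ (4 * n + 2 + 1),
    qPoch_succ _ _ (4 * n + 2 + 1 + 1), qPoch_succ _ _ (4 * n + 2 + 1 + 1 + 1)] at h1
  have i1 := right_ne_zero_of_mul h1
  have i2 := right_ne_zero_of_mul (left_ne_zero_of_mul h1)
  have i3 := right_ne_zero_of_mul (left_ne_zero_of_mul (left_ne_zero_of_mul h1))
  have i4 := right_ne_zero_of_mul (left_ne_zero_of_mul (left_ne_zero_of_mul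
    (left_ne_zero_of_mul h1)))
  have i5 := left_ne_zero_of_mul (left_ne_zero_of_mul (left_ne_zero_of_mul
    (left_ne_zero_of_mul h1)))
  simp only [clearedB, companionB, factorB]
  rw [f1, f2, f3, f5, f6, g1, g2, g3, g4, e1, e2, e3]
  simp only [qPoch_succ _ _ (4 * n + 2), qPoch_succ _ _ (4 * n + 2 + 1),
    qPoch_succ _ _ (4 * n + 2 + 1 + 1), qPoch_succ _ _ (4 * n + 2 + 1 + 1 + 1),
    qPoch_succ _ _ (2 * n), qPoch_succ _ _ (2 * n + 1), qPoch_succ _ _ n]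
  generalize qPochInf (z * q ^ (3 * n + 6)) (q ^ 3) = X1
  generalize qPochInf (a ^ 2 * z * q ^ (3 * n + 5)) (q ^ 3) = X2
  generalize qPochInf (a * z * q ^ 4 / (q ^ 3) ^ n) (q ^ 3) = X3
  generalize qPoch a q (2 * n) = P at *
  generalize qPoch (q / a) q (2 * n) = P' at *
  generalize qPoch q q (4 * n + 2) = V at *
  generalize qPoch (a * z * q ^ 3) q n = U' at *
  generalize qPoch (a * z) q n = U at *
  generalize qPoch (a * z) q 3 = T at *
  generalize hF : (1 - q * q ^ (4 * n)) * (1 - q ^ 2 * q ^ (4 * n)) *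
    (1 - a * z * q ^ 3 * q ^ (5 * n)) + q ^ (4 * n + 1) * (1 - a * z * q ^ 3 * q ^ n) *
    (1 - a * q ^ (2 * n)) * (1 - q / a * q ^ (2 * n)) = F
  have e : T * (q ^ (4 * n ^ 2) * X3 * (F * (P * P') * U' * V⁻¹ * (X1 * X2))) =
      (q ^ (4 * n ^ 2) * X3 * (F * (P * P') * V⁻¹ * (X1 * X2))) *
      (U * ((1 - a * z * q ^ n) * (1 - a * z * q ^ (n + 1)) * (1 - a * z * q ^ (n + 2)))) := by
    rw [← f4]; ring
  rw [e, ← hF]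
  have e' : (V * (1 - q * q ^ (4 * n + 2)) * (1 - q * q ^ (4 * n + 2 + 1)) *
      (1 - q * q ^ (4 * n + 2 + 1 + 1)) * (1 - q * q ^ (4 * n + 2 + 1 + 1 + 1)))⁻¹ =
      V⁻¹ * ((1 - q * q ^ (4 * n + 2)) * (1 - q * q ^ (4 * n + 2 + 1)) *
      (1 - q * q ^ (4 * n + 2 + 1 + 1)) * (1 - q * q ^ (4 * n + 2 + 1 + 1 + 1)))⁻¹ := by
    rw [← mul_inv]; ring_nf
  -- The vanishing factors of the companion at n + 1 are exactly the four factors 1 − q^(4n+3), …, 1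
  -- − q^(4n+6) newly present in its denominator.
  have e'' : (1 - 1 * q ^ (4 * (n + 1))) * (1 - q⁻¹ * q ^ (4 * (n + 1))) *
      (1 - q * q ^ (4 * (n + 1))) * (1 - q ^ 2 * q ^ (4 * (n + 1))) =
      (1 - q * q ^ (4 * n + 2)) * (1 - q * q ^ (4 * n + 2 + 1)) *
      (1 - q * q ^ (4 * n + 2 + 1 + 1)) * (1 - q * q ^ (4 * n + 2 + 1 + 1 + 1)) := by
    simp only [mul_add, mul_one, pow_add]; field_simp
  have e3' : a * z * q * (1 - 1 * q ^ (4 * (n + 1))) * (1 - q⁻¹ * q ^ (4 * (n + 1))) *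
      (1 - q * q ^ (4 * (n + 1))) * (1 - q ^ 2 * q ^ (4 * (n + 1))) =
      a * z * q * ((1 - q * q ^ (4 * n + 2)) * (1 - q * q ^ (4 * n + 2 + 1)) *
      (1 - q * q ^ (4 * n + 2 + 1 + 1)) * (1 - q * q ^ (4 * n + 2 + 1 + 1 + 1))) := by
    rw [← e'']; ring
  rw [e', e3']
  have hW : (1 - q * q ^ (4 * n + 2)) * (1 - q * q ^ (4 * n + 2 + 1)) *
      (1 - q * q ^ (4 * n + 2 + 1 + 1)) * (1 - q * q ^ (4 * n + 2 + 1 + 1 + 1)) ≠ 0 :=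
    mul_ne_zero (mul_ne_zero (mul_ne_zero i4 i3) i2) i1
  generalize (1 - q * q ^ (4 * n + 2)) * (1 - q * q ^ (4 * n + 2 + 1)) *
      (1 - q * q ^ (4 * n + 2 + 1 + 1)) * (1 - q * q ^ (4 * n + 2 + 1 + 1 + 1)) = W at *
  have hn : 4 * (n + 1) ^ 2 = 4 * n ^ 2 + 8 * n + 4 := by ring
  have hQ : q ^ n ≠ 0 := pow_ne_zero n hq
  have hpn : (q ^ 3) ^ n = (q ^ n) ^ 3 := by rw [← pow_mul, ← pow_mul, mul_comm]
  rw [hn]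
  simp only [pow_add q, pow_mul' q, pow_succ (q ^ 3) n, hpn]
  generalize (q ^ n ^ 2) ^ 4 = QQ
  generalize q ^ n = Q at *
  field_simp
  ring

/-! ### Bounds uniform in z on discs. -/

theorem norm_one_sub_mul_pow_le {q x : ℂ} (hq1 : ‖q‖ < 1) {R : ℝ} (hx : ‖x‖ ≤ R) (m : ℕ) :
    ‖1 - x * q ^ m‖ ≤ 1 + R := by
  refine (norm_sub_le _ _).trans ?_
  rw [norm_one, norm_mul, norm_pow]
  have := mul_le_of_le_one_right (norm_nonneg x) (pow_le_one₀ (norm_nonneg q) hq1.le (n := m))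
  linarith

theorem norm_mul_pow_le {q x : ℂ} (hq1 : ‖q‖ < 1) {R : ℝ} (hx : ‖x‖ ≤ R) (m : ℕ) :
    ‖x * q ^ m‖ ≤ R := by
  rw [norm_mul, norm_pow]
  exact (mul_le_of_le_one_right (norm_nonneg x) (pow_le_one₀ (norm_nonneg q) hq1.le)).trans hx

/-- One constant serves a whole disc, hence all shifts zq^(3k) at once. The first bound dominates
the series; the second makes the companion vanish at infinity. -/
theorem exists_norm_clearedA_le {q : ℂ} (hq1 : ‖q‖ < 1) (a : ℂ) (R : ℝ) :
    ∃ C : ℝ, ∀ w : ℂ, ‖w‖ ≤ R → ∀ n, ‖clearedA q a w n‖ ≤ ‖q‖ ^ (n ^ 2) * C ∧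
      ‖companionA q a w n‖ ≤ ‖q‖ ^ (n ^ 2) * C := by
  obtain ⟨K, hK, hKb⟩ := exists_norm_inv_qPoch_self_le hq1
  have hp := norm_cube_lt_one hq1
  obtain ⟨E, hE⟩ : ∃ E : ℝ → ℝ, E = fun R => Real.exp (R * (1 - ‖q‖)⁻¹) := ⟨_, rfl⟩
  obtain ⟨F, hF⟩ : ∃ F : ℝ → ℝ, F = fun R => Real.exp (R * (1 - ‖q ^ 3‖)⁻¹) := ⟨_, rfl⟩
  have bE : ∀ {x : ℂ} {r : ℝ}, ‖x‖ ≤ r → ∀ n, ‖qPoch x q n‖ ≤ E r := fun h n => by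
    rw [hE]; exact norm_qPoch_le hq1 h n
  have bF : ∀ {x : ℂ} {r : ℝ}, ‖x‖ ≤ r → ‖qPochInf x (q ^ 3)‖ ≤ F r := fun h => by
    rw [hF]; exact norm_qPochInf_le hp h
  refine ⟨max ((1 + ‖a‖ * R) * (E ‖a‖ * E ‖q / a‖) * E (‖a‖ * R) * K *
    (F R * F (‖a ^ 2‖ * R) * F (‖a‖ * R)))
    ((‖a‖ * R * (1 + 1) * (1 + ‖q⁻¹‖)) * (E ‖a‖ * E ‖q / a‖) * E (‖a‖ * R) * K *
    (F R * F (‖a ^ 2‖ * R) * F (‖a‖ * R))), fun w hw n => ?_⟩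
  have haw : ‖a * w‖ ≤ ‖a‖ * R := norm_mul_le_of_le le_rfl hw
  have ha2w : ‖a ^ 2 * w‖ ≤ ‖a ^ 2‖ * R := norm_mul_le_of_le le_rfl hw
  have hawq : ∀ m, ‖a * w * q ^ m‖ ≤ ‖a‖ * R := norm_mul_pow_le hq1 haw
  have hawq1 : ‖a * w * q‖ ≤ ‖a‖ * R := by simpa using hawq 1
  have hassoc : ∀ x A B C D E : ℝ, x * (A * B * C * D * E) = x * A * B * C * D * E := by
    intros; ring
  constructor
  · refine le_trans ?_ (mul_le_mul_of_nonneg_left (le_max_left _ _) (by positivity))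
    rw [hassoc]
    refine norm_mul_le_of_le (norm_mul_le_of_le (norm_mul_le_of_le (norm_mul_le_of_le
      (norm_mul_le_of_le (norm_pow_le _ _) ?_) (norm_mul_le_of_le ?_ ?_)) ?_) ?_)
      (norm_mul_le_of_le (norm_mul_le_of_le ?_ ?_) ?_)
    · exact norm_one_sub_mul_pow_le hq1 haw _
    · exact bE le_rfl _
    · exact bE le_rfl _
    · exact bE haw _
    · exact hKb _
    · exact bF (norm_mul_pow_le hq1 hw _)
    · exact bF (norm_mul_pow_le hq1 ha2w _)
    · exact bF hawq1
  · refine le_trans ?_ (mul_le_mul_of_nonneg_left (le_max_right _ _) (by positivity))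
    rw [hassoc]
    refine norm_mul_le_of_le (norm_mul_le_of_le (norm_mul_le_of_le (norm_mul_le_of_le
      (norm_mul_le_of_le (norm_pow_le _ _) (norm_mul_le_of_le (norm_mul_le_of_le ?_ ?_) ?_))
      (norm_mul_le_of_le ?_ ?_)) ?_) ?_) (norm_mul_le_of_le (norm_mul_le_of_le ?_ ?_) ?_)
    · exact hawq1
    · exact norm_one_sub_mul_pow_le hq1 (by simp) _
    · exact norm_one_sub_mul_pow_le hq1 le_rfl _
    · exact bE le_rfl _
    · exact bE le_rfl _
    · exact bE haw _
    · exact hKb _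
    · exact bF (norm_mul_pow_le hq1 hw _)
    · exact bF (norm_mul_pow_le hq1 ha2w _)
    · exact bF (hawq 4)

/-- The n factors 1 − x q^(−3j) grow at most like (1+R)^n |q|^(−3n(n+1)/2). The Gaussian q^(4n²)
absorbs this with room to spare, because n(n−1)/2 + 3n(n+1)/2 = 2n² + n ≤ 4n². -/
theorem norm_pow_mul_qPochInf_div_le {q : ℂ} (hq : q ≠ 0) (hq1 : ‖q‖ < 1) {x : ℂ} {R : ℝ}
    (hx : ‖x‖ ≤ R) (n : ℕ) :
    ‖q ^ (4 * n ^ 2) * qPochInf (x / (q ^ 3) ^ n) (q ^ 3)‖ ≤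
      (1 + R) ^ n * ‖q‖ ^ (n.choose 2) * Real.exp (R * (1 - ‖q ^ 3‖)⁻¹) := by
  have hp := norm_cube_lt_one hq1
  have hR : 0 ≤ R := (norm_nonneg x).trans hx
  have hρ : 0 < ‖q‖ := norm_pos_iff.2 hq
  have key : ‖q ^ 3‖ ^ ((n + 1).choose 2) * ‖qPochInf (x / (q ^ 3) ^ n) (q ^ 3)‖ ≤
      (1 + R) ^ n * Real.exp (R * (1 - ‖q ^ 3‖)⁻¹) := by
    induction n with
    | zero => simpa using norm_qPochInf_le hp hx
    | succ n ih =>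
      have e : x / (q ^ 3) ^ (n + 1) * q ^ 3 = x / (q ^ 3) ^ n := by
        rw [pow_succ]; field_simp
      rw [qPochInf_eq_one_sub_mul hp, e, Nat.choose_succ_succ' (n + 1) 1, Nat.choose_one_right,
        pow_add, norm_mul]
      have h1 : ‖q ^ 3‖ ^ (n + 1) * ‖1 - x / (q ^ 3) ^ (n + 1)‖ ≤ 1 + R := by
        rw [← norm_pow, ← norm_mul, mul_sub, mul_one,
          mul_div_cancel₀ _ (pow_ne_zero _ (pow_ne_zero 3 hq))]
        refine (norm_sub_le _ _).trans (add_le_add ?_ hx)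
        rw [norm_pow]
        exact pow_le_one₀ (norm_nonneg _) hp.le
      calc _ = (‖q ^ 3‖ ^ (n + 1) * ‖1 - x / (q ^ 3) ^ (n + 1)‖) *
            (‖q ^ 3‖ ^ ((n + 1).choose 2) * ‖qPochInf (x / (q ^ 3) ^ n) (q ^ 3)‖) := by ring
        _ ≤ (1 + R) * ((1 + R) ^ n * Real.exp (R * (1 - ‖q ^ 3‖)⁻¹)) :=
          mul_le_mul h1 ih (by positivity) (by positivity)
        _ = _ := by ring
  have hexp : n.choose 2 + 3 * (n + 1).choose 2 ≤ 4 * n ^ 2 := by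
    have h1 := choose_two_cast n
    have h2 := choose_two_cast (n + 1)
    push_cast at h2
    zify
    nlinarith
  rw [norm_mul, norm_pow]
  calc ‖q‖ ^ (4 * n ^ 2) * ‖qPochInf (x / (q ^ 3) ^ n) (q ^ 3)‖
      ≤ ‖q‖ ^ (n.choose 2 + 3 * (n + 1).choose 2) * ‖qPochInf (x / (q ^ 3) ^ n) (q ^ 3)‖ := by
        gcongr ?_ * _
        exact pow_le_pow_of_le_one hρ.le hq1.le hexp
    _ = ‖q‖ ^ (n.choose 2) *
        (‖q ^ 3‖ ^ ((n + 1).choose 2) * ‖qPochInf (x / (q ^ 3) ^ n) (q ^ 3)‖) := by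
        rw [pow_add, pow_mul, ← norm_pow q 3, mul_assoc]
    _ ≤ ‖q‖ ^ (n.choose 2) * ((1 + R) ^ n * Real.exp (R * (1 - ‖q ^ 3‖)⁻¹)) := by gcongr
    _ = _ := by ring

/-- The companion carries an extra q^(−3n), which only enlarges the geometric base of the majorant.
-/
theorem exists_norm_clearedB_le {q : ℂ} (hq : q ≠ 0) (hq1 : ‖q‖ < 1) (a : ℂ) {R : ℝ}
    (hR : 0 ≤ R) :
    ∃ C : ℝ, ∀ w : ℂ, ‖w‖ ≤ R → ∀ n,
      ‖clearedB q a w n‖ ≤ (1 + ‖a‖ * R) ^ n * ‖q‖ ^ (n.choose 2) * C ∧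
      ‖companionB q a w n‖ ≤ ((1 + ‖a‖ * R) * (‖q ^ 3‖)⁻¹) ^ n * ‖q‖ ^ (n.choose 2) * C := by
  obtain ⟨K, hK, hKb⟩ := exists_norm_inv_qPoch_self_le hq1
  have hp := norm_cube_lt_one hq1
  obtain ⟨E, hE⟩ : ∃ E : ℝ → ℝ, E = fun R => Real.exp (R * (1 - ‖q‖)⁻¹) := ⟨_, rfl⟩
  obtain ⟨F, hF⟩ : ∃ F : ℝ → ℝ, F = fun R => Real.exp (R * (1 - ‖q ^ 3‖)⁻¹) := ⟨_, rfl⟩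
  have bE : ∀ {x : ℂ} {r : ℝ}, ‖x‖ ≤ r → ∀ n, ‖qPoch x q n‖ ≤ E r := fun h n => by
    rw [hE]; exact norm_qPoch_le hq1 h n
  have bF : ∀ {x : ℂ} {r : ℝ}, ‖x‖ ≤ r → ‖qPochInf x (q ^ 3)‖ ≤ F r := fun h => by
    rw [hF]; exact norm_qPochInf_le hp h
  refine ⟨max (F (‖a‖ * R) *
    (((1 + ‖q‖) * (1 + ‖q ^ 2‖) * (1 + ‖a‖ * R) + 1 * (1 + ‖a‖ * R) * (1 + ‖a‖) * (1 + ‖q / a‖)) *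
      (E ‖a‖ * E ‖q / a‖) * E (‖a‖ * R) * K * (F R * F (‖a ^ 2‖ * R))))
    (F (‖a‖ * R) *
    (‖a‖ * R * (1 + 1) * (1 + ‖q⁻¹‖) * (1 + ‖q‖) * (1 + ‖q ^ 2‖) *
      (E ‖a‖ * E ‖q / a‖) * E (‖a‖ * R) * K * (F R * F (‖a ^ 2‖ * R)))), fun w hw n => ?_⟩
  have haw : ‖a * w‖ ≤ ‖a‖ * R := norm_mul_le_of_le le_rfl hw
  have ha2w : ‖a ^ 2 * w‖ ≤ ‖a ^ 2‖ * R := norm_mul_le_of_le le_rfl hw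
  have hawq : ∀ m, ‖a * w * q ^ m‖ ≤ ‖a‖ * R := norm_mul_pow_le hq1 haw
  have hawq1 : ‖a * w * q‖ ≤ ‖a‖ * R := by simpa using hawq 1
  have h1 := norm_pow_mul_qPochInf_div_le hq hq1 hawq1 n
  have h2 := norm_pow_mul_qPochInf_div_le hq hq1 (hawq 4) n
  have hFR : Real.exp (‖a‖ * R * (1 - ‖q ^ 3‖)⁻¹) = F (‖a‖ * R) := by rw [hF]
  rw [hFR] at h1 h2
  constructor
  · refine le_trans ?_ (mul_le_mul_of_nonneg_left (le_max_left _ _) (by positivity))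
    rw [← mul_assoc (_ ^ n * _)]
    refine norm_mul_le_of_le h1 (norm_mul_le_of_le (norm_mul_le_of_le (norm_mul_le_of_le
      (norm_mul_le_of_le ?_ (norm_mul_le_of_le ?_ ?_)) ?_) ?_) (norm_mul_le_of_le ?_ ?_))
    · refine norm_add_le_of_le (norm_mul_le_of_le (norm_mul_le_of_le ?_ ?_) ?_)
        (norm_mul_le_of_le (norm_mul_le_of_le (norm_mul_le_of_le ?_ ?_) ?_) ?_)
      · exact norm_one_sub_mul_pow_le hq1 le_rfl _
      · exact norm_one_sub_mul_pow_le hq1 le_rfl _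
      · exact norm_one_sub_mul_pow_le hq1 haw _
      · rw [norm_pow]; exact pow_le_one₀ (norm_nonneg _) hq1.le
      · exact norm_one_sub_mul_pow_le hq1 haw _
      · exact norm_one_sub_mul_pow_le hq1 le_rfl _
      · exact norm_one_sub_mul_pow_le hq1 le_rfl _
    · exact bE le_rfl _
    · exact bE le_rfl _
    · exact bE haw _
    · exact hKb _
    · exact bF (norm_mul_pow_le hq1 hw _)
    · exact bF (norm_mul_pow_le hq1 ha2w _)
  · have hpos : 0 ≤ ((1 + ‖a‖ * R) * (‖q ^ 3‖)⁻¹) ^ n * ‖q‖ ^ (n.choose 2) := by positivity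
    refine le_trans ?_ (mul_le_mul_of_nonneg_left (le_max_right _ _) hpos)
    have e : ∀ X Y : ℝ, ((1 + ‖a‖ * R) * (‖q ^ 3‖)⁻¹) ^ n * ‖q‖ ^ (n.choose 2) * (X * Y) =
        ((1 + ‖a‖ * R) ^ n * ‖q‖ ^ (n.choose 2) * X) * (‖q ^ 3‖⁻¹ ^ n) * Y := fun X Y => by
      rw [mul_pow]; ring
    rw [e]
    refine norm_mul_le_of_le (norm_mul_le_of_le h2 ?_) (norm_mul_le_of_le (norm_mul_le_of_le
      (norm_mul_le_of_le (norm_mul_le_of_le (norm_mul_le_of_le (norm_mul_le_of_le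
      (norm_mul_le_of_le (norm_mul_le_of_le ?_ ?_) ?_) ?_) ?_) (norm_mul_le_of_le ?_ ?_)) ?_) ?_)
      (norm_mul_le_of_le ?_ ?_))
    · rw [norm_inv, norm_pow, inv_pow]
    · exact hawq1
    · exact norm_one_sub_mul_pow_le hq1 (by simp) _
    · exact norm_one_sub_mul_pow_le hq1 le_rfl _
    · exact norm_one_sub_mul_pow_le hq1 le_rfl _
    · exact norm_one_sub_mul_pow_le hq1 le_rfl _
    · exact bE le_rfl _
    · exact bE le_rfl _
    · exact bE haw _
    · exact hKb _
    · exact bF (norm_mul_pow_le hq1 hw _)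
    · exact bF (norm_mul_pow_le hq1 ha2w _)

/-! ### Iteration z → zq³ → ⋯ → 0. -/

theorem tendsto_mul_cube_pow {q : ℂ} (hq1 : ‖q‖ < 1) (x y z : ℂ) :
    Tendsto (fun k : ℕ => x * (z * q ^ (3 * k)) * y) atTop (𝓝 0) := by
  have h : Tendsto (fun k : ℕ => (q ^ 3) ^ k) atTop (𝓝 0) :=
    tendsto_pow_atTop_nhds_zero_of_norm_lt_one (norm_cube_lt_one hq1)
  simpa [pow_mul] using ((h.const_mul z).const_mul x).mul_const y

theorem tendsto_qPoch_three_mul {q : ℂ} (hq1 : ‖q‖ < 1) (x : ℂ) :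
    Tendsto (fun k => qPoch x q (3 * k)) atTop (𝓝 (qPochInf x q)) :=
  (tendsto_qPoch hq1 x).comp (tendsto_id.const_mul_atTop' three_pos)

theorem qPoch_three_mul_succ (a z q : ℂ) (k : ℕ) :
    qPoch (a * z) q (3 * (k + 1)) =
      qPoch (a * z) q (3 * k) * qPoch (a * (z * q ^ (3 * k))) q 3 := by
  rw [mul_add, mul_one, qPoch_add]; ring_nf

/-- The k-th row is (az;q)_{3k} times the summand at zq^(3k); consecutive rows differ by a
telescoping term, and the rows converge termwise to (az;q)_∞ times the summand at z = 0. -/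
theorem hasSum_clearedA {q a : ℂ} (ha : a ≠ 0) (hq : q ≠ 0) (hq1 : ‖q‖ < 1) (z : ℂ) :
    HasSum (clearedA q a z) (qPochInf (a * z) q * ∑' n, limitA q a n) := by
  have hp := norm_cube_lt_one hq1
  obtain ⟨C, hC⟩ := exists_norm_clearedA_le hq1 a ‖z‖
  have hC' := fun k => hC (z * q ^ (3 * k)) (norm_mul_pow_le hq1 le_rfl _)
  have hsum := summable_pow_sq (norm_pos_iff.2 hq) hq1
  have h := hasSum_of_telescoping
    (t := fun k n => qPoch (a * z) q (3 * k) * clearedA q a (z * q ^ (3 * k)) n)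
    (g := fun k n => -(qPoch (a * z) q (3 * k) * -companionA q a (z * q ^ (3 * k)) n))
    (s := fun n => qPochInf (a * z) q * limitA q a n)
    (bound := fun n => Real.exp (‖a * z‖ * (1 - ‖q‖)⁻¹) * (‖q‖ ^ n ^ 2 * C))
    ((hsum.mul_right C).mul_left _)
    (fun k n => norm_mul_le_of_le (norm_qPoch_le hq1 le_rfl _) (hC' k n).1) ?_ ?_ ?_ ?_
  · rw [tsum_mul_left] at h
    simpa [qPoch_zero] using h
  · intro n
    refine (tendsto_qPoch_three_mul hq1 _).mul ?_
    have t1 := tendsto_qPochInf_one hp (tendsto_mul_cube_pow hq1 1 (q ^ (3 * n + 3)) z)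
    have t2 := tendsto_qPochInf_one hp (tendsto_mul_cube_pow hq1 (a ^ 2) (q ^ (3 * n + 2)) z)
    have t3 := tendsto_qPochInf_one hp (tendsto_mul_cube_pow hq1 a q z)
    have t4 := tendsto_qPoch_one (q := q) (tendsto_mul_cube_pow hq1 a 1 z) (2 * n)
    have t5 := (tendsto_mul_cube_pow hq1 a (q ^ (4 * n)) z).const_sub 1
    simp only [one_mul, mul_one] at t1 t2 t3 t4
    have := ((((t5.const_mul (q ^ n ^ 2)).mul_const (qPoch a q n * qPoch (q / a) q n)).mul
      t4).mul_const (qPoch q q (2 * n))⁻¹).mul ((t1.mul t2).mul t3)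
    simpa [clearedA, limitA, div_eq_mul_inv] using this
  · intro k n
    have h := clearedA_sub ha hq hq1 (z * q ^ (3 * k)) n
    have e : z * q ^ (3 * (k + 1)) = z * q ^ (3 * k) * q ^ 3 := by ring
    rw [qPoch_three_mul_succ, e]
    linear_combination qPoch (a * z) q (3 * k) * h
  · intro k; simp [companionA]
  · intro k
    refine squeeze_zero_norm (a := fun n => Real.exp (‖a * z‖ * (1 - ‖q‖)⁻¹) * (‖q‖ ^ n ^ 2 * C))
      (fun n => ?_) ?_
    · rw [norm_neg]
      refine norm_mul_le_of_le (norm_qPoch_le hq1 le_rfl _) ?_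
      rw [norm_neg]
      exact (hC' k n).2
    · simpa using (hsum.tendsto_atTop_zero.mul_const C).const_mul _

theorem hasSum_clearedB {q a : ℂ} (ha : a ≠ 0) (hq : q ≠ 0) (hq1 : ‖q‖ < 1) (z : ℂ) :
    HasSum (clearedB q a z) (qPochInf (a * z) q * ∑' n, limitB q a n) := by
  have hp := norm_cube_lt_one hq1
  obtain ⟨C, hC⟩ := exists_norm_clearedB_le hq hq1 a (norm_nonneg z)
  have hC' := fun k => hC (z * q ^ (3 * k)) (norm_mul_pow_le hq1 le_rfl _)
  have hρ : 0 < ‖q‖ := norm_pos_iff.2 hq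
  have hρ3 : 0 < ‖q ^ 3‖ := norm_pos_iff.2 (pow_ne_zero 3 hq)
  have hsum := summable_pow_mul_pow_choose hρ hq1 (R := 1 + ‖a‖ * ‖z‖) (by positivity)
  have hsum2 := summable_pow_mul_pow_choose hρ hq1
    (R := (1 + ‖a‖ * ‖z‖) * (‖q ^ 3‖)⁻¹) (by positivity)
  have h := hasSum_of_telescoping
    (t := fun k n => qPoch (a * z) q (3 * k) * clearedB q a (z * q ^ (3 * k)) n)
    (g := fun k n => qPoch (a * z) q (3 * k) * companionB q a (z * q ^ (3 * k)) n)
    (s := fun n => qPochInf (a * z) q * limitB q a n)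
    ((hsum.mul_right C).mul_left _)
    (fun k n => norm_mul_le_of_le (norm_qPoch_le hq1 le_rfl _) (hC' k n).1) ?_ ?_ ?_ ?_
  · rw [tsum_mul_left] at h
    simpa [qPoch_zero] using h
  · intro n
    refine (tendsto_qPoch_three_mul hq1 _).mul ?_
    have t1 := tendsto_qPochInf_one hp (tendsto_mul_cube_pow hq1 1 (q ^ (3 * n + 3)) z)
    have t2 := tendsto_qPochInf_one hp (tendsto_mul_cube_pow hq1 (a ^ 2) (q ^ (3 * n + 2)) z)
    have t3 := tendsto_qPochInf_one hp (tendsto_mul_cube_pow hq1 a (q / (q ^ 3) ^ n) z)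
    have t4 := tendsto_qPoch_one (q := q) (tendsto_mul_cube_pow hq1 a 1 z) n
    have t5 := (tendsto_mul_cube_pow hq1 a (q ^ (5 * n)) z).const_sub 1
    have t6 := (tendsto_mul_cube_pow hq1 a (q ^ n) z).const_sub 1
    simp only [one_mul, mul_one, ← mul_div_assoc] at t1 t2 t3 t4
    have t7 := (t5.const_mul ((1 - q * q ^ (4 * n)) * (1 - q ^ 2 * q ^ (4 * n)))).add
      (((t6.const_mul (q ^ (4 * n + 1))).mul_const (1 - a * q ^ (2 * n))).mul_const
        (1 - q / a * q ^ (2 * n)))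
    have := (t3.const_mul (q ^ (4 * n ^ 2))).mul
      ((((t7.mul_const (qPoch a q (2 * n) * qPoch (q / a) q (2 * n))).mul
      t4).mul_const (qPoch q q (4 * n + 2))⁻¹).mul (t1.mul t2))
    simpa [clearedB, limitB, factorB, div_eq_mul_inv, mul_assoc] using this
  · intro k n
    have h := clearedB_sub ha hq hq1 (z * q ^ (3 * k)) n
    have e : z * q ^ (3 * (k + 1)) = z * q ^ (3 * k) * q ^ 3 := by ring
    rw [qPoch_three_mul_succ, e]
    linear_combination qPoch (a * z) q (3 * k) * h
  · intro k; simp [companionB]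
  · intro k
    refine squeeze_zero_norm (fun n => norm_mul_le_of_le (norm_qPoch_le hq1 le_rfl _) (hC' k n).2)
      ?_
    simpa using (hsum2.tendsto_atTop_zero.mul_const C).const_mul _

/-- At z = 0 the two parts of `factorB` are what putting the terms 2n and 2n + 1 over (q;q)_{4n+2}
produces. Thus both families share the same limiting sum. -/
theorem limitB_eq_add {q a : ℂ} (hq1 : ‖q‖ < 1) (n : ℕ) :
    limitB q a n = limitA q a (2 * n) + limitA q a (2 * n + 1) := by
  have h1 := qPoch_self_ne_zero hq1 (4 * n + 1 + 1)
  have e1 : 2 * (2 * n) = 4 * n := by ring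
  have e2 : 2 * (2 * n + 1) = 4 * n + 1 + 1 := by ring
  have e3 : 4 * n + 2 = 4 * n + 1 + 1 := by ring
  have e4 : (2 * n + 1) ^ 2 = 4 * n ^ 2 + (4 * n + 1) := by ring
  have e5 : (2 * n) ^ 2 = 4 * n ^ 2 := by ring
  simp only [limitB, limitA, factorB, e1, e2, e3, e4, e5, qPoch_succ _ _ (2 * n),
    qPoch_succ _ _ (4 * n), qPoch_succ _ _ (4 * n + 1)] at h1 ⊢
  have i1 := right_ne_zero_of_mul h1
  have i2 := right_ne_zero_of_mul (left_ne_zero_of_mul h1)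
  have i3 := left_ne_zero_of_mul (left_ne_zero_of_mul h1)
  have i4 : 1 - q ^ 2 * q ^ (4 * n) ≠ 0 := by
    intro h; apply i1; rw [← h]; ring
  have i5 : 1 - q * q ^ (4 * n + 1) = 1 - q ^ 2 * q ^ (4 * n) := by ring
  rw [i5, pow_add q (4 * n ^ 2), pow_succ q (4 * n)]
  generalize q / a = a'
  field_simp
  ring

theorem hasSum_limitA {q a : ℂ} (ha : a ≠ 0) (hq : q ≠ 0) (hq1 : ‖q‖ < 1) :
    HasSum (limitA q a) (qPochInf (a * q) (q ^ 3) * qPochInf (q ^ 2 / a) (q ^ 3) *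
      qPochInf (q ^ 3) (q ^ 3) / qPochInf q q) :=
  hasSum_bailey ha hq hq1

theorem hasSum_limitB {q a : ℂ} (ha : a ≠ 0) (hq : q ≠ 0) (hq1 : ‖q‖ < 1) :
    HasSum (limitB q a) (∑' n, limitA q a n) := by
  have hs := (hasSum_limitA ha hq hq1).summable
  have h0 := hs.comp_injective (i := fun n : ℕ => 2 * n) (fun m n h => by simpa using h)
  have h1 := hs.comp_injective (i := fun n : ℕ => 2 * n + 1) (fun m n h => by simpa using h)
  rw [← tsum_even_add_odd h0 h1]
  simp_rw [funext (limitB_eq_add (a := a) hq1)]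
  exact h0.hasSum.add h1.hasSum

/-! ### Translation from b, c to a = q^(1/2+3b), z = q^(3c). -/

theorem ofReal_cube_cpow {q : ℝ} (hq : 0 < q) (x : ℂ) : ((q ^ 3 : ℝ) : ℂ) ^ x = (q : ℂ) ^ (3 * x) := by
  have h : (q : ℂ) ≠ 0 := by exact_mod_cast hq.ne'
  have h3 : ((q ^ 3 : ℝ) : ℂ) ≠ 0 := by exact_mod_cast (pow_pos hq 3).ne'
  rw [Complex.cpow_def_of_ne_zero h, Complex.cpow_def_of_ne_zero h3, ← Complex.ofReal_log hq.le,
    ← Complex.ofReal_log (pow_pos hq 3).le, Real.log_pow]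
  push_cast
  ring_nf

/-- Reduces identities between complex powers to polynomial identities in q^b, q^c, q^n and q^(1/2).
-/
theorem cpow_monomial {q : ℂ} (hq : q ≠ 0) (b c : ℂ) (n i j k l : ℕ) {e : ℂ}
    (he : e = i * b + j * c + k * n + l * (1 / 2)) :
    q ^ e = (q ^ b) ^ i * (q ^ c) ^ j * (q ^ n) ^ k * (q ^ (1 / 2 : ℂ)) ^ l := by
  rw [he, Complex.cpow_add _ _ hq, Complex.cpow_add _ _ hq, Complex.cpow_add _ _ hq,
    Complex.cpow_nat_mul, Complex.cpow_nat_mul, Complex.cpow_nat_mul, Complex.cpow_nat_mul,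
    Complex.cpow_natCast]

theorem cpow_half_sq (q : ℂ) : (q ^ (1 / 2 : ℂ)) ^ 2 = q := by
  rw [← Complex.cpow_nat_mul]
  norm_num

theorem cpow_half_add {q : ℂ} (hq : q ≠ 0) (b : ℂ) :
    q ^ (1 / 2 + 3 * b) = q ^ (1 / 2 : ℂ) * (q ^ b) ^ 3 := by
  rw [cpow_monomial hq b 0 0 3 0 0 1 (by push_cast; ring)]; simp; ring

theorem cpow_three_mul (q c : ℂ) : q ^ (3 * c) = (q ^ c) ^ 3 := by
  rw [← Complex.cpow_nat_mul]; norm_num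

/-- The middle factor is the denominator of `termB`, so it cancels whenever it is nonzero. -/
theorem polyB_eq {q : ℂ} (hq : q ≠ 0) (b c : ℂ) (n : ℕ) :
    polyB q b c n = q ^ (4 * b + c + 3) *
      (q ^ (2 * b + 2 * c + 1) - q ^ (-b - c + 3 * n - 1 / 2)) *
      factorB q (q ^ (1 / 2 + 3 * b)) (q ^ (3 * c)) n := by
  have hm : q ^ (-b - c + 3 * n - 1 / 2) =
      (q ^ n) ^ 3 / (q ^ b * q ^ c * q ^ (1 / 2 : ℂ)) := by
    rw [show -b - c + 3 * (n : ℂ) - 1 / 2 = ((3 : ℕ) * (n : ℂ)) - (b + c + 1 / 2) by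
      push_cast; ring, Complex.cpow_sub _ _ hq, Complex.cpow_nat_mul, Complex.cpow_natCast,
      Complex.cpow_add _ _ hq, Complex.cpow_add _ _ hq]
  have key := cpow_monomial hq b c n
  rw [polyB, hm, cpow_half_add hq, cpow_three_mul, factorB]
  rw [key 6 3 4 12 (e := 6 * b + 3 * c + 4 * n + 6) (by push_cast; ring),
    key 9 6 5 9 (e := 9 * b + 6 * c + 5 * n + 9 / 2) (by push_cast; ring),
    key 9 6 5 11 (e := 9 * b + 6 * c + 5 * n + 11 / 2) (by push_cast; ring),
    key 3 3 6 11 (e := 3 * b + 3 * c + 6 * n + 11 / 2) (by push_cast; ring),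
    key 9 3 6 11 (e := 9 * b + 3 * c + 6 * n + 11 / 2) (by push_cast; ring),
    key 6 6 7 12 (e := 6 * b + 6 * c + 7 * n + 6) (by push_cast; ring),
    key 12 6 7 12 (e := 12 * b + 6 * c + 7 * n + 6) (by push_cast; ring),
    key 6 3 8 6 (e := 6 * b + 3 * c + 8 * n + 3) (by push_cast; ring),
    key 6 3 8 8 (e := 6 * b + 3 * c + 8 * n + 4) (by push_cast; ring),
    key 6 3 8 12 (e := 6 * b + 3 * c + 8 * n + 6) (by push_cast; ring),
    key 6 3 8 14 (e := 6 * b + 3 * c + 8 * n + 7) (by push_cast; ring),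
    key 9 6 9 11 (e := 9 * b + 6 * c + 9 * n + 11 / 2) (by push_cast; ring),
    key 3 3 10 9 (e := 3 * b + 3 * c + 10 * n + 9 / 2) (by push_cast; ring),
    key 9 3 10 9 (e := 9 * b + 3 * c + 10 * n + 9 / 2) (by push_cast; ring),
    key 6 3 12 8 (e := 6 * b + 3 * c + 12 * n + 4) (by push_cast; ring),
    key 9 6 13 15 (e := 9 * b + 6 * c + 13 * n + 15 / 2) (by push_cast; ring),
    key 6 3 16 12 (e := 6 * b + 3 * c + 16 * n + 6) (by push_cast; ring),
    key 6 3 0 8 (e := 6 * b + 3 * c + 4) (by push_cast; ring),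
    key 3 0 3 5 (e := 3 * b + 3 * n + 5 / 2) (by push_cast; ring),
    key 3 0 7 9 (e := 3 * b + 7 * n + 9 / 2) (by push_cast; ring),
    key 6 0 9 8 (e := 6 * b + 9 * n + 4) (by push_cast; ring),
    key 3 0 11 9 (e := 3 * b + 11 * n + 9 / 2) (by push_cast; ring),
    key 3 0 11 11 (e := 3 * b + 11 * n + 11 / 2) (by push_cast; ring),
    key 0 0 9 8 (e := 9 * n + 4) (by push_cast; ring),
    key 4 1 0 6 (e := 4 * b + c + 3) (by push_cast; ring),
    key 2 2 0 2 (e := 2 * b + 2 * c + 1) (by push_cast; ring)]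
  have hh := cpow_half_sq q
  have hB : q ^ b ≠ 0 := by simp [Complex.cpow_eq_zero_iff, hq]
  have hG : q ^ c ≠ 0 := by simp [Complex.cpow_eq_zero_iff, hq]
  have hH : q ^ (1 / 2 : ℂ) ≠ 0 := by simp [Complex.cpow_eq_zero_iff, hq]
  simp only [pow_add q, pow_mul' q, pow_one]
  generalize q ^ b = B at *
  generalize q ^ c = G at *
  generalize q ^ (1 / 2 : ℂ) = h at *
  generalize q ^ n = N at *
  -- All integer powers of q become even powers of h = q^(1/2), leaving a rational identity in
  -- independent variables.
  subst hh
  field_simp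
  ring

theorem auxPolyB_eq {q : ℂ} (hq : q ≠ 0) (b : ℂ) (n : ℕ) :
    auxPolyB q b n = q ^ (1 / 2 + 3 * b) * factorB q (q ^ (1 / 2 + 3 * b)) 0 n := by
  have key := cpow_monomial hq b 0 n
  rw [auxPolyB, cpow_half_add hq, factorB,
    key 3 0 4 5 (e := 3 * b + 4 * n + 5 / 2) (by push_cast; ring),
    key 6 0 6 4 (e := 6 * b + 6 * n + 2) (by push_cast; ring),
    key 3 0 8 5 (e := 3 * b + 8 * n + 5 / 2) (by push_cast; ring),
    key 3 0 8 7 (e := 3 * b + 8 * n + 7 / 2) (by push_cast; ring),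
    key 3 0 0 1 (e := 3 * b + 1 / 2) (by push_cast; ring),
    key 0 0 6 4 (e := 6 * n + 2) (by push_cast; ring)]
  have hh := cpow_half_sq q
  have hB : q ^ b ≠ 0 := by simp [Complex.cpow_eq_zero_iff, hq]
  have hH : q ^ (1 / 2 : ℂ) ≠ 0 := by simp [Complex.cpow_eq_zero_iff, hq]
  simp only [pow_add q, pow_mul' q, pow_one]
  generalize q ^ b = B at *
  generalize q ^ (1 / 2 : ℂ) = h at *
  generalize q ^ n = N at *
  subst hh
  field_simp
  ring

theorem ofReal_ne_zero_of_pos {q : ℝ} (hq : 0 < q) : (q : ℂ) ≠ 0 := by exact_mod_cast hq.ne'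

theorem cpow_ne_zero_of_pos {q : ℝ} (hq : 0 < q) (x : ℂ) : (q : ℂ) ^ x ≠ 0 := by
  simp [Complex.cpow_eq_zero_iff, hq.ne']

theorem cpow_param₁ {q : ℝ} (hq : 0 < q) (b : ℂ) : (q : ℂ) ^ (1 / 2 - 3 * b) = q / (q : ℂ) ^ (1 / 2 + 3 * b) := by
  have h := ofReal_ne_zero_of_pos hq
  rw [eq_div_iff (cpow_ne_zero_of_pos hq _), ← Complex.cpow_add _ _ h]
  ring_nf
  simp

theorem cpow_param₂ {q : ℝ} (hq : 0 < q) (b c : ℂ) :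
    (q : ℂ) ^ (3 * b + 3 * c + 1 / 2) = (q : ℂ) ^ (1 / 2 + 3 * b) * (q : ℂ) ^ (3 * c) := by
  rw [← Complex.cpow_add _ _ (ofReal_ne_zero_of_pos hq)]; ring_nf

theorem cpow_param₃ {q : ℝ} (hq : 0 < q) (b c : ℂ) (n : ℕ) : (q : ℂ) ^ (3 * b + 3 * c + 4 * n + 1 / 2) =
    (q : ℂ) ^ (1 / 2 + 3 * b) * (q : ℂ) ^ (3 * c) * (q : ℂ) ^ (4 * n) := by
  rw [← Complex.cpow_natCast, ← Complex.cpow_add _ _ (ofReal_ne_zero_of_pos hq),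
    ← Complex.cpow_add _ _ (ofReal_ne_zero_of_pos hq)]
  push_cast; ring_nf

theorem cpow_param₄ {q : ℝ} (hq : 0 < q) (c : ℂ) : (q : ℂ) ^ (3 * c + 3) = (q : ℂ) ^ (3 * c) * (q : ℂ) ^ 3 := by
  rw [← Complex.cpow_natCast, ← Complex.cpow_add _ _ (ofReal_ne_zero_of_pos hq)]
  norm_num

theorem cpow_param₅ {q : ℝ} (hq : 0 < q) (b c : ℂ) : (q : ℂ) ^ (6 * b + 3 * c + 3) =
    ((q : ℂ) ^ (1 / 2 + 3 * b)) ^ 2 * (q : ℂ) ^ (3 * c) * (q : ℂ) ^ 2 := by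
  rw [← Complex.cpow_nat_mul, ← Complex.cpow_natCast (q : ℂ) 2,
    ← Complex.cpow_add _ _ (ofReal_ne_zero_of_pos hq),
    ← Complex.cpow_add _ _ (ofReal_ne_zero_of_pos hq)]
  push_cast; ring_nf

theorem cpow_param₆ {q : ℝ} (hq : 0 < q) (b c : ℂ) : (q : ℂ) ^ (3 * b + 3 * c + 3 / 2) =
    (q : ℂ) ^ (1 / 2 + 3 * b) * (q : ℂ) ^ (3 * c) * (q : ℂ) := by
  rw [← cpow_param₂ hq]
  nth_rewrite 3 [← Complex.cpow_one (q : ℂ)]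
  rw [← Complex.cpow_add _ _ (ofReal_ne_zero_of_pos hq)]
  ring_nf

theorem cpow_param₇ {q : ℝ} (hq : 0 < q) (b c : ℂ) : (q : ℂ) ^ (3 / 2 - 3 * b - 3 * c) =
    (q : ℂ) ^ 3 / ((q : ℂ) ^ (1 / 2 + 3 * b) * (q : ℂ) ^ (3 * c) * q) := by
  rw [← cpow_param₆ hq, ← Complex.cpow_natCast, ← Complex.cpow_sub _ _ (ofReal_ne_zero_of_pos hq)]
  push_cast; ring_nf

theorem cpow_add_three_mul {q : ℝ} (hq : 0 < q) (x : ℂ) (j : ℕ) :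
    (q : ℂ) ^ (x + 3 * j) = (q : ℂ) ^ x * ((q : ℂ) ^ 3) ^ j := by
  rw [Complex.cpow_add _ _ (ofReal_ne_zero_of_pos hq), ← pow_mul, ← Complex.cpow_natCast]
  push_cast; rfl

theorem norm_ofReal_lt_one {q : ℝ} (hq : 0 < q) (hq1 : q < 1) : ‖(q : ℂ)‖ < 1 := by
  rwa [Complex.norm_real, Real.norm_of_nonneg hq.le]

theorem auxA_eq {q : ℝ} (hq : 0 < q) (b : ℂ) :
    auxA q b = limitA q ((q : ℂ) ^ (1 / 2 + 3 * b)) := by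
  funext n
  rw [auxA, limitA, cpow_param₁ hq]
  ring

theorem auxB_eq {q : ℝ} (hq : 0 < q) (b : ℂ) (n : ℕ) :
    auxB q b n = (q : ℂ) ^ (1 / 2 + 3 * b) * limitB q ((q : ℂ) ^ (1 / 2 + 3 * b)) n := by
  have h : (3 : ℂ) * b + 1 / 2 = 1 / 2 + 3 * b := by ring
  rw [auxB, limitB, cpow_param₁ hq, auxPolyB_eq (ofReal_ne_zero_of_pos hq), h]
  ring

/-- The product `(z q³, a² z q², a z q; q³)_∞`. -/
noncomputable def denomInf (q a z : ℂ) : ℂ :=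
  qPochInf (z * q ^ 3) (q ^ 3) * qPochInf (a ^ 2 * z * q ^ 2) (q ^ 3) *
    qPochInf (a * z * q) (q ^ 3)

/-- Trades a finite denominator for an infinite tail over a constant; this is how `denomInf` appears
in every term. -/
theorem div_qPoch_eq {p x : ℂ} (hp : ‖p‖ < 1) (hx : qPochInf x p ≠ 0) (n : ℕ) :
    (qPoch x p n)⁻¹ = qPochInf (x * p ^ n) p / qPochInf x p := by
  have h := qPochInf_eq hp x n
  have h1 : qPoch x p n ≠ 0 := fun h0 => hx (by rw [h, h0, zero_mul])
  rw [eq_div_iff hx, h, inv_mul_cancel_left₀ h1]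

theorem termA_eq {q : ℝ} (hq : 0 < q) (hq1 : q < 1) (b c : ℂ)
    (h : denomInf q ((q : ℂ) ^ (1 / 2 + 3 * b)) ((q : ℂ) ^ (3 * c)) ≠ 0) (n : ℕ) :
    termA q b c n = clearedA q ((q : ℂ) ^ (1 / 2 + 3 * b)) ((q : ℂ) ^ (3 * c)) n /
      denomInf q ((q : ℂ) ^ (1 / 2 + 3 * b)) ((q : ℂ) ^ (3 * c)) := by
  have hp := norm_cube_lt_one (norm_ofReal_lt_one hq hq1)
  have e : (3 : ℂ) + 6 * b + 3 * c = 6 * b + 3 * c + 3 := by ring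
  rw [termA, e, cpow_param₁ hq, cpow_param₂ hq, cpow_param₃ hq, cpow_param₄ hq, cpow_param₅ hq,
    clearedA]
  rw [denomInf] at h ⊢
  generalize (q : ℂ) ^ (1 / 2 + 3 * b) = a at *
  generalize (q : ℂ) ^ (3 * c) = z at *
  have h3 := right_ne_zero_of_mul h
  have h2 := right_ne_zero_of_mul (left_ne_zero_of_mul h)
  have h1 := left_ne_zero_of_mul (left_ne_zero_of_mul h)
  have e1 : z * (q : ℂ) ^ (3 * n + 3) = z * (q : ℂ) ^ 3 * ((q : ℂ) ^ 3) ^ n := by ring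
  have e2 : a ^ 2 * z * (q : ℂ) ^ (3 * n + 2) = a ^ 2 * z * (q : ℂ) ^ 2 * ((q : ℂ) ^ 3) ^ n := by
    ring
  rw [div_eq_mul_inv, mul_inv, mul_inv, div_qPoch_eq hp h1, div_qPoch_eq hp h2, e1, e2]
  field_simp

/-- With x = azq, reversal turns (−x)^n (q³/x; q³)_n into a power of q times (x q^(−3n); q³)_n,
which joins (x; q³)_∞ to form the infinite product in `clearedB`. -/
theorem termB_eq {q : ℝ} (hq : 0 < q) (hq1 : q < 1) (b c : ℂ)
    (h : denomInf q ((q : ℂ) ^ (1 / 2 + 3 * b)) ((q : ℂ) ^ (3 * c)) ≠ 0) (n : ℕ)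
    (hn : (q : ℂ) ^ (2 * b + 2 * c + 1) ≠ (q : ℂ) ^ (-b - c + 3 * n - 1 / 2)) :
    termB q b c n = (q : ℂ) ^ (3 * b + 3) *
      (clearedB q ((q : ℂ) ^ (1 / 2 + 3 * b)) ((q : ℂ) ^ (3 * c)) n /
      denomInf q ((q : ℂ) ^ (1 / 2 + 3 * b)) ((q : ℂ) ^ (3 * c))) := by
  have hp := norm_cube_lt_one (norm_ofReal_lt_one hq hq1)
  have hq0 := ofReal_ne_zero_of_pos hq
  have e : (3 : ℂ) * b + 1 / 2 = 1 / 2 + 3 * b := by ring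
  -- Exponent bookkeeping: the prefactor of `termB`, the monomial of `polyB_eq` and the power from
  -- the reversal together give q^(3b+3) q^(4n²) (azq)^n.
  have hpow : (q : ℂ) ^ (3 * b * n - b + 3 * c * n - c + 5 * n ^ 2 / 2) *
      (q : ℂ) ^ (4 * b + c + 3) * (((q : ℂ) ^ 3) ^ ((n + 1).choose 2)) =
      (q : ℂ) ^ (3 * b + 3) * (q : ℂ) ^ (4 * n ^ 2) *
        ((q : ℂ) ^ (1 / 2 + 3 * b) * (q : ℂ) ^ (3 * c) * q) ^ n := by
    have hc : (((n + 1).choose 2 : ℕ) : ℂ) = (n + 1) * n / 2 := by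
      have h := choose_two_cast (n + 1)
      rw [eq_div_iff (two_ne_zero' ℂ)]
      have h' : ((((n + 1).choose 2 : ℕ) : ℤ) : ℂ) * 2 = ((n + 1 : ℕ) : ℂ) * ((n + 1 : ℕ) - 1) := by
        exact_mod_cast congrArg (Int.cast (R := ℂ)) h
      push_cast at h'
      rw [h']; ring
    rw [← cpow_param₆ hq, ← pow_mul, ← Complex.cpow_natCast (q : ℂ) (3 * _),
      ← Complex.cpow_natCast (q : ℂ) (4 * _), ← Complex.cpow_nat_mul]
    simp only [← Complex.cpow_add _ _ hq0]
    congr 1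
    push_cast
    rw [hc]
    ring
  have hpn := qPoch_mul_pow_neg (x := (q : ℂ) ^ (1 / 2 + 3 * b) * (q : ℂ) ^ (3 * c) * q)
    (mul_ne_zero (mul_ne_zero (cpow_ne_zero_of_pos hq _) (cpow_ne_zero_of_pos hq _)) hq0)
    (pow_ne_zero 3 hq0) n
  have hpf := sub_ne_zero.2 hn
  have hx0 : ((q : ℂ) ^ (1 / 2 + 3 * b) * (q : ℂ) ^ (3 * c) * q) ^ n ≠ 0 := pow_ne_zero _
    (mul_ne_zero (mul_ne_zero (cpow_ne_zero_of_pos hq _) (cpow_ne_zero_of_pos hq _)) hq0)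
  rw [termB, polyB_eq hq0, e, cpow_param₁ hq, cpow_param₂ hq, cpow_param₄ hq, cpow_param₅ hq,
    cpow_param₇ hq, clearedB]
  rw [denomInf] at h ⊢
  generalize (q : ℂ) ^ (2 * b + 2 * c + 1) - (q : ℂ) ^ (-b - c + 3 * n - 1 / 2) = pf at *
  generalize (q : ℂ) ^ (1 / 2 + 3 * b) = a at *
  generalize (q : ℂ) ^ (3 * c) = z at *
  have h3 := right_ne_zero_of_mul h
  have h2 := right_ne_zero_of_mul (left_ne_zero_of_mul h)
  have h1 := left_ne_zero_of_mul (left_ne_zero_of_mul h)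
  have e1 : z * (q : ℂ) ^ (3 * n + 3) = z * (q : ℂ) ^ 3 * ((q : ℂ) ^ 3) ^ n := by ring
  have e2 : a ^ 2 * z * (q : ℂ) ^ (3 * n + 2) = a ^ 2 * z * (q : ℂ) ^ 2 * ((q : ℂ) ^ 3) ^ n := by
    ring
  have e3 := qPochInf_eq hp (a * z * q / ((q : ℂ) ^ 3) ^ n) n
  rw [div_mul_cancel₀ _ (pow_ne_zero _ (pow_ne_zero 3 hq0)), div_eq_mul_inv (a * z * q)] at e3
  rw [div_eq_mul_inv, mul_inv, mul_inv, mul_inv, div_qPoch_eq hp h1, div_qPoch_eq hp h2, e1, e2,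
    div_eq_mul_inv (a * z * q), e3]
  rw [neg_pow] at hpn
  apply mul_left_cancel₀ hx0
  generalize qPoch (a * z * q * (((q : ℂ) ^ 3) ^ n)⁻¹) ((q : ℂ) ^ 3) n = Y at *
  generalize qPoch ((q : ℂ) ^ 3 / (a * z * q)) ((q : ℂ) ^ 3) n = Y' at *
  generalize (q : ℂ) ^ (3 * b * n - b + 3 * c * n - c + 5 * n ^ 2 / 2) = E1 at *
  generalize (q : ℂ) ^ (4 * b + c + 3) = E2 at *
  generalize ((q : ℂ) ^ 3) ^ ((n + 1).choose 2) = E3 at *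
  generalize (q : ℂ) ^ (3 * b + 3) = E4 at *
  generalize (q : ℂ) ^ (4 * n ^ 2) = E5 at *
  generalize (a * z * q) ^ n = E6 at *
  generalize factorB q a z n = F at *
  have main : E6 * ((-1) ^ n * E1 * (E2 * pf * F) * Y') * pf⁻¹ = E6 * (E4 * (E5 * Y)) * F := by
    have : E6 * ((-1) ^ n * E1 * (E2 * pf * F) * Y') * pf⁻¹ =
        E1 * E2 * F * ((-1) ^ n * E6 * Y') * (pf * pf⁻¹) := by ring
    rw [this, mul_inv_cancel₀ hpf, ← hpn]
    linear_combination Y * F * hpow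
  generalize qPoch a q (2 * n) = P1
  generalize qPoch (q / a) q (2 * n) = P2
  generalize qPoch (a * z) q n = P3
  have main2 := congrArg (fun t => t * (P1 * P2 * P3) * (qPoch q q (4 * n + 2))⁻¹ *
    (qPochInf (z * q ^ 3 * (q ^ 3) ^ n) (q ^ 3) / qPochInf (z * q ^ 3) (q ^ 3) *
     (qPochInf (a ^ 2 * z * q ^ 2 * (q ^ 3) ^ n) (q ^ 3) /
       qPochInf (a ^ 2 * z * q ^ 2) (q ^ 3)))) main
  convert main2 using 1
  · ring
  · field_simp

/-! ### The q-gamma factors as infinite products. -/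

theorem qPoch_three_mul (a q : ℂ) (n : ℕ) : qPoch a q (3 * n) =
    qPoch a (q ^ 3) n * qPoch (a * q) (q ^ 3) n * qPoch (a * q ^ 2) (q ^ 3) n := by
  induction n with
  | zero => simp [qPoch_zero]
  | succ n ih =>
    have e : 3 * (n + 1) = 3 * n + 1 + 1 + 1 := by ring
    rw [e]
    simp only [qPoch_succ]
    rw [ih]
    ring

theorem qPochInf_trisection {q : ℂ} (hq1 : ‖q‖ < 1) (a : ℂ) : qPochInf a q =
    qPochInf a (q ^ 3) * qPochInf (a * q) (q ^ 3) * qPochInf (a * q ^ 2) (q ^ 3) := by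
  have hp := norm_cube_lt_one hq1
  refine tendsto_nhds_unique (tendsto_qPoch_three_mul hq1 a) ?_
  simp_rw [qPoch_three_mul]
  exact ((tendsto_qPoch hp _).mul (tendsto_qPoch hp _)).mul (tendsto_qPoch hp _)

/-- No pole needs to be excluded: if (q^x;q)_∞ = 0, the conventional inverse is 0, as is the right
side. -/
theorem inv_qGamma_mul_qGamma {q : ℝ} (hq1 : q < 1) {x y : ℂ} (hxy : x + y = 1) :
    (qGamma q x * qGamma q y)⁻¹ = qPochInf ((q : ℂ) ^ x) q * qPochInf ((q : ℂ) ^ y) q /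
      (qPochInf q q ^ 2 * (1 - q)) := by
  have hu : ((1 - q : ℝ) : ℂ) ≠ 0 := by exact_mod_cast (sub_pos.2 hq1).ne'
  have h : ((1 - q : ℝ) : ℂ) ^ (1 - x) * ((1 - q : ℝ) : ℂ) ^ (1 - y) = 1 - q := by
    rw [← Complex.cpow_add _ _ hu]
    have : 1 - x + (1 - y) = 1 := by linear_combination -hxy
    rw [this, Complex.cpow_one]
    push_cast; rfl
  rw [← h, qGamma, qGamma]
  simp only [mul_inv, div_eq_mul_inv, inv_inv]
  ring

theorem qPochInf_cube_ne_zero {q : ℝ} (hq : 0 < q) (x : ℂ)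
    (h : ∀ j : ℕ, (q : ℂ) ^ (x + 3 * j) ≠ 1) (hq1 : q < 1) :
    qPochInf ((q : ℂ) ^ x) ((q : ℂ) ^ 3) ≠ 0 :=
  qPochInf_ne_zero (norm_cube_lt_one (norm_ofReal_lt_one hq hq1)) fun k => by
    rw [← cpow_add_three_mul hq]; exact h k

/-- Since (1−q)(q²+q+1) = 1−q³, every power can be written with base 1−q³, and the exponents add up
to 1. -/
theorem one_sub_mul_cpow {q : ℝ} (hq : 0 < q) (hq1 : q < 1) (b c : ℂ) :
    (1 - q) * ((q : ℂ) ^ 2 + q + 1) ^ (3 * b + 3 * c + 1 / 2) *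
      ((1 - q ^ 3 : ℝ) : ℂ) ^ (1 - (c + 1)) * ((1 - q ^ 3 : ℝ) : ℂ) ^ (1 - (b + c + 1 / 2)) *
      ((1 - q ^ 3 : ℝ) : ℂ) ^ (1 - (2 * b + c + 1)) *
      (((1 - q : ℝ) : ℂ) ^ (1 - (3 * b + 3 * c + 1 / 2)))⁻¹ = 1 - (q : ℂ) ^ 3 := by
  have hu : ((1 - q : ℝ) : ℂ) ≠ 0 := by exact_mod_cast (sub_pos.2 hq1).ne'
  have hv : ((1 - q ^ 3 : ℝ) : ℂ) ≠ 0 := by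
    exact_mod_cast (sub_pos.2 (pow_lt_one₀ hq.le hq1 three_ne_zero)).ne'
  set e := 3 * b + 3 * c + 1 / 2 with he
  have h1 : ((1 - q : ℝ) : ℂ) * (((1 - q : ℝ) : ℂ) ^ (1 - e))⁻¹ = ((1 - q : ℝ) : ℂ) ^ e := by
    rw [← Complex.cpow_neg]
    nth_rewrite 1 [← Complex.cpow_one ((1 - q : ℝ) : ℂ)]
    rw [← Complex.cpow_add _ _ hu]
    congr 1; ring
  have h2 : ((q : ℂ) ^ 2 + q + 1) ^ e * ((1 - q : ℝ) : ℂ) ^ e = ((1 - q ^ 3 : ℝ) : ℂ) ^ e := by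
    have hw : (q : ℂ) ^ 2 + q + 1 = ((q ^ 2 + q + 1 : ℝ) : ℂ) := by push_cast; rfl
    rw [hw, ← Complex.mul_cpow_ofReal_nonneg (by positivity) (sub_pos.2 hq1).le,
      ← Complex.ofReal_mul]
    congr 2; ring
  have h3 : ((1 - q ^ 3 : ℝ) : ℂ) ^ e * (((1 - q ^ 3 : ℝ) : ℂ) ^ (1 - (c + 1)) *
      ((1 - q ^ 3 : ℝ) : ℂ) ^ (1 - (b + c + 1 / 2)) *
      ((1 - q ^ 3 : ℝ) : ℂ) ^ (1 - (2 * b + c + 1))) = 1 - (q : ℂ) ^ 3 := by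
    rw [← Complex.cpow_add _ _ hv, ← Complex.cpow_add _ _ hv, ← Complex.cpow_add _ _ hv]
    have : e + (1 - (c + 1) + (1 - (b + c + 1 / 2)) + (1 - (2 * b + c + 1))) = 1 := by
      rw [he]; ring
    rw [this, Complex.cpow_one]
    push_cast; rfl
  rw [← h3, ← h2, ← h1]
  push_cast
  ring

/-- The normalizing factor `N(b, c)`. -/
noncomputable def normFactor (q : ℝ) (b c : ℂ) : ℂ :=
  (1 - q) * ((q : ℂ) ^ 2 + q + 1) ^ (3 * b + 3 * c + 1 / 2) *
    qGamma (q ^ 3) (c + 1) * qGamma (q ^ 3) (b + c + 1 / 2) * qGamma (q ^ 3) (2 * b + c + 1)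

theorem normFactor_mul_inv {q : ℝ} (hq : 0 < q) (hq1 : q < 1) (b c : ℂ) :
    normFactor q b c * (qGamma q (3 * b + 3 * c + 1 / 2))⁻¹ =
      (1 - (q : ℂ) ^ 3) * qPochInf ((q : ℂ) ^ 3) ((q : ℂ) ^ 3) ^ 3 *
        qPochInf ((q : ℂ) ^ (1 / 2 + 3 * b) * (q : ℂ) ^ (3 * c)) q *
        (qPochInf q q * denomInf q ((q : ℂ) ^ (1 / 2 + 3 * b)) ((q : ℂ) ^ (3 * c)))⁻¹ := by
  rw [← one_sub_mul_cpow hq hq1 b c, normFactor]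
  simp only [qGamma, ofReal_cube_cpow hq, denomInf]
  simp only [Complex.ofReal_pow]
  have e1 : 3 * (c + 1) = 3 * c + 3 := by ring
  have e2 : 3 * (b + c + 1 / 2) = 3 * b + 3 * c + 3 / 2 := by ring
  have e3 : 3 * (2 * b + c + 1) = 6 * b + 3 * c + 3 := by ring
  rw [e1, e2, e3, cpow_param₄ hq, cpow_param₅ hq, cpow_param₆ hq, cpow_param₂ hq]
  simp only [mul_inv, div_eq_mul_inv, inv_inv]
  ring

theorem inv_qGamma_third {q : ℝ} (hq : 0 < q) (hq1 : q < 1) :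
    (qGamma (q ^ 3) (1 / 3) * qGamma (q ^ 3) (2 / 3))⁻¹ =
      qPochInf q ((q : ℂ) ^ 3) * qPochInf ((q : ℂ) * q) ((q : ℂ) ^ 3) /
        (qPochInf ((q : ℂ) ^ 3) ((q : ℂ) ^ 3) ^ 2 * (1 - (q : ℂ) ^ 3)) := by
  rw [inv_qGamma_mul_qGamma (pow_lt_one₀ hq.le hq1 three_ne_zero) (by norm_num)]
  simp only [ofReal_cube_cpow hq]
  simp only [Complex.ofReal_pow]
  have e1 : (q : ℂ) ^ (3 * (1 / 3) : ℂ) = q := by norm_num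
  have e2 : (q : ℂ) ^ (3 * (2 / 3) : ℂ) = (q : ℂ) * q := by
    rw [← sq, ← Complex.cpow_natCast]; norm_num
  rw [e1, e2]

theorem inv_qGamma_half {q : ℝ} (hq : 0 < q) (hq1 : q < 1) (b : ℂ) :
    (qGamma (q ^ 3) (1 / 2 - b) * qGamma (q ^ 3) (b + 1 / 2))⁻¹ =
      qPochInf ((q : ℂ) ^ 2 / (q : ℂ) ^ (1 / 2 + 3 * b)) ((q : ℂ) ^ 3) *
        qPochInf ((q : ℂ) ^ (1 / 2 + 3 * b) * q) ((q : ℂ) ^ 3) /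
        (qPochInf ((q : ℂ) ^ 3) ((q : ℂ) ^ 3) ^ 2 * (1 - (q : ℂ) ^ 3)) := by
  have hq0 := ofReal_ne_zero_of_pos hq
  rw [inv_qGamma_mul_qGamma (pow_lt_one₀ hq.le hq1 three_ne_zero) (by ring)]
  simp only [ofReal_cube_cpow hq]
  simp only [Complex.ofReal_pow]
  have e1 : (q : ℂ) ^ (3 * (1 / 2 - b)) = (q : ℂ) ^ 2 / (q : ℂ) ^ (1 / 2 + 3 * b) := by
    rw [← Complex.cpow_natCast, ← Complex.cpow_sub _ _ hq0]
    push_cast; ring_nf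
  have e2 : (q : ℂ) ^ (3 * (b + 1 / 2)) = (q : ℂ) ^ (1 / 2 + 3 * b) * q := by
    nth_rewrite 3 [← Complex.cpow_one (q : ℂ)]
    rw [← Complex.cpow_add _ _ hq0]
    ring_nf
  rw [e1, e2]

/-- The factor `C(b, c)`. -/
theorem normFactor_div_third {q : ℝ} (hq : 0 < q) (hq1 : q < 1) (b c : ℂ) :
    normFactor q b c / (qGamma (q ^ 3) (1 / 3) * qGamma (q ^ 3) (2 / 3) *
        qGamma q (3 * b + 3 * c + 1 / 2)) =
      qPochInf ((q : ℂ) ^ (1 / 2 + 3 * b) * (q : ℂ) ^ (3 * c)) q /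
        denomInf q ((q : ℂ) ^ (1 / 2 + 3 * b)) ((q : ℂ) ^ (3 * c)) := by
  have hn := norm_ofReal_lt_one hq hq1
  have h0 := qPochInf_ne_zero_of_norm_lt hn hn
  have h3 := norm_cube_lt_one hn
  have h1 : 1 - (q : ℂ) ^ 3 ≠ 0 := by
    intro h
    rw [← sub_eq_zero.1 h] at h3
    simp at h3
  -- (q, q², q³; q³)_∞ = (q;q)_∞ is what removes Γ_{q³}(1/3) Γ_{q³}(2/3).
  have ht := qPochInf_trisection hn q
  have e : (q : ℂ) * (q : ℂ) ^ 2 = (q : ℂ) ^ 3 := by ring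
  rw [e] at ht
  rw [div_eq_mul_inv, mul_inv, mul_left_comm, normFactor_mul_inv hq hq1, inv_qGamma_third hq hq1,
    mul_inv, div_eq_mul_inv _ (denomInf _ _ _)]
  generalize (denomInf _ _ _)⁻¹ = D
  rw [ht] at h0 ⊢
  have i1 := right_ne_zero_of_mul h0
  have i2 := right_ne_zero_of_mul (left_ne_zero_of_mul h0)
  have i3 := left_ne_zero_of_mul (left_ne_zero_of_mul h0)
  generalize qPochInf (q : ℂ) ((q : ℂ) ^ 3) = X at *
  generalize qPochInf ((q : ℂ) * q) ((q : ℂ) ^ 3) = Y at *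
  field_simp

/-- The factor `R(b, c)`. -/
theorem normFactor_div_half {q : ℝ} (hq : 0 < q) (hq1 : q < 1) (b c : ℂ) :
    normFactor q b c / (qGamma (q ^ 3) (1 / 2 - b) * qGamma (q ^ 3) (b + 1 / 2) *
        qGamma q (3 * b + 3 * c + 1 / 2)) =
      qPochInf ((q : ℂ) ^ (1 / 2 + 3 * b) * (q : ℂ) ^ (3 * c)) q /
        denomInf q ((q : ℂ) ^ (1 / 2 + 3 * b)) ((q : ℂ) ^ (3 * c)) *
      ∑' n, limitA q ((q : ℂ) ^ (1 / 2 + 3 * b)) n := by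
  have hn := norm_ofReal_lt_one hq hq1
  have h0 := qPochInf_ne_zero_of_norm_lt hn hn
  have h3 := norm_cube_lt_one hn
  have h1 : 1 - (q : ℂ) ^ 3 ≠ 0 := by
    intro h
    rw [← sub_eq_zero.1 h] at h3
    simp at h3
  have i1 := qPochInf_ne_zero_of_norm_lt h3 h3
  -- The product for S(a) contains (aq, q²/a; q³)_∞, which is exactly what 1/(Γ_{q³}(1/2−b)
  -- Γ_{q³}(b+1/2)) contributes.
  rw [(hasSum_limitA (cpow_ne_zero_of_pos hq _) (ofReal_ne_zero_of_pos hq) hn).tsum_eq,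
    div_eq_mul_inv, mul_inv, mul_left_comm, normFactor_mul_inv hq hq1, inv_qGamma_half hq hq1,
    mul_inv, div_eq_mul_inv _ (denomInf _ _ _)]
  generalize (denomInf _ _ _)⁻¹ = D
  field_simp

/-! ### The two-variable formulas. -/

theorem denomInf_ne_zero {q : ℝ} (hq : 0 < q) (hq1 : q < 1) {b c : ℂ}
    (h1 : ∀ j : ℕ, (q : ℂ) ^ (3 * c + 3 + 3 * j) ≠ 1)
    (h2 : ∀ j : ℕ, (q : ℂ) ^ (6 * b + 3 * c + 3 + 3 * j) ≠ 1)
    (h3 : ∀ j : ℕ, (q : ℂ) ^ (3 * b + 3 * c + 3 / 2 + 3 * j) ≠ 1) :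
    denomInf q ((q : ℂ) ^ (1 / 2 + 3 * b)) ((q : ℂ) ^ (3 * c)) ≠ 0 := by
  rw [denomInf, ← cpow_param₄ hq, ← cpow_param₅ hq, ← cpow_param₆ hq]
  exact mul_ne_zero (mul_ne_zero (qPochInf_cube_ne_zero hq _ h1 hq1)
    (qPochInf_cube_ne_zero hq _ h2 hq1)) (qPochInf_cube_ne_zero hq _ h3 hq1)

theorem hasSum_termA {q : ℝ} (hq : 0 < q) (hq1 : q < 1) {b c : ℂ}
    (h : denomInf q ((q : ℂ) ^ (1 / 2 + 3 * b)) ((q : ℂ) ^ (3 * c)) ≠ 0) :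
    HasSum (termA q b c) (qPochInf ((q : ℂ) ^ (1 / 2 + 3 * b) * (q : ℂ) ^ (3 * c)) q /
        denomInf q ((q : ℂ) ^ (1 / 2 + 3 * b)) ((q : ℂ) ^ (3 * c)) *
      ∑' n, limitA q ((q : ℂ) ^ (1 / 2 + 3 * b)) n) := by
  rw [funext (termA_eq hq hq1 b c h), div_mul_eq_mul_div]
  exact (hasSum_clearedA (cpow_ne_zero_of_pos hq _) (ofReal_ne_zero_of_pos hq)
    (norm_ofReal_lt_one hq hq1) _).div_const _

theorem hasSum_termB {q : ℝ} (hq : 0 < q) (hq1 : q < 1) {b c : ℂ}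
    (h : denomInf q ((q : ℂ) ^ (1 / 2 + 3 * b)) ((q : ℂ) ^ (3 * c)) ≠ 0)
    (hn : ∀ n : ℕ, (q : ℂ) ^ (2 * b + 2 * c + 1) ≠ (q : ℂ) ^ (-b - c + 3 * n - 1 / 2)) :
    HasSum (termB q b c) ((q : ℂ) ^ (3 * b + 3) *
      (qPochInf ((q : ℂ) ^ (1 / 2 + 3 * b) * (q : ℂ) ^ (3 * c)) q /
        denomInf q ((q : ℂ) ^ (1 / 2 + 3 * b)) ((q : ℂ) ^ (3 * c)) *
      ∑' n, limitA q ((q : ℂ) ^ (1 / 2 + 3 * b)) n)) := by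
  have ha := cpow_ne_zero_of_pos hq (1 / 2 + 3 * b)
  have h0 := ofReal_ne_zero_of_pos hq
  have h1 := norm_ofReal_lt_one hq hq1
  rw [funext fun n => termB_eq hq hq1 b c h n (hn n), div_mul_eq_mul_div,
    ← (hasSum_limitB ha h0 h1).tsum_eq]
  exact ((hasSum_clearedB ha h0 h1 _).div_const _).mul_left _

theorem two_variable_formulas {q : ℝ} (hq : 0 < q) (hq1 : q < 1) {b c : ℂ}
    (h1 : ∀ j : ℕ, (q : ℂ) ^ (3 * c + 3 + 3 * j) ≠ 1)
    (h2 : ∀ j : ℕ, (q : ℂ) ^ (6 * b + 3 * c + 3 + 3 * j) ≠ 1)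
    (h3 : ∀ j : ℕ, (q : ℂ) ^ (3 * b + 3 * c + 3 / 2 + 3 * j) ≠ 1) :
    (Summable (auxA q b) ∧ HasSum (termA q b c)
      (normFactor q b c / (qGamma (q ^ 3) (1 / 3) * qGamma (q ^ 3) (2 / 3) *
        qGamma q (3 * b + 3 * c + 1 / 2)) * ∑' n, auxA q b n)) ∧
    HasSum (termA q b c) (normFactor q b c / (qGamma (q ^ 3) (1 / 2 - b) *
      qGamma (q ^ 3) (b + 1 / 2) * qGamma q (3 * b + 3 * c + 1 / 2))) ∧
    ((∀ n : ℕ, (q : ℂ) ^ (2 * b + 2 * c + 1) ≠ (q : ℂ) ^ (-b - c + 3 * n - 1 / 2)) →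
      (Summable (auxB q b) ∧ HasSum (fun n => (q : ℂ) ^ (-(5 / 2) : ℂ) * termB q b c n)
        (normFactor q b c / (qGamma (q ^ 3) (1 / 3) * qGamma (q ^ 3) (2 / 3) *
          qGamma q (3 * b + 3 * c + 1 / 2)) * ∑' n, auxB q b n)) ∧
      HasSum (termB q b c) ((q : ℂ) ^ (3 * b + 3) * normFactor q b c /
        (qGamma (q ^ 3) (1 / 2 - b) * qGamma (q ^ 3) (b + 1 / 2) *
          qGamma q (3 * b + 3 * c + 1 / 2)))) := by
  have hD := denomInf_ne_zero hq hq1 h1 h2 h3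
  have ha := cpow_ne_zero_of_pos hq (1 / 2 + 3 * b)
  have h0 := ofReal_ne_zero_of_pos hq
  have hn1 := norm_ofReal_lt_one hq hq1
  have hA := hasSum_termA hq hq1 hD
  have hauxB : HasSum (auxB q b) ((q : ℂ) ^ (1 / 2 + 3 * b) *
      ∑' n, limitA q ((q : ℂ) ^ (1 / 2 + 3 * b)) n) := by
    rw [funext (auxB_eq hq b)]
    exact (hasSum_limitB ha h0 hn1).mul_left _
  rw [auxA_eq hq, mul_div_assoc, normFactor_div_third hq hq1, normFactor_div_half hq hq1]
  refine ⟨⟨(hasSum_limitA ha h0 hn1).summable, hA⟩, hA, fun hn => ?_⟩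
  have hB := hasSum_termB hq hq1 hD hn
  refine ⟨⟨hauxB.summable, ?_⟩, hB⟩
  -- Reconciles normalizations: the auxiliary series carries an extra a = q^(1/2+3b), and `termB`
  -- carries q^(3b+3).
  have e : (q : ℂ) ^ (1 / 2 + 3 * b) = (q : ℂ) ^ (-(5 / 2) : ℂ) * (q : ℂ) ^ (3 * b + 3) := by
    rw [← Complex.cpow_add _ _ h0]; congr 1; ring
  have hv : ∀ K S : ℂ, K * ((q : ℂ) ^ (1 / 2 + 3 * b) * S) =
      (q : ℂ) ^ (-(5 / 2) : ℂ) * ((q : ℂ) ^ (3 * b + 3) * (K * S)) := fun K S => by rw [e]; ring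
  rw [hauxB.tsum_eq, hv]
  exact hB.mul_left _

/-! ### The case b = c = 0 in base q². -/

theorem ofReal_sq_cpow {q : ℝ} (hq : 0 < q) {e : ℂ} (m : ℕ) (he : 2 * e = m) :
    ((q ^ 2 : ℝ) : ℂ) ^ e = (q : ℂ) ^ m := by
  have h : (q : ℂ) ≠ 0 := by exact_mod_cast hq.ne'
  have h2 : ((q ^ 2 : ℝ) : ℂ) ≠ 0 := by exact_mod_cast (pow_pos hq 2).ne'
  rw [← Complex.cpow_natCast, ← he, Complex.cpow_def_of_ne_zero h, Complex.cpow_def_of_ne_zero h2,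
    ← Complex.ofReal_log hq.le, ← Complex.ofReal_log (pow_pos hq 2).le, Real.log_pow]
  push_cast
  ring_nf

theorem ofReal_pow_ne_one {q : ℝ} (hq : 0 < q) (hq1 : q < 1) {m : ℕ} (hm : m ≠ 0) :
    (q : ℂ) ^ m ≠ 1 := by
  intro h
  have h1 := pow_lt_one₀ (norm_nonneg _) (norm_ofReal_lt_one hq hq1) hm
  rw [← norm_pow, h, norm_one] at h1
  exact lt_irrefl _ h1

theorem qGamma_one {q : ℝ} (hq : 0 < q) (hq1 : q < 1) : qGamma q 1 = 1 := by
  have h := norm_ofReal_lt_one hq hq1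
  rw [qGamma, Complex.cpow_one, div_self (qPochInf_ne_zero_of_norm_lt h h), sub_self,
    Complex.cpow_zero, mul_one]

theorem qGamma_ne_zero {q : ℝ} (hq : 0 < q) (hq1 : q < 1) {x : ℂ} (hx : 0 < x.re) :
    qGamma q x ≠ 0 := by
  have h := norm_ofReal_lt_one hq hq1
  have hu : ((1 - q : ℝ) : ℂ) ≠ 0 := by exact_mod_cast (sub_pos.2 hq1).ne'
  have hx1 : ‖(q : ℂ) ^ x‖ < 1 := by
    rw [Complex.norm_cpow_eq_rpow_re_of_pos hq]
    exact Real.rpow_lt_one hq.le hq1 hx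
  refine mul_ne_zero (div_ne_zero (qPochInf_ne_zero_of_norm_lt h h)
    (qPochInf_ne_zero_of_norm_lt h hx1)) ?_
  rw [Ne, Complex.cpow_eq_zero_iff]
  exact fun h => hu h.1

theorem termA_zero_zero {q : ℝ} (hq : 0 < q) (n : ℕ) : termA (q ^ 2) 0 0 n = termA₀ q n := by
  rw [termA, termA₀,
    ofReal_sq_cpow hq (e := 3 * 0 + 3 * 0 + 4 * n + 1 / 2) (8 * n + 1) (by push_cast; ring),
    ofReal_sq_cpow hq (e := 1 / 2 - 3 * 0) 1 (by push_cast; ring),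
    ofReal_sq_cpow hq (e := 1 / 2 + 3 * 0) 1 (by push_cast; ring),
    ofReal_sq_cpow hq (e := 3 * 0 + 3 * 0 + 1 / 2) 1 (by push_cast; ring),
    ofReal_sq_cpow hq (e := 3 * 0 + 3) 6 (by push_cast; ring),
    ofReal_sq_cpow hq (e := 3 + 6 * 0 + 3 * 0) 6 (by push_cast; ring), Complex.ofReal_pow,
    ← pow_mul, ← pow_mul]
  ring_nf

/-- The case a = q, z = 1 in base q². The two extra factors cancel against parts of 1 − q^(8n+2) and
1 − q^(8n+4), leaving the three factors of the form 1 + q^m in the denominator of `termB₀`. -/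
theorem factorB_one_eq {q : ℂ} (hq : q ≠ 0) (n : ℕ) :
    factorB (q ^ 2) q 1 n = polyB₀ q n * ((1 - q ^ (4 * n + 1)) * (1 - q ^ (2 * n + 1))) := by
  have e : q ^ 2 / q = q := by field_simp
  rw [factorB, polyB₀, e]
  ring

theorem termB_zero_zero {q : ℝ} (hq : 0 < q) (hq1 : q < 1) (n : ℕ)
    (hn : ((q ^ 2 : ℝ) : ℂ) ^ (2 * 0 + 2 * 0 + 1 : ℂ) ≠
      ((q ^ 2 : ℝ) : ℂ) ^ (-0 - 0 + 3 * n - 1 / 2 : ℂ)) :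
    termB (q ^ 2) 0 0 n = (q : ℂ) ^ 6 * termB₀ q n := by
  have hq0 := ofReal_ne_zero_of_pos hq
  have hpf := sub_ne_zero.2 hn
  have hq2 : 0 < q ^ 2 := pow_pos hq 2
  rw [termB, termB₀, polyB_eq (ofReal_ne_zero_of_pos hq2),
    ofReal_sq_cpow hq (e := 3 * 0 * n - 0 + 3 * 0 * n - 0 + 5 * n ^ 2 / 2) (5 * n ^ 2)
      (by push_cast; ring),
    ofReal_sq_cpow hq (e := 1 / 2 - 3 * 0) 1 (by push_cast; ring),
    ofReal_sq_cpow hq (e := 3 * 0 + 1 / 2) 1 (by push_cast; ring),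
    ofReal_sq_cpow hq (e := 1 / 2 + 3 * 0) 1 (by push_cast; ring),
    ofReal_sq_cpow hq (e := 3 * 0 + 3 * 0 + 1 / 2) 1 (by push_cast; ring),
    ofReal_sq_cpow hq (e := 3 * 0 + 3) 6 (by push_cast; ring),
    ofReal_sq_cpow hq (e := 3 / 2 - 3 * 0 - 3 * 0) 3 (by push_cast; ring),
    ofReal_sq_cpow hq (e := 4 * 0 + 0 + 3) 6 (by push_cast; ring),
    ofReal_sq_cpow hq (e := 3 * 0) 0 (by push_cast; ring),
    ofReal_sq_cpow hq (e := 6 * 0 + 3 * 0 + 3) 6 (by push_cast; ring)]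
  generalize ((q ^ 2 : ℝ) : ℂ) ^ (2 * 0 + 2 * 0 + 1 : ℂ) -
      ((q ^ 2 : ℝ) : ℂ) ^ (-0 - 0 + 3 * n - 1 / 2 : ℂ) = pf at *
  have h2 : ‖(q : ℂ) ^ 2‖ < 1 := by
    rw [norm_pow]; exact pow_lt_one₀ (norm_nonneg _) (norm_ofReal_lt_one hq hq1) two_ne_zero
  have h6 : ‖(q : ℂ) ^ 6‖ < 1 := by
    rw [norm_pow]; exact pow_lt_one₀ (norm_nonneg _) (norm_ofReal_lt_one hq hq1) (by norm_num)
  have i6 := qPoch_self_ne_zero h6 n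
  have i2 := qPoch_self_ne_zero h2 (4 * n + 1 + 1)
  have e2 : 4 * n + 2 = 4 * n + 1 + 1 := rfl
  simp only [Complex.ofReal_pow, pow_one, pow_zero]
  rw [e2, qPoch_succ, qPoch_succ] at *
  rw [factorB_one_eq hq0]
  have j1 := right_ne_zero_of_mul i2
  have j2 := right_ne_zero_of_mul (left_ne_zero_of_mul i2)
  have j3 := left_ne_zero_of_mul (left_ne_zero_of_mul i2)
  have f1 : 1 - (q : ℂ) ^ 2 * ((q : ℂ) ^ 2) ^ (4 * n) =
      (1 - (q : ℂ) ^ (4 * n + 1)) * ((q : ℂ) ^ (4 * n + 1) + 1) := by ring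
  have f2 : 1 - (q : ℂ) ^ 2 * ((q : ℂ) ^ 2) ^ (4 * n + 1) =
      (1 - (q : ℂ) ^ (2 * n + 1)) * ((q : ℂ) ^ (2 * n + 1) + 1) * ((q : ℂ) ^ (4 * n + 2) + 1) := by
    ring
  rw [f1] at j2
  rw [f2] at j1
  rw [f1, f2, ← pow_mul (q : ℂ) 2 3]
  have k1 := left_ne_zero_of_mul j2
  have k2 := right_ne_zero_of_mul j2
  have k3 := right_ne_zero_of_mul j1
  have k4 := right_ne_zero_of_mul (left_ne_zero_of_mul j1)
  have k5 := left_ne_zero_of_mul (left_ne_zero_of_mul j1)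
  generalize (q : ℂ) ^ (4 * n + 1) = A at *
  generalize (q : ℂ) ^ (2 * n + 1) = B at *
  generalize (q : ℂ) ^ (4 * n + 2) = C at *
  generalize polyB₀ q n = P
  have g6 : (2 * 3 : ℕ) = 6 := rfl
  rw [g6]
  generalize qPoch ((q : ℂ) ^ 6) ((q : ℂ) ^ 6) n = D at *
  generalize qPoch ((q : ℂ) ^ 2) ((q : ℂ) ^ 2) (4 * n) = E at *
  field_simp

theorem normFactor_zero_div {q : ℝ} (hq : 0 < q) (hq1 : q < 1) :
    normFactor (q ^ 2) 0 0 / (qGamma ((q ^ 2) ^ 3) (1 / 2 - 0) * qGamma ((q ^ 2) ^ 3) (0 + 1 / 2) *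
      qGamma (q ^ 2) (3 * 0 + 3 * 0 + 1 / 2)) = rhs₀ q := by
  have hq6 : 0 < q ^ 6 := pow_pos hq 6
  have hq61 : q ^ 6 < 1 := pow_lt_one₀ hq.le hq1 (by norm_num)
  have e6 : (q ^ 2) ^ 3 = q ^ 6 := by ring
  have es : (((q ^ 2 : ℝ) : ℂ) ^ 2 + (q ^ 2 : ℝ) + 1) ^ (1 / 2 : ℂ) =
      ((√(q ^ 4 + q ^ 2 + 1) : ℝ) : ℂ) := by
    rw [Real.sqrt_eq_rpow, Complex.ofReal_cpow (by positivity)]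
    push_cast
    ring_nf
  have hne := qGamma_ne_zero hq6 hq61 (x := 1 / 2) (by norm_num)
  rw [normFactor, rhs₀, e6]
  simp only [mul_zero, zero_add, sub_zero, qGamma_one hq6 hq61, mul_one]
  rw [es]
  push_cast
  field_simp

theorem ofReal_cpow_ne_of_re_ne {q : ℝ} (hq : 0 < q) (hq1 : q < 1) {x y : ℂ} (h : x.re ≠ y.re) :
    (q : ℂ) ^ x ≠ (q : ℂ) ^ y := by
  intro he
  have h1 := congrArg norm he
  rw [Complex.norm_cpow_eq_rpow_re_of_pos hq, Complex.norm_cpow_eq_rpow_re_of_pos hq] at h1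
  exact h ((Real.rpow_right_inj hq hq1.ne).1 h1)

theorem specializations {q : ℝ} (hq : 0 < q) (hq1 : q < 1) :
    HasSum (fun n => termA₀ q n) (rhs₀ q) ∧ HasSum (fun n => termB₀ q n) (rhs₀ q) := by
  have hq2 : 0 < q ^ 2 := pow_pos hq 2
  have hq21 : q ^ 2 < 1 := pow_lt_one₀ hq.le hq1 two_ne_zero
  have hn : ∀ n : ℕ, ((q ^ 2 : ℝ) : ℂ) ^ (2 * 0 + 2 * 0 + 1 : ℂ) ≠
      ((q ^ 2 : ℝ) : ℂ) ^ (-0 - 0 + 3 * n - 1 / 2 : ℂ) := by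
    intro n
    -- Equal real parts would mean 1 = 3n − 1/2, that is 3 = 6n.
    refine ofReal_cpow_ne_of_re_ne hq2 hq21 ?_
    intro h
    norm_num at h
    have h' : (3 : ℝ) = 6 * n := by linarith
    have h'' : (3 : ℕ) = 6 * n := by exact_mod_cast h'
    omega
  obtain ⟨-, hA, hB⟩ := two_variable_formulas hq2 hq21 (b := 0) (c := 0)
    (fun j => by
      rw [ofReal_sq_cpow hq (6 + 6 * j) (by push_cast; ring)]
      exact ofReal_pow_ne_one hq hq1 (by omega))
    (fun j => by
      rw [ofReal_sq_cpow hq (6 + 6 * j) (by push_cast; ring)]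
      exact ofReal_pow_ne_one hq hq1 (by omega))
    (fun j => by
      rw [ofReal_sq_cpow hq (3 + 6 * j) (by push_cast; ring)]
      exact ofReal_pow_ne_one hq hq1 (by omega))
  have hB := (hB hn).2
  rw [normFactor_zero_div hq hq1] at hA
  rw [mul_div_assoc, normFactor_zero_div hq hq1,
    ofReal_sq_cpow hq (e := 3 * 0 + 3) 6 (by push_cast; ring)] at hB
  rw [funext (termA_zero_zero hq)] at hA
  refine ⟨hA, ?_⟩
  rw [funext fun n => termB_zero_zero hq hq1 n (hn n)] at hB
  exact (hasSum_mul_left_iff (pow_ne_zero 6 (ofReal_ne_zero_of_pos hq))).1 hB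

/-! ### Termwise limits as q → 1⁻. -/

theorem one_sub_pow_eq_mul_geom_sum (q : ℝ) (m : ℕ) :
    1 - q ^ m = (1 - q) * ∑ i ∈ Finset.range m, q ^ i := by
  rw [mul_comm, geom_sum_mul_neg]

theorem one_sub_pow_pos {q : ℝ} (hq : 0 < q) (hq1 : q < 1) {m : ℕ} (hm : m ≠ 0) :
    0 < 1 - q ^ m :=
  sub_pos.2 (pow_lt_one₀ hq.le hq1 hm)

theorem one_sub_pow_nonneg {q : ℝ} (hq : 0 < q) (hq1 : q < 1) (m : ℕ) : 0 ≤ 1 - q ^ m :=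
  sub_nonneg.2 (pow_le_one₀ hq.le hq1.le)

theorem one_sub_pow_le_mul {q : ℝ} (hq : 0 < q) (hq1 : q < 1) (m : ℕ) :
    1 - q ^ m ≤ m * (1 - q) := by
  rw [one_sub_pow_eq_mul_geom_sum, mul_comm]
  refine mul_le_mul_of_nonneg_right ?_ (sub_pos.2 hq1).le
  calc ∑ i ∈ Finset.range m, q ^ i ≤ ∑ _i ∈ Finset.range m, (1 : ℝ) :=
        Finset.sum_le_sum fun i _ => pow_le_one₀ hq.le hq1.le
    _ = m := by simp

theorem tendsto_one_sub_pow_div (m : ℕ) :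
    Tendsto (fun q : ℝ => (1 - q ^ m) / (1 - q)) (𝓝[<] 1) (𝓝 m) := by
  have h : Tendsto (fun q : ℝ => ∑ i ∈ Finset.range m, q ^ i) (𝓝[<] 1) (𝓝 m) := by
    have hc : Continuous fun q : ℝ => ∑ i ∈ Finset.range m, q ^ i := by fun_prop
    have := (hc.tendsto 1).mono_left (nhdsWithin_le_nhds (s := Set.Iio 1))
    simpa using this
  refine h.congr' ?_
  filter_upwards [self_mem_nhdsWithin] with q hq
  rw [one_sub_pow_eq_mul_geom_sum, mul_div_cancel_left₀]
  exact (sub_pos.2 hq).ne'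

theorem tendsto_one_sub_pow_div_one_sub_pow (m : ℕ) {l : ℕ} (hl : l ≠ 0) :
    Tendsto (fun q : ℝ => (1 - q ^ m) / (1 - q ^ l)) (𝓝[<] 1) (𝓝 (m / l)) := by
  refine ((tendsto_one_sub_pow_div m).div (tendsto_one_sub_pow_div l)
    (Nat.cast_ne_zero.2 hl)).congr' ?_
  filter_upwards [self_mem_nhdsWithin] with q hq
  exact div_div_div_cancel_right₀ (sub_pos.2 hq).ne' _ _

theorem tendsto_pow_one (m : ℕ) : Tendsto (fun q : ℝ => q ^ m) (𝓝[<] 1) (𝓝 1) := by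
  have := ((continuous_pow m).tendsto (1 : ℝ)).mono_left (nhdsWithin_le_nhds (s := Set.Iio 1))
  simpa using this

/-- The quotient of consecutive hypergeometric factors of `termA₀`. -/
noncomputable def ratioA (q : ℝ) (k : ℕ) : ℝ :=
  q ^ (4 * k + 2) * ((1 - q ^ (4 * k + 1)) / (1 - q ^ (4 * k + 2))) *
    ((1 - q ^ (4 * k + 3)) / (1 - q ^ (4 * k + 4))) * ((1 - q ^ (2 * k + 1)) / (1 - q ^ (6 * k + 6))) ^ 2

/-- The quotient of consecutive hypergeometric factors of `termB₀`. -/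
noncomputable def ratioB (q : ℝ) (k : ℕ) : ℝ :=
  -(q ^ (10 * k + 5) * ((1 - q ^ (2 * k + 1)) / (1 - q ^ (6 * k + 6))) *
    ((1 - q ^ (6 * k + 3)) / (1 - q ^ (6 * k + 6))) *
    ((1 - q ^ (4 * k + 1)) / (1 - q ^ (8 * k + 2)) *
      ((1 - q ^ (4 * k + 1)) / (1 - q ^ (8 * k + 4)))) *
    ((1 - q ^ (4 * k + 3)) / (1 - q ^ (8 * k + 6)) *
      ((1 - q ^ (4 * k + 3)) / (1 - q ^ (8 * k + 8)))))

/-- The real version of `polyB₀`. -/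
noncomputable def polyBReal (q : ℝ) (n : ℕ) : ℝ :=
  (1 - q ^ (10 * n + 1)) + (1 - q ^ (12 * n + 2)) + (1 - q ^ (12 * n + 3)) +
    (1 - q ^ (14 * n + 2)) + (1 - q ^ (14 * n + 3)) + (1 - q ^ (16 * n + 3)) +
    (1 - q ^ (16 * n + 4)) + (1 - q ^ (18 * n + 4)) + (1 - q ^ (20 * n + 5)) -
    ((1 - q ^ (2 * n + 1)) + (1 - q ^ (4 * n + 1)) + (1 - q ^ (4 * n + 2)) +
    (1 - q ^ (6 * n + 2)) + (1 - q ^ (6 * n + 3)) + (1 - q ^ (8 * n + 2)) +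
    (1 - q ^ (8 * n + 3)) + (1 - q ^ (10 * n + 4)))

/-- As a product of term ratios, the summand can be both bounded and passed to the limit factor by
factor. -/
theorem termA₀_eq (q : ℝ) (n : ℕ) :
    termA₀ q n = (((1 - q ^ (8 * n + 1)) * ∏ k ∈ Finset.range n, ratioA q k : ℝ) : ℂ) := by
  have key : (q : ℂ) ^ (2 * n ^ 2) * qPoch q ((q : ℂ) ^ 2) (2 * n) * qPoch q ((q : ℂ) ^ 2) n ^ 2 /
      (qPoch ((q : ℂ) ^ 2) ((q : ℂ) ^ 2) (2 * n) * qPoch ((q : ℂ) ^ 6) ((q : ℂ) ^ 6) n ^ 2) =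
      ((∏ k ∈ Finset.range n, ratioA q k : ℝ) : ℂ) := by
    induction n with
    | zero => simp [qPoch_zero]
    | succ n ih =>
      rw [Finset.prod_range_succ, Complex.ofReal_mul, ← ih]
      have e1 : 2 * (n + 1) = 2 * n + 1 + 1 := by ring
      have e2 : 2 * (n + 1) ^ 2 = 2 * n ^ 2 + (4 * n + 2) := by ring
      rw [e1, e2, ratioA]
      simp only [qPoch_succ _ _ n, qPoch_succ _ _ (2 * n), qPoch_succ _ _ (2 * n + 1)]
      push_cast
      have f1 : (q : ℂ) * ((q : ℂ) ^ 2) ^ (2 * n) = (q : ℂ) ^ (4 * n + 1) := by ring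
      have f2 : (q : ℂ) * ((q : ℂ) ^ 2) ^ (2 * n + 1) = (q : ℂ) ^ (4 * n + 3) := by ring
      have f3 : (q : ℂ) * ((q : ℂ) ^ 2) ^ n = (q : ℂ) ^ (2 * n + 1) := by ring
      have f4 : (q : ℂ) ^ 2 * ((q : ℂ) ^ 2) ^ (2 * n) = (q : ℂ) ^ (4 * n + 2) := by ring
      have f5 : (q : ℂ) ^ 2 * ((q : ℂ) ^ 2) ^ (2 * n + 1) = (q : ℂ) ^ (4 * n + 4) := by ring
      have f6 : (q : ℂ) ^ 6 * ((q : ℂ) ^ 6) ^ n = (q : ℂ) ^ (6 * n + 6) := by ring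
      rw [f1, f2, f3, f4, f5, f6, pow_add (q : ℂ) (2 * n ^ 2)]
      generalize 1 - (q : ℂ) ^ (4 * n + 1) = X0
      generalize 1 - (q : ℂ) ^ (4 * n + 3) = X1
      generalize 1 - (q : ℂ) ^ (2 * n + 1) = X2
      generalize 1 - (q : ℂ) ^ (4 * n + 2) = X3
      generalize 1 - (q : ℂ) ^ (4 * n + 4) = X4
      generalize 1 - (q : ℂ) ^ (6 * n + 6) = X5
      simp only [div_eq_mul_inv, mul_inv, mul_pow, ← inv_pow]
      ring
  rw [Complex.ofReal_mul, ← key, termA₀]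
  push_cast
  ring

/-- Nine coefficients are 1 and nine are −1, so the polynomial vanishes at q = 1 and regroups into
differences 1 − q^m, ready for division by 1 − q. -/
theorem polyB₀_eq (q : ℝ) (n : ℕ) : polyB₀ q n = ((polyBReal q n : ℝ) : ℂ) := by
  rw [polyB₀, polyBReal]
  push_cast
  ring

theorem termB₀_eq (q : ℝ) (n : ℕ) :
    termB₀ q n = ((polyBReal q n / ((q ^ (2 * n + 1) + 1) * (q ^ (4 * n + 1) + 1) *
      (q ^ (4 * n + 2) + 1)) * ∏ k ∈ Finset.range n, ratioB q k : ℝ) : ℂ) := by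
  have key : (-1) ^ n * (q : ℂ) ^ (5 * n ^ 2) * qPoch q ((q : ℂ) ^ 2) n *
      qPoch ((q : ℂ) ^ 3) ((q : ℂ) ^ 6) n * qPoch q ((q : ℂ) ^ 2) (2 * n) ^ 2 /
      (qPoch ((q : ℂ) ^ 2) ((q : ℂ) ^ 2) (4 * n) * qPoch ((q : ℂ) ^ 6) ((q : ℂ) ^ 6) n ^ 2) =
      ((∏ k ∈ Finset.range n, ratioB q k : ℝ) : ℂ) := by
    induction n with
    | zero => simp [qPoch_zero]
    | succ n ih =>
      rw [Finset.prod_range_succ, Complex.ofReal_mul, ← ih]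
      have e1 : 2 * (n + 1) = 2 * n + 1 + 1 := by ring
      have e2 : 5 * (n + 1) ^ 2 = 5 * n ^ 2 + (10 * n + 5) := by ring
      have e3 : 4 * (n + 1) = 4 * n + 1 + 1 + 1 + 1 := by ring
      rw [e1, e2, e3, ratioB]
      simp only [qPoch_succ _ _ n, qPoch_succ _ _ (2 * n), qPoch_succ _ _ (2 * n + 1),
        qPoch_succ _ _ (4 * n), qPoch_succ _ _ (4 * n + 1), qPoch_succ _ _ (4 * n + 1 + 1),
        qPoch_succ _ _ (4 * n + 1 + 1 + 1)]
      push_cast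
      have f1 : (q : ℂ) * ((q : ℂ) ^ 2) ^ (2 * n) = (q : ℂ) ^ (4 * n + 1) := by ring
      have f2 : (q : ℂ) * ((q : ℂ) ^ 2) ^ (2 * n + 1) = (q : ℂ) ^ (4 * n + 3) := by ring
      have f3 : (q : ℂ) * ((q : ℂ) ^ 2) ^ n = (q : ℂ) ^ (2 * n + 1) := by ring
      have f4 : (q : ℂ) ^ 2 * ((q : ℂ) ^ 2) ^ (4 * n) = (q : ℂ) ^ (8 * n + 2) := by ring
      have f5 : (q : ℂ) ^ 2 * ((q : ℂ) ^ 2) ^ (4 * n + 1) = (q : ℂ) ^ (8 * n + 4) := by ring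
      have f6 : (q : ℂ) ^ 6 * ((q : ℂ) ^ 6) ^ n = (q : ℂ) ^ (6 * n + 6) := by ring
      have f7 : (q : ℂ) ^ 2 * ((q : ℂ) ^ 2) ^ (4 * n + 1 + 1) = (q : ℂ) ^ (8 * n + 6) := by ring
      have f8 : (q : ℂ) ^ 2 * ((q : ℂ) ^ 2) ^ (4 * n + 1 + 1 + 1) = (q : ℂ) ^ (8 * n + 8) := by
        ring
      have f9 : (q : ℂ) ^ 3 * ((q : ℂ) ^ 6) ^ n = (q : ℂ) ^ (6 * n + 3) := by ring
      rw [f1, f2, f3, f4, f5, f6, f7, f8, f9, pow_add (q : ℂ) (5 * n ^ 2)]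
      generalize 1 - (q : ℂ) ^ (4 * n + 1) = X0
      generalize 1 - (q : ℂ) ^ (4 * n + 3) = X1
      generalize 1 - (q : ℂ) ^ (2 * n + 1) = X2
      generalize 1 - (q : ℂ) ^ (6 * n + 3) = X3
      generalize 1 - (q : ℂ) ^ (6 * n + 6) = X4
      generalize 1 - (q : ℂ) ^ (8 * n + 2) = X5
      generalize 1 - (q : ℂ) ^ (8 * n + 4) = X6
      generalize 1 - (q : ℂ) ^ (8 * n + 6) = X7
      generalize 1 - (q : ℂ) ^ (8 * n + 8) = X8
      simp only [div_eq_mul_inv, mul_inv, mul_pow, ← inv_pow]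
      ring
  rw [Complex.ofReal_mul, ← key, termB₀, polyB₀_eq]
  push_cast
  simp only [div_eq_mul_inv, mul_inv]
  ring

theorem poch_succ (x : ℝ) (n : ℕ) : poch x (n + 1) = poch x n * (x + n) := by
  simp [poch, ascPochhammer_succ_eval]

theorem poch_zero (x : ℝ) : poch x 0 = 1 := by simp [poch]

theorem poch_one_ne_zero (n : ℕ) : poch 1 n ≠ 0 := by
  induction n with
  | zero => simp [poch_zero]
  | succ n ih => rw [poch_succ]; exact mul_ne_zero ih (by positivity)

theorem hypergeometric_eq_prod (x : ℝ) (n : ℕ) :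
    x ^ n * (poch (1 / 2) n * poch (1 / 4) n * poch (3 / 4) n / poch 1 n ^ 3) =
      ∏ k ∈ Finset.range n, x * ((2 * k + 1) * (4 * k + 1) * (4 * k + 3) / (32 * (k + 1) ^ 3)) := by
  induction n with
  | zero => simp [poch_zero]
  | succ n ih =>
    rw [Finset.prod_range_succ, ← ih]
    simp only [poch_succ]
    have h := poch_one_ne_zero n
    have h1 : (1 : ℝ) + n ≠ 0 := by positivity
    have h2 : (n : ℝ) + 1 ≠ 0 := by positivity
    field_simp
    ring

theorem tendsto_ratioA (k : ℕ) : Tendsto (fun q => ratioA q k) (𝓝[<] 1)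
    (𝓝 (1 / 9 * ((2 * k + 1) * (4 * k + 1) * (4 * k + 3) / (32 * (k + 1) ^ 3)))) := by
  have h := (((tendsto_pow_one (4 * k + 2)).mul
    (tendsto_one_sub_pow_div_one_sub_pow (4 * k + 1) (l := 4 * k + 2) (by omega))).mul
    (tendsto_one_sub_pow_div_one_sub_pow (4 * k + 3) (l := 4 * k + 4) (by omega))).mul
    ((tendsto_one_sub_pow_div_one_sub_pow (2 * k + 1) (l := 6 * k + 6) (by omega)).pow 2)
  refine Eq.subst (motive := fun v => Tendsto (fun q => ratioA q k) (𝓝[<] 1) (𝓝 v)) ?_ h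
  push_cast
  have h1 : (k : ℝ) + 1 ≠ 0 := by positivity
  have h2 : (4 : ℝ) * k + 2 ≠ 0 := by positivity
  have h3 : (4 : ℝ) * k + 4 ≠ 0 := by positivity
  have h4 : (6 : ℝ) * k + 6 ≠ 0 := by positivity
  field_simp
  ring

theorem tendsto_ratioB (k : ℕ) : Tendsto (fun q => ratioB q k) (𝓝[<] 1)
    (𝓝 (-1 / 48 * ((2 * k + 1) * (4 * k + 1) * (4 * k + 3) / (32 * (k + 1) ^ 3)))) := by
  have h := (((((tendsto_pow_one (10 * k + 5)).mul
    (tendsto_one_sub_pow_div_one_sub_pow (2 * k + 1) (l := 6 * k + 6) (by omega))).mul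
    (tendsto_one_sub_pow_div_one_sub_pow (6 * k + 3) (l := 6 * k + 6) (by omega))).mul
    ((tendsto_one_sub_pow_div_one_sub_pow (4 * k + 1) (l := 8 * k + 2) (by omega)).mul
    (tendsto_one_sub_pow_div_one_sub_pow (4 * k + 1) (l := 8 * k + 4) (by omega)))).mul
    ((tendsto_one_sub_pow_div_one_sub_pow (4 * k + 3) (l := 8 * k + 6) (by omega)).mul
    (tendsto_one_sub_pow_div_one_sub_pow (4 * k + 3) (l := 8 * k + 8) (by omega)))).neg
  refine Eq.subst (motive := fun v => Tendsto (fun q => ratioB q k) (𝓝[<] 1) (𝓝 v)) ?_ h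
  push_cast
  have h1 : (k : ℝ) + 1 ≠ 0 := by positivity
  have h2 : (8 : ℝ) * k + 2 ≠ 0 := by positivity
  have h3 : (8 : ℝ) * k + 4 ≠ 0 := by positivity
  have h4 : (6 : ℝ) * k + 6 ≠ 0 := by positivity
  have h5 : (8 : ℝ) * k + 6 ≠ 0 := by positivity
  have h6 : (8 : ℝ) * k + 8 ≠ 0 := by positivity
  field_simp
  ring

/-- Each 1 − q^m contributes m. The result 3(28n+3), over the limit 8 of the three factors 1 + q^m,
explains the constant 3/8. -/
theorem tendsto_polyBReal_div (n : ℕ) :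
    Tendsto (fun q => polyBReal q n / (1 - q)) (𝓝[<] 1) (𝓝 (84 * n + 9)) := by
  have t := tendsto_one_sub_pow_div
  have h := (((((((((t (10 * n + 1)).add (t (12 * n + 2))).add (t (12 * n + 3))).add
    (t (14 * n + 2))).add (t (14 * n + 3))).add (t (16 * n + 3))).add (t (16 * n + 4))).add
    (t (18 * n + 4))).add (t (20 * n + 5))).sub
    ((((((((t (2 * n + 1)).add (t (4 * n + 1))).add (t (4 * n + 2))).add (t (6 * n + 2))).add
    (t (6 * n + 3))).add (t (8 * n + 2))).add (t (8 * n + 3))).add (t (10 * n + 4)))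
  simp only [← add_div, ← sub_div] at h
  refine Eq.subst (motive := fun v => Tendsto (fun q => polyBReal q n / (1 - q)) (𝓝[<] 1) (𝓝 v)) ?_ h
  push_cast
  ring

theorem tendsto_termA₀ (n : ℕ) :
    Tendsto (fun q : ℝ => termA₀ q n / (1 - q)) (𝓝[<] 1) (𝓝 (classicalA n)) := by
  have h := (tendsto_one_sub_pow_div (8 * n + 1)).mul
    (tendsto_finsetProd (Finset.range n) fun k _ => tendsto_ratioA k)
  rw [← hypergeometric_eq_prod] at h
  have h2 := (Complex.continuous_ofReal.tendsto _).comp h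
  have e : classicalA n = ((8 * n + 1 : ℕ) : ℝ) * ((1 / 9) ^ n *
      (poch (1 / 2) n * poch (1 / 4) n * poch (3 / 4) n / poch 1 n ^ 3)) := by
    rw [classicalA]; push_cast; ring
  rw [e]
  refine h2.congr' ?_
  filter_upwards [Ioo_mem_nhdsLT one_pos] with q hq
  rw [termA₀_eq]
  simp only [Function.comp]
  push_cast
  ring

theorem tendsto_termB₀ (n : ℕ) :
    Tendsto (fun q : ℝ => termB₀ q n / (1 - q)) (𝓝[<] 1) (𝓝 (3 / 8 * classicalB n)) := by
  have hd := (((tendsto_pow_one (2 * n + 1)).add_const 1).mul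
    ((tendsto_pow_one (4 * n + 1)).add_const 1)).mul ((tendsto_pow_one (4 * n + 2)).add_const 1)
  have h := ((tendsto_polyBReal_div n).div hd (by norm_num)).mul
    (tendsto_finsetProd (Finset.range n) fun k _ => tendsto_ratioB k)
  rw [← hypergeometric_eq_prod] at h
  have h2 := (Complex.continuous_ofReal.tendsto _).comp h
  have e : (3 / 8 * classicalB n : ℂ) = (((84 * n + 9) / ((1 + 1) * (1 + 1) * (1 + 1)) *
      ((-1 / 48) ^ n * (poch (1 / 2) n * poch (1 / 4) n * poch (3 / 4) n / poch 1 n ^ 3)) : ℝ) : ℂ) := by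
    rw [classicalB]; push_cast; ring
  rw [e]
  refine h2.congr' ?_
  filter_upwards [Ioo_mem_nhdsLT one_pos] with q hq
  rw [termB₀_eq]
  simp only [Function.comp, Pi.div_apply]
  push_cast
  ring

/-! ### Geometric majorants uniform for q near 1. -/

/-- With x = q^(2k+2), 1 − x³ = (1−x)(1+x+x²) ≥ 3x(1−x), so the squared factor costs at most
1/(9x²). The power q^(4k+2) compensates x² up to q^(−2). -/
theorem abs_ratioA_le {q : ℝ} (hq : 4 / 5 < q) (hq1 : q < 1) (k : ℕ) : |ratioA q k| ≤ 2 / 9 := by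
  have h0 : 0 < q := by linarith
  have hp : ∀ m, 0 ≤ 1 - q ^ m := one_sub_pow_nonneg h0 hq1
  have hle : ∀ {m l : ℕ}, m ≤ l → l ≠ 0 → (1 - q ^ m) / (1 - q ^ l) ≤ 1 := fun h hl =>
    (div_le_one (one_sub_pow_pos h0 hq1 hl)).2
      (sub_le_sub_left (pow_le_pow_of_le_one h0.le hq1.le h) 1)
  have hx : 0 < q ^ (2 * k + 2) := by positivity
  have h3 : (1 - q ^ (2 * k + 1)) / (1 - q ^ (6 * k + 6)) ≤ 1 / (3 * q ^ (2 * k + 2)) := by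
    have h4 : 1 - q ^ (2 * k + 1) ≤ 1 - q ^ (2 * k + 2) :=
      sub_le_sub_left (pow_le_pow_of_le_one h0.le hq1.le (by omega)) 1
    have h5 : 1 - q ^ (6 * k + 6) = 1 - (q ^ (2 * k + 2)) ^ 3 := by ring
    have h6 := hp (2 * k + 2)
    have h7 := one_sub_pow_pos h0 hq1 (m := 6 * k + 6) (by omega)
    rw [div_le_div_iff₀ h7 (by positivity), h5]
    generalize q ^ (2 * k + 2) = x at *
    calc (1 - q ^ (2 * k + 1)) * (3 * x) ≤ (1 - x) * (3 * x) := by gcongr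
      _ ≤ 1 * (1 - x ^ 3) := by nlinarith [mul_nonneg h6 (sq_nonneg (1 - x))]
  have hq2 : 1 ≤ 2 * q ^ 2 := by nlinarith
  have hd : ∀ m l : ℕ, 0 ≤ (1 - q ^ m) / (1 - q ^ l) := fun m l => div_nonneg (hp m) (hp l)
  rw [abs_of_nonneg (by have := hd; rw [ratioA]; exact mul_nonneg (mul_nonneg
    (mul_nonneg (by positivity) (hd _ _)) (hd _ _)) (sq_nonneg _)), ratioA]
  calc _ ≤ q ^ (4 * k + 2) * 1 * 1 * (1 / (3 * q ^ (2 * k + 2))) ^ 2 := by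
        refine mul_le_mul (mul_le_mul (mul_le_mul_of_nonneg_left (hle (by omega) (by omega))
          (by positivity)) (hle (by omega) (by omega)) (hd _ _) (by positivity))
          (pow_le_pow_left₀ (hd _ _) h3 2) (sq_nonneg _) (by positivity)
    _ = 1 / (9 * q ^ 2) := by
        have : q ^ (4 * k + 2) = (q ^ (2 * k + 2)) ^ 2 / q ^ 2 := by
          rw [eq_div_iff (by positivity)]; ring
        rw [this]
        field_simp
        norm_num
    _ ≤ 2 / 9 := by
        rw [div_le_div_iff₀ (by positivity) (by norm_num)]
        linarith

theorem abs_ratioB_le {q : ℝ} (hq : 4 / 5 < q) (hq1 : q < 1) (k : ℕ) : |ratioB q k| ≤ 1 / 24 := by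
  have h0 : 0 < q := by linarith
  have hp : ∀ m, 0 ≤ 1 - q ^ m := one_sub_pow_nonneg h0 hq1
  have hle : ∀ {m l : ℕ}, m ≤ l → l ≠ 0 → (1 - q ^ m) / (1 - q ^ l) ≤ 1 := fun h hl =>
    (div_le_one (one_sub_pow_pos h0 hq1 hl)).2
      (sub_le_sub_left (pow_le_pow_of_le_one h0.le hq1.le h) 1)
  have hx : 0 < q ^ (2 * k + 2) := by positivity
  have h3 : (1 - q ^ (2 * k + 1)) / (1 - q ^ (6 * k + 6)) ≤ 1 / (3 * q ^ (2 * k + 2)) := by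
    have h4 : 1 - q ^ (2 * k + 1) ≤ 1 - q ^ (2 * k + 2) :=
      sub_le_sub_left (pow_le_pow_of_le_one h0.le hq1.le (by omega)) 1
    have h5 : 1 - q ^ (6 * k + 6) = 1 - (q ^ (2 * k + 2)) ^ 3 := by ring
    have h6 := hp (2 * k + 2)
    have h7 := one_sub_pow_pos h0 hq1 (m := 6 * k + 6) (by omega)
    rw [div_le_div_iff₀ h7 (by positivity), h5]
    generalize q ^ (2 * k + 2) = x at *
    calc (1 - q ^ (2 * k + 1)) * (3 * x) ≤ (1 - x) * (3 * x) := by gcongr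
      _ ≤ 1 * (1 - x ^ 3) := by nlinarith [mul_nonneg h6 (sq_nonneg (1 - x))]
  have hd : ∀ m l : ℕ, 0 ≤ (1 - q ^ m) / (1 - q ^ l) := fun m l => div_nonneg (hp m) (hp l)
  -- With y = q^(m+1) ≥ x = q^(m+2), one factor 1 − y cancels, and 1 − y ≤ 1 − x together with
  -- (1+x)(1+y) ≥ (1+x)² ≥ 4x gives the bound.
  have hpair : ∀ m : ℕ, (1 - q ^ (m + 1)) / (1 - q ^ (2 * m + 2)) *
      ((1 - q ^ (m + 1)) / (1 - q ^ (2 * m + 4))) ≤ 1 / (4 * q ^ (m + 2)) := by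
    intro m
    have a1 := one_sub_pow_pos h0 hq1 (m := m + 1) (by omega)
    have a2 := one_sub_pow_pos h0 hq1 (m := m + 2) (by omega)
    have a3 : q ^ (m + 2) ≤ q ^ (m + 1) := pow_le_pow_of_le_one h0.le hq1.le (by omega)
    have a4 : 0 < q ^ (m + 2) := by positivity
    have e1 : 1 - q ^ (2 * m + 2) = (1 - q ^ (m + 1)) * (1 + q ^ (m + 1)) := by ring
    have e2 : 1 - q ^ (2 * m + 4) = (1 - q ^ (m + 2)) * (1 + q ^ (m + 2)) := by ring
    rw [e1, e2, div_mul_div_comm]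
    generalize q ^ (m + 1) = y at *
    generalize q ^ (m + 2) = x at *
    have a5 : 0 < (1 - y) * (1 + y) * ((1 - x) * (1 + x)) := by
      have : 0 < y := by linarith
      positivity
    rw [div_le_div_iff₀ a5 (by positivity)]
    have b1 : 4 * x ≤ (1 + x) * (1 + y) := by nlinarith [sq_nonneg (1 - x)]
    calc (1 - y) * (1 - y) * (4 * x) ≤ (1 - y) * (1 - x) * ((1 + x) * (1 + y)) := by gcongr
      _ = 1 * ((1 - y) * (1 + y) * ((1 - x) * (1 + x))) := by ring
  have p1 := hpair (4 * k)
  have p2 := hpair (4 * k + 2)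
  have e1 : 2 * (4 * k) + 2 = 8 * k + 2 := by ring
  have e2 : 2 * (4 * k) + 4 = 8 * k + 4 := by ring
  have e3 : 2 * (4 * k + 2) + 2 = 8 * k + 6 := by ring
  have e4 : 2 * (4 * k + 2) + 4 = 8 * k + 8 := by ring
  rw [e1, e2] at p1
  rw [e3, e4] at p2
  -- The threshold 4/5 suffices because (4/5)³ = 0.512 > 1/2.
  have hq3 : 1 ≤ 2 * q ^ 3 := by
    have : (4 / 5 : ℝ) ^ 3 ≤ q ^ 3 := pow_le_pow_left₀ (by norm_num) hq.le 3
    norm_num at this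
    linarith
  rw [ratioB, abs_neg, abs_of_nonneg (mul_nonneg (mul_nonneg (mul_nonneg
    (mul_nonneg (by positivity) (hd _ _)) (hd _ _)) (mul_nonneg (hd _ _) (hd _ _)))
    (mul_nonneg (hd _ _) (hd _ _)))]
  calc _ ≤ q ^ (10 * k + 5) * (1 / (3 * q ^ (2 * k + 2))) * 1 * (1 / (4 * q ^ (4 * k + 2))) *
        (1 / (4 * q ^ (4 * k + 4))) := by
        refine mul_le_mul (mul_le_mul (mul_le_mul (mul_le_mul_of_nonneg_left h3 (by positivity))
          (hle (by omega) (by omega)) (hd _ _) (by positivity)) p1 (mul_nonneg (hd _ _) (hd _ _))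
          (by positivity)) p2 (mul_nonneg (hd _ _) (hd _ _)) (by positivity)
    _ = 1 / (48 * q ^ 3) := by
        field_simp
        ring
    _ ≤ 1 / 24 := by
        rw [div_le_div_iff₀ (by positivity) (by norm_num)]
        linarith

/-- All exponents m in the grouped differences add up to 180n + 45, and 0 ≤ 1 − q^m ≤ m(1 − q). -/
theorem abs_polyBReal_le {q : ℝ} (hq : 0 < q) (hq1 : q < 1) (n : ℕ) :
    |polyBReal q n| ≤ (180 * n + 45) * (1 - q) := by
  have h0 := one_sub_pow_nonneg hq hq1
  have h1 := one_sub_pow_le_mul hq hq1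
  have a1 := h1 (10 * n + 1)
  have a2 := h1 (12 * n + 2)
  have a3 := h1 (12 * n + 3)
  have a4 := h1 (14 * n + 2)
  have a5 := h1 (14 * n + 3)
  have a6 := h1 (16 * n + 3)
  have a7 := h1 (16 * n + 4)
  have a8 := h1 (18 * n + 4)
  have a9 := h1 (20 * n + 5)
  have b1 := h1 (2 * n + 1)
  have b2 := h1 (4 * n + 1)
  have b3 := h1 (4 * n + 2)
  have b4 := h1 (6 * n + 2)
  have b5 := h1 (6 * n + 3)
  have b6 := h1 (8 * n + 2)
  have b7 := h1 (8 * n + 3)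
  have b8 := h1 (10 * n + 4)
  push_cast at a1 a2 a3 a4 a5 a6 a7 a8 a9 b1 b2 b3 b4 b5 b6 b7 b8
  have hn : 0 ≤ (n : ℝ) * (1 - q) := mul_nonneg n.cast_nonneg (sub_pos.2 hq1).le
  rw [polyBReal, abs_le]
  constructor
  · linarith [h0 (10 * n + 1), h0 (12 * n + 2), h0 (12 * n + 3), h0 (14 * n + 2), h0 (14 * n + 3),
      h0 (16 * n + 3), h0 (16 * n + 4), h0 (18 * n + 4), h0 (20 * n + 5)]
  · linarith [h0 (2 * n + 1), h0 (4 * n + 1), h0 (4 * n + 2), h0 (6 * n + 2), h0 (6 * n + 3),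
      h0 (8 * n + 2), h0 (8 * n + 3), h0 (10 * n + 4)]

theorem norm_termA₀_div_le {q : ℝ} (hq : 4 / 5 < q) (hq1 : q < 1) (n : ℕ) :
    ‖termA₀ q n / (1 - q)‖ ≤ (8 * n + 1) * (2 / 9) ^ n := by
  have h0 : 0 < q := by linarith
  have hu : 0 < 1 - q := sub_pos.2 hq1
  have e : (1 : ℂ) - q = ((1 - q : ℝ) : ℂ) := by push_cast; rfl
  rw [termA₀_eq, e, ← Complex.ofReal_div, Complex.norm_real, Real.norm_eq_abs, abs_div,
    abs_of_pos hu, abs_mul, mul_div_right_comm]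
  refine mul_le_mul ?_ ?_ (abs_nonneg _) (by positivity)
  · rw [div_le_iff₀ hu, abs_of_nonneg (one_sub_pow_nonneg h0 hq1 _)]
    simpa using one_sub_pow_le_mul h0 hq1 (8 * n + 1)
  · rw [Finset.abs_prod]
    calc _ ≤ ∏ _k ∈ Finset.range n, (2 / 9 : ℝ) :=
          Finset.prod_le_prod (fun _ _ => abs_nonneg _) fun k _ => abs_ratioA_le hq hq1 k
      _ = _ := by rw [Finset.prod_const, Finset.card_range]

theorem norm_termB₀_div_le {q : ℝ} (hq : 4 / 5 < q) (hq1 : q < 1) (n : ℕ) :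
    ‖termB₀ q n / (1 - q)‖ ≤ (180 * n + 45) * (1 / 24) ^ n := by
  have h0 : 0 < q := by linarith
  have hu : 0 < 1 - q := sub_pos.2 hq1
  have e : (1 : ℂ) - q = ((1 - q : ℝ) : ℂ) := by push_cast; rfl
  rw [termB₀_eq, e, ← Complex.ofReal_div, Complex.norm_real, Real.norm_eq_abs, abs_div,
    abs_of_pos hu, abs_mul, mul_div_right_comm]
  refine mul_le_mul ?_ ?_ (abs_nonneg _) (by positivity)
  · rw [div_le_iff₀ hu, abs_div]
    refine (div_le_self (abs_nonneg _) ?_).trans (abs_polyBReal_le h0 hq1 n)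
    rw [abs_of_pos (by positivity)]
    have : ∀ m, 1 ≤ q ^ m + 1 := fun m => le_add_of_nonneg_left (by positivity)
    exact one_le_mul_of_one_le_of_one_le (one_le_mul_of_one_le_of_one_le (this _) (this _))
      (this _)
  · rw [Finset.abs_prod]
    calc _ ≤ ∏ _k ∈ Finset.range n, (1 / 24 : ℝ) :=
          Finset.prod_le_prod (fun _ _ => abs_nonneg _) fun k _ => abs_ratioB_le hq hq1 k
      _ = _ := by rw [Finset.prod_const, Finset.card_range]

theorem summable_linear_mul_geometric (a b : ℝ) {r : ℝ} (h0 : 0 ≤ r) (h1 : r < 1) :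
    Summable fun n : ℕ => (a * n + b) * r ^ n := by
  have hs := summable_pow_mul_geometric_of_norm_lt_one 1 (r := r)
    (by rwa [Real.norm_of_nonneg h0])
  have := (hs.mul_left a).add ((summable_geometric_of_lt_one h0 h1).mul_left b)
  refine this.congr fun n => ?_
  ring

/-! ### The q-Wallis product and the limit of the right-hand side. -/

/-- The `k`-th factor of the `q`-Wallis product is `1 + wallisTerm q k`. -/
noncomputable def wallisTerm (q : ℝ) (k : ℕ) : ℝ :=
  q ^ (2 * k + 1) * ((1 - q ^ 1) / (1 - q ^ (2 * k + 1))) * ((1 - q ^ 1) / (1 - q ^ (2 * k + 3)))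

/-- The arithmetic-geometric mean inequality for 1, q, …, q^(2j), whose geometric mean is q^j; the
induction adds the outer pair 1 + q^(2j+2) ≥ 2 q^(j+1). -/
theorem mul_pow_le_one_sub_pow {q : ℝ} (hq : 0 < q) (hq1 : q < 1) (j : ℕ) :
    (2 * j + 1) * q ^ j * (1 - q) ≤ 1 - q ^ (2 * j + 1) := by
  have key : (2 * j + 1) * q ^ j ≤ ∑ i ∈ Finset.range (2 * j + 1), q ^ i := by
    induction j with
    | zero => simp
    | succ j ih =>
      have e : 2 * (j + 1) + 1 = 2 * j + 1 + 1 + 1 := by ring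
      rw [e, Finset.sum_range_succ, Finset.sum_range_succ']
      simp only [pow_succ q (_ : ℕ)]
      rw [← Finset.sum_mul]
      have h1 := mul_le_mul_of_nonneg_right ih hq.le
      push_cast
      have e2 : q ^ (2 * j) * q * q = (q ^ j * q) ^ 2 := by ring
      rw [pow_zero, e2]
      nlinarith [sq_nonneg (1 - q ^ j * q)]
  rw [one_sub_pow_eq_mul_geom_sum, mul_comm (1 - q)]
  exact mul_le_mul_of_nonneg_right key (sub_pos.2 hq1).le

theorem wallisTerm_nonneg {q : ℝ} (hq : 0 < q) (hq1 : q < 1) (k : ℕ) : 0 ≤ wallisTerm q k :=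
  mul_nonneg (mul_nonneg (by positivity)
    (div_nonneg (one_sub_pow_nonneg hq hq1 _) (one_sub_pow_nonneg hq hq1 _)))
    (div_nonneg (one_sub_pow_nonneg hq hq1 _) (one_sub_pow_nonneg hq hq1 _))

/-- Uses the preceding inequality at j = k and j = k + 1, where q^k q^(k+1) matches the numerator.
The bound is also the limit as q → 1⁻, so it is a majorant free of q. -/
theorem wallisTerm_le {q : ℝ} (hq : 0 < q) (hq1 : q < 1) (k : ℕ) :
    wallisTerm q k ≤ 1 / ((2 * k + 1) * (2 * k + 3)) := by
  have h1 := mul_pow_le_one_sub_pow hq hq1 k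
  have h2 := mul_pow_le_one_sub_pow hq hq1 (k + 1)
  have e : 2 * (k + 1) + 1 = 2 * k + 3 := by ring
  rw [e] at h2
  push_cast at h2
  have p1 := one_sub_pow_pos hq hq1 (m := 2 * k + 1) (by omega)
  have p2 := one_sub_pow_pos hq hq1 (m := 2 * k + 3) (by omega)
  have hu := sub_pos.2 hq1
  have h3 := mul_le_mul h1 h2 (by positivity) p1.le
  have e3 : wallisTerm q k = q ^ (2 * k + 1) * (1 - q) ^ 2 /
      ((1 - q ^ (2 * k + 1)) * (1 - q ^ (2 * k + 3))) := by
    rw [wallisTerm, pow_one]; field_simp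
  rw [e3, div_le_div_iff₀ (by positivity) (by positivity)]
  calc _ = (2 * k + 1) * q ^ k * (1 - q) * ((2 * ((k : ℝ) + 1) + 1) * q ^ (k + 1) * (1 - q)) := by
        ring
    _ ≤ _ := h3
    _ = _ := by ring

theorem tendsto_wallisTerm (k : ℕ) :
    Tendsto (fun q => wallisTerm q k) (𝓝[<] 1) (𝓝 (1 / ((2 * k + 1) * (2 * k + 3)))) := by
  have h := ((tendsto_pow_one (2 * k + 1)).mul
    (tendsto_one_sub_pow_div_one_sub_pow 1 (l := 2 * k + 1) (by omega))).mul
    (tendsto_one_sub_pow_div_one_sub_pow 1 (l := 2 * k + 3) (by omega))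
  refine Eq.subst (motive := fun v => Tendsto (fun q => wallisTerm q k) (𝓝[<] 1) (𝓝 v)) ?_ h
  push_cast
  field_simp

theorem summable_wallis_bound : Summable fun k : ℕ => (1 : ℝ) / ((2 * k + 1) * (2 * k + 3)) := by
  have h := (summable_nat_add_iff 1).2 (Real.summable_one_div_nat_pow.2 (one_lt_two))
  refine Summable.of_nonneg_of_le (fun k => by positivity) (fun k => ?_) h
  push_cast
  rw [div_le_div_iff₀ (by positivity) (by positivity)]
  nlinarith [(Nat.cast_nonneg k : (0 : ℝ) ≤ k)]

theorem tprod_wallis : ∏' k : ℕ, (1 + (1 : ℝ) / ((2 * k + 1) * (2 * k + 3))) = Real.pi / 2 := by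
  have hm := Real.multipliable_one_add_of_summable summable_wallis_bound
  refine tendsto_nhds_unique hm.hasProd.tendsto_prod_nat ?_
  refine Real.tendsto_prod_pi_div_two.congr fun n => Finset.prod_congr rfl fun k _ => ?_
  field_simp
  ring

theorem tendsto_tprod_wallisTerm :
    Tendsto (fun q => ∏' k : ℕ, (1 + wallisTerm q k)) (𝓝[<] 1) (𝓝 (Real.pi / 2)) := by
  rw [← tprod_wallis]
  refine tendsto_tprod_one_add_of_dominated_convergence summable_wallis_bound
    tendsto_wallisTerm ?_
  filter_upwards [Ioo_mem_nhdsLT one_pos] with q hq k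
  rw [Real.norm_of_nonneg (wallisTerm_nonneg hq.1 hq.2 k)]
  exact wallisTerm_le hq.1 hq.2 k

/-- Each factor is (1−q^(2k+2))² / ((1−q^(2k+1))(1−q^(2k+3))), so the odd factors pair up except at
the two ends. -/
theorem prod_one_add_wallisTerm {q : ℝ} (hq : 0 < q) (hq1 : q < 1) (n : ℕ) :
    ((∏ k ∈ Finset.range n, (1 + wallisTerm q k) : ℝ) : ℂ) =
      (1 - q) * (qPoch ((q : ℂ) ^ 2) ((q : ℂ) ^ 2) n / qPoch q ((q : ℂ) ^ 2) n) ^ 2 /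
        (1 - q ^ (2 * n + 1)) := by
  induction n with
  | zero =>
    have h : (1 : ℂ) - q ≠ 0 := by exact_mod_cast (sub_pos.2 hq1).ne'
    simp [qPoch_zero, h]
  | succ n ih =>
    rw [Finset.prod_range_succ, Complex.ofReal_mul, ih]
    have h1 : (1 : ℂ) - (q : ℂ) ^ (2 * n + 1) ≠ 0 := by
      exact_mod_cast (one_sub_pow_pos hq hq1 (m := 2 * n + 1) (by omega)).ne'
    have h2 : (1 : ℂ) - (q : ℂ) ^ (2 * n + 3) ≠ 0 := by
      exact_mod_cast (one_sub_pow_pos hq hq1 (m := 2 * n + 3) (by omega)).ne'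
    have e1 : (1 : ℂ) - q * ((q : ℂ) ^ 2) ^ n = 1 - (q : ℂ) ^ (2 * n + 1) := by ring
    have e2 : (1 : ℂ) - (q : ℂ) ^ 2 * ((q : ℂ) ^ 2) ^ n = 1 - (q : ℂ) ^ (2 * n + 2) := by ring
    have e3 : 2 * (n + 1) + 1 = 2 * n + 3 := by ring
    have e4 : ((1 + wallisTerm q n : ℝ) : ℂ) = (1 - (q : ℂ) ^ (2 * n + 2)) ^ 2 /
        ((1 - (q : ℂ) ^ (2 * n + 1)) * (1 - (q : ℂ) ^ (2 * n + 3))) := by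
      rw [wallisTerm]
      push_cast
      rw [eq_div_iff (mul_ne_zero h1 h2)]
      field_simp
      ring
    rw [qPoch_succ, qPoch_succ, e1, e2, e3, e4]
    generalize (1 : ℂ) - (q : ℂ) ^ (2 * n + 1) = X at *
    generalize (1 : ℂ) - (q : ℂ) ^ (2 * n + 3) = Y at *
    simp only [div_eq_mul_inv, mul_inv]
    ring

theorem norm_sq_lt_one {q : ℝ} (hq : 0 < q) (hq1 : q < 1) : ‖(q : ℂ) ^ 2‖ < 1 := by
  rw [norm_pow]; exact pow_lt_one₀ (norm_nonneg _) (norm_ofReal_lt_one hq hq1) two_ne_zero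

theorem qGamma_half_sq {q : ℝ} (hq : 0 < q) (hq1 : q < 1) :
    qGamma (q ^ 2) (1 / 2) ^ 2 = (((1 + q) * ∏' k : ℕ, (1 + wallisTerm q k) : ℝ) : ℂ) := by
  have hn := norm_ofReal_lt_one hq hq1
  have hn2 := norm_sq_lt_one hq hq1
  have hs : Summable (wallisTerm q) := Summable.of_nonneg_of_le (wallisTerm_nonneg hq hq1)
    (wallisTerm_le hq hq1) summable_wallis_bound
  have hne : qPochInf q ((q : ℂ) ^ 2) ≠ 0 := qPochInf_ne_zero_of_norm_lt hn2 hn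
  have h1 := (Complex.continuous_ofReal.tendsto _).comp
    (Real.multipliable_one_add_of_summable hs).hasProd.tendsto_prod_nat
  have h2 : Tendsto (fun n : ℕ => (1 - (q : ℂ)) * (qPoch ((q : ℂ) ^ 2) ((q : ℂ) ^ 2) n /
      qPoch q ((q : ℂ) ^ 2) n) ^ 2 / (1 - (q : ℂ) ^ (2 * n + 1))) atTop
      (𝓝 ((1 - (q : ℂ)) * (qPochInf ((q : ℂ) ^ 2) ((q : ℂ) ^ 2) /
        qPochInf q ((q : ℂ) ^ 2)) ^ 2 / (1 - 0))) := by
    refine Tendsto.div (((tendsto_qPoch hn2 _).div (tendsto_qPoch hn2 _) hne).pow 2 |>.const_mul _)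
      (Tendsto.const_sub 1 ?_) (by norm_num)
    refine (tendsto_pow_atTop_nhds_zero_of_norm_lt_one hn).comp
      (tendsto_atTop_mono (fun n => ?_) tendsto_id)
    simp only [id]; omega
  have h3 := tendsto_nhds_unique (h1.congr fun n => prod_one_add_wallisTerm hq hq1 n) h2
  have hh : (((1 - q ^ 2 : ℝ) : ℂ) ^ (1 - 1 / 2 : ℂ)) ^ 2 = ((1 - q ^ 2 : ℝ) : ℂ) := by
    rw [← Complex.cpow_nat_mul]; norm_num
  rw [Complex.ofReal_mul, h3, qGamma, mul_pow, hh,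
    ofReal_sq_cpow hq (e := 1 / 2) 1 (by push_cast; ring), pow_one]
  push_cast
  ring

/-- Fixes the sign of the square root in `qGamma_half_eq`: the Wallis product only determines the
square of Γ_{q²}(1/2). -/
theorem exists_qPochInf_eq_ofReal {a q : ℝ} (ha1 : a ≤ 1) (hq : 0 < q)
    (hq1 : q < 1) : ∃ r : ℝ, 0 ≤ r ∧ qPochInf a q = r := by
  have h := tendsto_qPoch (norm_ofReal_lt_one hq hq1) a
  have e : ∀ n, qPoch a q n = ((∏ k ∈ Finset.range n, (1 - a * q ^ k) : ℝ) : ℂ) := fun n => by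
    rw [qPoch]; push_cast; rfl
  have hre := (Complex.continuous_re.tendsto _).comp h
  have him := (Complex.continuous_im.tendsto _).comp h
  have h0 : 0 ≤ (qPochInf a q).re := by
    refine ge_of_tendsto' hre fun n => ?_
    simp only [Function.comp, e, Complex.ofReal_re]
    exact Finset.prod_nonneg fun k _ => sub_nonneg.2
      (mul_le_one₀ ha1 (by positivity) (pow_le_one₀ hq.le hq1.le))
  have h1 : (qPochInf a q).im = 0 := by
    refine tendsto_nhds_unique him ?_
    simp only [Function.comp_def, e, Complex.ofReal_im]
    exact tendsto_const_nhds
  exact ⟨_, h0, Complex.ext rfl h1⟩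

theorem qGamma_half_eq {q : ℝ} (hq : 0 < q) (hq1 : q < 1) :
    qGamma (q ^ 2) (1 / 2) = ((√((1 + q) * ∏' k : ℕ, (1 + wallisTerm q k)) : ℝ) : ℂ) := by
  have hq2 : 0 < q ^ 2 := pow_pos hq 2
  have hq21 : q ^ 2 < 1 := pow_lt_one₀ hq.le hq1 two_ne_zero
  obtain ⟨r, hr, er⟩ := exists_qPochInf_eq_ofReal hq21.le hq2 hq21
  obtain ⟨s, hs, es⟩ := exists_qPochInf_eq_ofReal hq1.le hq2 hq21
  have e : qGamma (q ^ 2) (1 / 2) = ((r / s * (1 - q ^ 2) ^ (1 - 1 / 2 : ℝ) : ℝ) : ℂ) := by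
    rw [qGamma, ofReal_sq_cpow hq (e := 1 / 2) 1 (by push_cast; ring), pow_one, er, es,
      Complex.ofReal_mul, Complex.ofReal_cpow (sub_pos.2 hq21).le]
    push_cast
    rfl
  have h := qGamma_half_sq hq hq1
  rw [e] at h ⊢
  have h' : (r / s * (1 - q ^ 2) ^ (1 - 1 / 2 : ℝ)) ^ 2 =
      (1 + q) * ∏' k : ℕ, (1 + wallisTerm q k) := by exact_mod_cast h
  rw [← h', Real.sqrt_sq]
  have := (sub_pos.2 hq21).le
  positivity

theorem tendsto_qGamma_half :
    Tendsto (fun q : ℝ => qGamma (q ^ 2) (1 / 2)) (𝓝[<] 1) (𝓝 ((√Real.pi : ℝ) : ℂ)) := by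
  have h1 : Tendsto (fun q : ℝ => (1 + q) * ∏' k : ℕ, (1 + wallisTerm q k)) (𝓝[<] 1)
      (𝓝 ((1 + 1) * (Real.pi / 2))) :=
    ((tendsto_id.mono_left nhdsWithin_le_nhds).const_add 1).mul tendsto_tprod_wallisTerm
  have e : (1 + 1) * (Real.pi / 2) = Real.pi := by ring
  rw [e] at h1
  refine ((Complex.continuous_ofReal.tendsto _).comp h1.sqrt).congr' ?_
  filter_upwards [Ioo_mem_nhdsLT one_pos] with q hq
  exact (qGamma_half_eq hq.1 hq.2).symm

theorem tendsto_rhs₀ : Tendsto (fun q : ℝ => rhs₀ q / (1 - q)) (𝓝[<] 1)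
    (𝓝 ((2 * √3 / Real.pi : ℝ) : ℂ)) := by
  -- Γ_{q⁶}(1/2) is Γ_{q²}(1/2) with q³ in place of q.
  have hcube : Tendsto (fun q : ℝ => q ^ 3) (𝓝[<] 1) (𝓝[<] 1) := by
    refine tendsto_nhdsWithin_iff.2 ⟨tendsto_pow_one 3, ?_⟩
    filter_upwards [Ioo_mem_nhdsLT one_pos] with q hq
    exact pow_lt_one₀ hq.1.le hq.2 three_ne_zero
  have h6 := tendsto_qGamma_half.comp hcube
  have hnum : Tendsto (fun q : ℝ => (((1 + q) * √(q ^ 4 + q ^ 2 + 1) : ℝ) : ℂ)) (𝓝[<] 1)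
      (𝓝 ((2 * √3 : ℝ) : ℂ)) := by
    have hc : Continuous fun q : ℝ => (((1 + q) * √(q ^ 4 + q ^ 2 + 1) : ℝ) : ℂ) := by fun_prop
    have := (hc.tendsto 1).mono_left (nhdsWithin_le_nhds (s := Set.Iio 1))
    norm_num at this ⊢
    exact this
  have hpi : ((√Real.pi : ℝ) : ℂ) * ((√Real.pi : ℝ) : ℂ) = (Real.pi : ℂ) := by
    rw [← Complex.ofReal_mul, Real.mul_self_sqrt Real.pi_pos.le]
  have h := hnum.div (tendsto_qGamma_half.mul h6)
    (by rw [hpi]; exact_mod_cast Real.pi_ne_zero)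
  rw [hpi, ← Complex.ofReal_div] at h
  refine h.congr' ?_
  filter_upwards [self_mem_nhdsWithin] with q hq
  have hu : (1 : ℂ) - q ≠ 0 := by exact_mod_cast (sub_pos.2 hq).ne'
  have e6 : (q ^ 3) ^ 2 = q ^ 6 := by ring
  simp only [Pi.div_apply, Function.comp, e6, rhs₀]
  have e : (((1 - q ^ 2) * √(q ^ 4 + q ^ 2 + 1) : ℝ) : ℂ) =
      (1 - q) * (((1 + q) * √(q ^ 4 + q ^ 2 + 1) : ℝ) : ℂ) := by push_cast; ring
  rw [e, mul_div_assoc, mul_div_cancel_left₀ _ hu]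

/-! ### The classical evaluations. -/

/-- Tannery's theorem as q → 1⁻. The limit series inherits the majorant, so its convergence need not
be known beforehand. -/
theorem hasSum_of_tendsto_dominated {f : ℝ → ℕ → ℂ} {g : ℕ → ℂ} {F : ℝ → ℂ} {v : ℂ}
    {bound : ℕ → ℝ} (hb : Summable bound)
    (hf : ∀ n, Tendsto (fun q => f q n) (𝓝[<] 1) (𝓝 (g n)))
    (hbound : ∀ q : ℝ, 4 / 5 < q → q < 1 → ∀ n, ‖f q n‖ ≤ bound n)
    (hF : ∀ q : ℝ, 4 / 5 < q → q < 1 → HasSum (f q) (F q)) (hv : Tendsto F (𝓝[<] 1) (𝓝 v)) :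
    HasSum g v := by
  have hev : ∀ᶠ q : ℝ in 𝓝[<] 1, q ∈ Set.Ioo (4 / 5 : ℝ) 1 := Ioo_mem_nhdsLT (by norm_num)
  have h := tendsto_tsum_of_dominated_convergence hb hf
    (hev.mono fun q hq n => hbound q hq.1 hq.2 n)
  have h2 : Tendsto (fun q => ∑' n, f q n) (𝓝[<] 1) (𝓝 v) :=
    hv.congr' (hev.mono fun q hq => (hF q hq.1 hq.2).tsum_eq.symm)
  rw [← tendsto_nhds_unique h h2]
  refine (Summable.of_norm_bounded hb fun n => ?_).hasSum
  exact le_of_tendsto (hf n).norm (hev.mono fun q hq => hbound q hq.1 hq.2 n)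

theorem hasSum_classicalA : HasSum classicalA (2 * √3 / Real.pi) := by
  rw [← Complex.hasSum_ofReal]
  exact hasSum_of_tendsto_dominated
    (summable_linear_mul_geometric 8 1 (by norm_num) (by norm_num)) tendsto_termA₀
    (fun q h h1 => norm_termA₀_div_le h h1)
    (fun q h h1 => (specializations (by linarith) h1).1.div_const _) tendsto_rhs₀

theorem hasSum_classicalB : HasSum classicalB (16 / (√3 * Real.pi)) := by
  have h : HasSum (fun n => 3 / 8 * classicalB n) (2 * √3 / Real.pi) := by
    rw [← Complex.hasSum_ofReal]
    push_cast
    have := hasSum_of_tendsto_dominated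
      (summable_linear_mul_geometric 180 45 (by norm_num) (by norm_num)) tendsto_termB₀
      (fun q h h1 => norm_termB₀_div_le h h1)
      (fun q h h1 => (specializations (by linarith) h1).2.div_const _) tendsto_rhs₀
    push_cast at this
    exact this
  have h2 := h.mul_left (8 / 3)
  have e : 8 / 3 * (2 * √3 / Real.pi) = 16 / (√3 * Real.pi) := by
    have h3 : √3 * √3 = 3 := Real.mul_self_sqrt (by norm_num)
    have hs : √3 ≠ 0 := by positivity
    have hp := Real.pi_ne_zero
    field_simp
    linear_combination 16 * h3
  rw [e] at h2
  refine h2.congr_fun ?_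
  intro n
  ring

theorem mainTheorem6 :
    -- the two-variable formulas
    (∀ (q : ℝ), 0 < q → q < 1 → ∀ (b c : ℂ),
      (∀ j : ℕ, (q : ℂ) ^ (3 * c + 3 + 3 * j) ≠ 1) →
      (∀ j : ℕ, (q : ℂ) ^ (6 * b + 3 * c + 3 + 3 * j) ≠ 1) →
      (∀ j : ℕ, (q : ℂ) ^ (3 * b + 3 * c + 3 / 2 + 3 * j) ≠ 1) →
        -- the `8n+1` series
        (Summable (auxA q b) ∧
          HasSum (termA q b c)
            ((1 - q) * ((q : ℂ) ^ 2 + q + 1) ^ (3 * b + 3 * c + 1 / 2) *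
            qGamma (q ^ 3) (c + 1) * qGamma (q ^ 3) (b + c + 1 / 2) *
            qGamma (q ^ 3) (2 * b + c + 1) /
            (qGamma (q ^ 3) (1 / 3) * qGamma (q ^ 3) (2 / 3) *
            qGamma q (3 * b + 3 * c + 1 / 2)) *
            ∑' n, auxA q b n)) ∧
        HasSum (termA q b c)
          ((1 - q) * ((q : ℂ) ^ 2 + q + 1) ^ (3 * b + 3 * c + 1 / 2) *
            qGamma (q ^ 3) (c + 1) * qGamma (q ^ 3) (b + c + 1 / 2) *
            qGamma (q ^ 3) (2 * b + c + 1) /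
            (qGamma (q ^ 3) (1 / 2 - b) * qGamma (q ^ 3) (b + 1 / 2) *
            qGamma q (3 * b + 3 * c + 1 / 2))) ∧
        -- the `28n+3` series
        ((∀ n : ℕ, (q : ℂ) ^ (2 * b + 2 * c + 1) ≠ (q : ℂ) ^ (-b - c + 3 * n - 1 / 2)) →
          (Summable (auxB q b) ∧
            HasSum (fun n => (q : ℂ) ^ (-(5 / 2) : ℂ) * termB q b c n)
            ((1 - q) * ((q : ℂ) ^ 2 + q + 1) ^ (3 * b + 3 * c + 1 / 2) *
            qGamma (q ^ 3) (c + 1) * qGamma (q ^ 3) (b + c + 1 / 2) *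
            qGamma (q ^ 3) (2 * b + c + 1) /
            (qGamma (q ^ 3) (1 / 3) * qGamma (q ^ 3) (2 / 3) *
            qGamma q (3 * b + 3 * c + 1 / 2)) *
            ∑' n, auxB q b n)) ∧
          HasSum (termB q b c)
          ((q : ℂ) ^ (3 * b + 3) *
            ((1 - q) * ((q : ℂ) ^ 2 + q + 1) ^ (3 * b + 3 * c + 1 / 2) *
            qGamma (q ^ 3) (c + 1) * qGamma (q ^ 3) (b + c + 1 / 2) *
            qGamma (q ^ 3) (2 * b + c + 1)) /
            (qGamma (q ^ 3) (1 / 2 - b) * qGamma (q ^ 3) (b + 1 / 2) *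
            qGamma q (3 * b + 3 * c + 1 / 2))))) ∧
    -- the case `b = c = 0`, with `q ^ 2` in place of `q`
    (∀ (q : ℝ), 0 < q → q < 1 →
      HasSum (fun n => termA₀ q n) (rhs₀ q) ∧ HasSum (fun n => termB₀ q n) (rhs₀ q)) ∧
    -- these are `q`-analogues: as `q → 1⁻`, summands and values tend to the classical ones
    (∀ n : ℕ, Tendsto (fun q : ℝ => termA₀ q n / (1 - q)) (𝓝[<] 1) (𝓝 (classicalA n))) ∧
    (∀ n : ℕ, Tendsto (fun q : ℝ => termB₀ q n / (1 - q)) (𝓝[<] 1)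
      (𝓝 (3 / 8 * classicalB n))) ∧
    Tendsto (fun q : ℝ => rhs₀ q / (1 - q)) (𝓝[<] 1) (𝓝 ((2 * √3 / Real.pi : ℝ) : ℂ)) ∧
    HasSum classicalA (2 * √3 / Real.pi) ∧
    HasSum classicalB (16 / (√3 * Real.pi)) := by
  exact ⟨fun q hq hq1 b c h1 h2 h3 => two_variable_formulas hq hq1 h1 h2 h3,
    fun q hq hq1 => specializations hq hq1, tendsto_termA₀, tendsto_termB₀, tendsto_rhs₀,
    hasSum_classicalA, hasSum_classicalB⟩
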